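/- **Fusion rule (II).** *Parameters.* Let $q_1,q_2,q_3\in\mathbb C$ with $q_1q_2q_3=1$ be generic: $q_1^Lq_2^Mq_3^N=1$ with $L,M,N\in\mathbb Z$ only if $L=M=N$. Fix fourth roots $q_i^{1/4}$ such that the square roots $q_i^{1/2}:=(q_i^{1/4})^2$ satisfy $q_1^{1/2}q_2^{1/2}q_3^{1/2}=1$; all fractional powers are powers of these. Let $c=(c_1,\dots,c_n)\in\{1,2,3\}^n$, $u_1,\dots,u_n\in\mathbb C$, $q_c:=\prod_i q_{c_i}$, $q_c^{1/2}:=\prod_iq_{c_i}^{1/2}$, with $q_c\neq1$ and such that there is $\varepsilon>0$ with $|q_c^k-1|\ge\varepsilon^k$ for all $k\ge1$ (automatic if $|q_c|\ne1$; it makes the series below converge). For $0<|p|<1$ let $\theta_p(x)=\prod_{k\ge0}(1-p^kx)(1-p^{k+1}x^{-1})$ and $\kappa_k=\prod_{i=1}^3(q_i^k-1)$. *Fock space.* Let $\mathcal H$ be the Fock space (polynomials in the creation operators applied to a vacuum) of commuting pairs of bosons $a^{(i)}_{\pm k},b^{(i)}_{\pm k}$ ($1\le i\le n$, $k\ge1$)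 with $$[a^{(i)}_k,a^{(i)}_{-k}]=\frac{k}{\kappa_k}\bigl(q_{c_i}^{k/2}-q_{c_i}^{-k/2}\bigr)(1-p^k),\qquad [b^{(i)}_k,b^{(i)}_{-k}]=\frac{k}{\kappa_k}\bigl(q_{c_i}^{k/2}-q_{c_i}^{-k/2}\bigr)\frac{1-p^k}{p^k},$$ all other commutators being zero. Put $L_i=\prod_{l<i}q_{c_l}^{1/2}$, $R_i=\prod_{l>i}q_{c_l}^{1/2}$, $\nu_k=\frac{\kappa_k}{k(1-p^k)}$, $d_k=q_c^{k/2}-q_c^{-k/2}$. The decoupled elliptic vertex operators are $\widetilde\Lambda_j(z)=\alpha(z)\Lambda_j(z)\beta(z)$, where, writing $q=q_{c_i}$ inside the sums, $$\begin{aligned}\Lambda_j(z)=u_j&\exp\sum_{i<j}\sum_{k\ge1}\nu_k\bigl(p^kq^{k/4}(L_iq^{1/2}z)^{-k}b^{(i)}_{-k}-q^{-k/4}(L_iq^{1/2}z)^ka^{(i)}_{-k}\bigr)\\ \times&\exp\sum_{i=j}\sum_{k\ge1}\frac{\nu_k}{q^{k/2}-q^{-k/2}}\bigl(p^kq^{k/4}(L_iz)^{-k}b^{(i)}_{-k}+q^{-k/4}(L_iz)^ka^{(i)}_{-k}\bigr)\\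 \times&\exp\sum_{i=j}\sum_{k\ge1}\nu_k\Bigl(\frac{p^kq^{-k/4}}{q^{-k}-1}(L_iz)^kb^{(i)}_k-\frac{q^{k/4}}{q^k-1}(L_iz)^{-k}a^{(i)}_k\Bigr),\end{aligned}$$ $$\alpha(z)=\exp\Bigl(-\sum_{i=1}^n\sum_{k\ge1}\frac{\nu_k}{d_k}\bigl(q^{-k/4}R_i^{-k}z^ka^{(i)}_{-k}+p^kq^{k/4}R_i^kz^{-k}b^{(i)}_{-k}\bigr)\Bigr),$$ $$\beta(z)=\exp\Bigl(\sum_{i=1}^n\sum_{k\ge1}\frac{\nu_k}{d_k}\bigl(q_c^{-k/2}q^{k/4}L_i^kz^{-k}a^{(i)}_k+p^kq_c^{k/2}q^{-k/4}L_i^{-k}z^kb^{(i)}_k\bigr)\Bigr).$$ *Currents.* With $\Theta(x)_k=\prod_{0\le j<k}\theta_p(q_3^jx)$ and $:\ :$ the normal ordering, which puts creation operators to the left, the currents $\widetilde T_m(z;p)$ are defined by the Miura transformation $:R_1(z)\cdots R_n(z):\ =\sum_{m\ge0}(-1)^m\widetilde T_m(z;p)\,q_3^{-mD_z}$, where $q_3^{D_z}g(z)=g(q_3z)$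 and $$R_i(z)=\sum_{k\ge0}(-1)^kq_3^{k^2/2}q_{c_i}^{-k/2}\frac{\Theta(q_3^{1-k}q_{c_i})_k}{\Theta(q_3)_k}:\widetilde\Lambda_i(z)\widetilde\Lambda_i(q_3^{-1}z)\cdots\widetilde\Lambda_i(q_3^{-(k-1)}z):\,q_3^{-kD_z}.$$ *Structure function.* For $r\le m$ let $f_{r,m}(x;p)=\exp\bigl(\sum_{k\ge1}\frac{x^k}{1-p^k}\phi_k\bigr)\exp\bigl(\sum_{k\ge1}\frac{p^kx^{-k}}{1-p^k}\phi_k\bigr)$ with $$\phi_k=\frac1k\bigl(q_3^{rk/2}-q_3^{-rk/2}\bigr)\bigl(q_c^{k/2}q_3^{-mk/2}-q_c^{-k/2}q_3^{mk/2}\bigr)\frac{(q_1^{k/2}-q_1^{-k/2})(q_2^{k/2}-q_2^{-k/2})}{(q_c^{k/2}-q_c^{-k/2})(q_3^{k/2}-q_3^{-k/2})}.$$ *Theorem.* Let $1\le r\le m$. Call $p$ admissible if $0<|p|<1$ and $q_3^l\notin p^{\mathbb Z}$ for $1\le l\le m+r$, and let $\Omega$ be the set of $(p,z,w)$ with $p$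 admissible, $z,w\ne0$ and $q_3^jw/z\notin p^{\mathbb Z}$ for all integers $-m\le j\le r$. There is $\rho>0$ such that every matrix element (in the monomial basis of $\mathcal H$) of $$f_{r,m}\bigl(q_3^{\frac{r-m}2}\tfrac wz;p\bigr)\,\widetilde T_r(z;p)\,\widetilde T_m(w;p)$$ is given by absolutely convergent series (those defining $f_{r,m}$ and the sum over intermediate basis states) at all $(p,z,w)\in\Omega$ with $|w/z|<\rho$, $|pz/w|<\rho$, and extends from there to a function on $\Omega$ that is holomorphic in each of the variables $p,z,w$. For this extension, for every admissible $p$ and every $w\neq0$, in the sense of matrix elements, $$\lim_{z\to q_3^{-m}w}\theta_p\Bigl(q_3^{-m}\frac wz\Bigr)f_{r,m}\Bigl(q_3^{\frac{r-m}2}\frac wz;p\Bigr)\widetilde T_r(z;p)\widetilde T_m(w;p)=\frac{\theta_p(q_1^{-1})\theta_p(q_2^{-1})}{\theta_p(q_3)}\prod_{l=1}^{r-1}\frac{\theta_p(q_2q_3^{-l})\,\theta_p(q_1q_3^{-l})}{\theta_p(q_3^{-l-1})\,\theta_p(q_3^{-l})}\;\widetilde T_{m+r}(w;p).$$ -/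

import Mathlib

open Filter Topology

noncomputable section

namespace EllipticCorner

/-! ### Theta functions -/

/-- The theta function `θ_p(x) = (x;p)_∞ (p x⁻¹;p)_∞`, used for `0 < |p| < 1` and `x ≠ 0`. -/
def theta (p x : ℂ) : ℂ :=
  (∏' k : ℕ, (1 - p ^ k * x)) * ∏' k : ℕ, (1 - p ^ k * (p * x⁻¹))

/-- `Θ(x;q,p)_k = Γ(q^k x;q,p) / Γ(x;q,p) = ∏_{0 ≤ j < k} θ_p(q^j x)` for `k ≥ 0`. -/
def thetaShift (p q x : ℂ) (k : ℕ) : ℂ :=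
  ∏ j ∈ Finset.range k, theta p (q ^ j * x)

/-! ### Parameters

The colours `1, 2, 3` are the elements `0, 1, 2` of `Fin 3`. -/

/-- The numerical data: fourth roots `s i = q_i^{1/4}` of the three parameters, the colours
`c = (c_1, …, c_n)` of the tensor factors, and the spectral parameters `u = (u_1, …, u_n)`. -/
structure Data (n : ℕ) where
  s : Fin 3 → ℂ
  c : Fin n → Fin 3
  u : Fin n → ℂ

variable {n : ℕ}

namespace Data

/-- `q_i` -/
def q (D : Data n) (i : Fin 3) : ℂ := D.s i ^ 4

/-- `q_i^{1/2}` -/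
def qh (D : Data n) (i : Fin 3) : ℂ := D.s i ^ 2

/-- `q_c = ∏ q_{c_i}` -/
def qc (D : Data n) : ℂ := ∏ i, D.q (D.c i)

/-- `q_c^{1/2} = ∏ q_{c_i}^{1/2}`, the value of the central element `C` on the whole tensor
product. -/
def qch (D : Data n) : ℂ := ∏ i, D.qh (D.c i)

/-- `κ_k = (q_1^k - 1) (q_2^k - 1) (q_3^k - 1)` -/
def kap (D : Data n) (k : ℕ) : ℂ := ∏ i, (D.q i ^ k - 1)

/-- `∏_{l < i} q_{c_l}^{1/2}`, the value of `C_1 ⋯ C_{i-1}` -/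
def left (D : Data n) (i : Fin n) : ℂ := ∏ l ∈ Finset.Iio i, D.qh (D.c l)

/-- `∏_{l > i} q_{c_l}^{1/2}`, the value of `C_{i+1} ⋯ C_n` -/
def right (D : Data n) (i : Fin n) : ℂ := ∏ l ∈ Finset.Ioi i, D.qh (D.c l)

end Data

/-! ### Fock space -/

/-- The oscillator modes of `H^{(c_1)} ⊗ ⋯ ⊗ H^{(c_n)}`: `inl (i, k)` is the `k`-th mode of the
bosons `a^{(c_i)}` of the `i`-th tensor factor, `inr (i, k)` that of the bosons `b^{(c_i)}`. -/
abbrev Mode (n : ℕ) : Type := (Fin n × ℕ+) ⊕ (Fin n × ℕ+)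

/-- The Fock space: polynomials in the creation modes, with vacuum `1`. The creation operator
`a_{-k}` (or `b_{-k}`) of the mode `M` is multiplication by `X M`, the annihilation operator `a_k`
(or `b_k`) is `comm M • ∂/∂(X M)`. -/
abbrev Fock (n : ℕ) : Type := MvPolynomial (Mode n) ℂ

/-- The completed Fock space, in which vertex operators at a point take values. -/
abbrev FockHat (n : ℕ) : Type := MvPowerSeries (Mode n) ℂ

namespace Data

variable (D : Data n) (p : ℂ)

/-- The commutators `[a_k, a_{-k}]` and `[b_k, b_{-k}]` of the elliptic Heisenberg algebras. -/
def comm : Mode n → ℂ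
  | .inl (i, k) => k / D.kap k * (D.qh (D.c i) ^ (k : ℕ) - (D.qh (D.c i) ^ (k : ℕ))⁻¹)
      * (1 - p ^ (k : ℕ))
  | .inr (i, k) => k / D.kap k * (D.qh (D.c i) ^ (k : ℕ) - (D.qh (D.c i) ^ (k : ℕ))⁻¹)
      * ((1 - p ^ (k : ℕ)) / p ^ (k : ℕ))

/-- `exp(∑_M A_M · (creation operator of M))` applied to the vacuum:
its coefficient at `∏_M X_M^{ν_M}` is `∏_M A_M^{ν_M} / ν_M!`. -/
def expCre (A : Mode n → ℂ) : FockHat n :=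
  fun ν => ν.prod fun M k => A M ^ k / (k.factorial : ℂ)

/-- `exp(∑_M B_M · (annihilation operator of M)) = exp(∑_M B_M (comm M) ∂/∂(X M))`, which by
Taylor's formula is the translation `X M ↦ X M + B_M (comm M)`. -/
def expAnn (B : Mode n → ℂ) : Fock n →ₐ[ℂ] Fock n :=
  MvPolynomial.aeval fun M => MvPolynomial.X M + MvPolynomial.C (B M * D.comm p M)

/-- The normally ordered exponential `exp(∑ A_M · creation) exp(∑ B_M · annihilation)`. -/
def expOp (A B : Mode n → ℂ) (v : Fock n) : FockHat n :=
  expCre A * (D.expAnn p B v : FockHat n)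

/-! ### Vertex operators -/

/-- Creation exponents of
`Λ_j(z) = u_j φ⁻(C_1 z) ⊗ ⋯ ⊗ φ⁻(C_1 ⋯ C_{j-1} z) ⊗ η(C_1 ⋯ C_{j-1} z) ⊗ 1 ⊗ ⋯ ⊗ 1`. -/
def lamCre (j : Fin n) (z : ℂ) : Mode n → ℂ
  | .inl (i, k) =>
      if i < j then
        -(1 / (1 - p ^ (k : ℕ)) * (D.kap k / k) * (D.s (D.c i) ^ (k : ℕ))⁻¹)
          * (D.left i * D.qh (D.c i) * z) ^ (k : ℕ)
      else if i = j then
        1 / (1 - p ^ (k : ℕ)) * (D.kap k / k)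
          * ((D.s (D.c i) ^ (k : ℕ))⁻¹
              / (D.qh (D.c i) ^ (k : ℕ) - (D.qh (D.c i) ^ (k : ℕ))⁻¹))
          * (D.left i * z) ^ (k : ℕ)
      else 0
  | .inr (i, k) =>
      if i < j then
        p ^ (k : ℕ) / (1 - p ^ (k : ℕ)) * (D.kap k / k) * D.s (D.c i) ^ (k : ℕ)
          * ((D.left i * D.qh (D.c i) * z) ^ (k : ℕ))⁻¹
      else if i = j then
        p ^ (k : ℕ) / (1 - p ^ (k : ℕ)) * (D.kap k / k)
          * (D.s (D.c i) ^ (k : ℕ)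
              / (D.qh (D.c i) ^ (k : ℕ) - (D.qh (D.c i) ^ (k : ℕ))⁻¹))
          * ((D.left i * z) ^ (k : ℕ))⁻¹
      else 0

/-- Annihilation exponents of `Λ_j(z)`; only the factor `η` in position `j` contributes. -/
def lamAnn (j : Fin n) (z : ℂ) : Mode n → ℂ
  | .inl (i, k) =>
      if i = j then
        -(1 / (1 - p ^ (k : ℕ)) * (D.kap k / k)
          * (D.s (D.c i) ^ (k : ℕ) / (D.q (D.c i) ^ (k : ℕ) - 1)))
          * ((D.left i * z) ^ (k : ℕ))⁻¹
      else 0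
  | .inr (i, k) =>
      if i = j then
        p ^ (k : ℕ) / (1 - p ^ (k : ℕ)) * (D.kap k / k)
          * ((D.s (D.c i) ^ (k : ℕ))⁻¹ / ((D.q (D.c i) ^ (k : ℕ))⁻¹ - 1))
          * (D.left i * z) ^ (k : ℕ)
      else 0

/-- The images of the generators `b̃_{-k}` (on `inl`) and `b̃'_{-k}` (on `inr`), as coefficients
of the creation operators. They are read off from
`K⁻(z) = exp(-∑ b̃_{-k} z^k) exp(∑ b̃'_{-k} z^{-k})`, which acts on the tensor product as
`⊗_i φ⁻((C_{i+1} ⋯ C_n)⁻¹ z)`. -/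
def bNeg : Mode n → ℂ
  | .inl (i, k) => 1 / (1 - p ^ (k : ℕ)) * (D.kap k / k) * (D.s (D.c i) ^ (k : ℕ))⁻¹
      * (D.right i ^ (k : ℕ))⁻¹
  | .inr (i, k) => p ^ (k : ℕ) / (1 - p ^ (k : ℕ)) * (D.kap k / k) * D.s (D.c i) ^ (k : ℕ)
      * D.right i ^ (k : ℕ)

/-- The images of the generators `b̃_k` (on `inl`) and `b̃'_k` (on `inr`), as coefficients of
the annihilation operators. They are read off from
`K⁺(z) = exp(∑ b̃_k C^k z^{-k}) exp(-∑ b̃'_k C^{-k} z^k)`, which acts on the tensor product as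
`⊗_i φ⁺((C_1 ⋯ C_{i-1})⁻¹ z)`, where `φ⁺(z) = exp(-∑ p^k/(1-p^k) κ_k/k q^{-k/4} b_k z^k)
exp(∑ 1/(1-p^k) κ_k/k q^{k/4} a_k z^{-k})`. -/
def bPos : Mode n → ℂ
  | .inl (i, k) => (D.qch ^ (k : ℕ))⁻¹ * (1 / (1 - p ^ (k : ℕ)) * (D.kap k / k)
      * D.s (D.c i) ^ (k : ℕ) * D.left i ^ (k : ℕ))
  | .inr (i, k) => D.qch ^ (k : ℕ) * (p ^ (k : ℕ) / (1 - p ^ (k : ℕ)) * (D.kap k / k)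
      * (D.s (D.c i) ^ (k : ℕ))⁻¹ * (D.left i ^ (k : ℕ))⁻¹)

/-- Exponents of
`α(z) = exp(-∑ b̃_{-k} z^k / (C^k - C^{-k})) exp(-∑ b̃'_{-k} z^{-k} / (C^k - C^{-k}))`. -/
def alphaCre (z : ℂ) : Mode n → ℂ
  | .inl (i, k) => -(1 / (D.qch ^ (k : ℕ) - (D.qch ^ (k : ℕ))⁻¹))
      * D.bNeg p (.inl (i, k)) * z ^ (k : ℕ)
  | .inr (i, k) => -(1 / (D.qch ^ (k : ℕ) - (D.qch ^ (k : ℕ))⁻¹))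
      * D.bNeg p (.inr (i, k)) * (z ^ (k : ℕ))⁻¹

/-- Exponents of
`β(z) = exp(∑ b̃_k z^{-k} / (C^k - C^{-k})) exp(∑ b̃'_k z^k / (C^k - C^{-k}))`. -/
def betaAnn (z : ℂ) : Mode n → ℂ
  | .inl (i, k) => 1 / (D.qch ^ (k : ℕ) - (D.qch ^ (k : ℕ))⁻¹)
      * D.bPos p (.inl (i, k)) * (z ^ (k : ℕ))⁻¹
  | .inr (i, k) => 1 / (D.qch ^ (k : ℕ) - (D.qch ^ (k : ℕ))⁻¹)
      * D.bPos p (.inr (i, k)) * z ^ (k : ℕ)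

/-- Creation exponents of the decoupled vertex operator `Λ̃_j(z) = α(z) Λ_j(z) β(z)`. -/
def decCre (j : Fin n) (z : ℂ) (M : Mode n) : ℂ := D.alphaCre p z M + D.lamCre p j z M

/-- Annihilation exponents of the decoupled vertex operator `Λ̃_j(z) = α(z) Λ_j(z) β(z)`. -/
def decAnn (j : Fin n) (z : ℂ) (M : Mode n) : ℂ := D.lamAnn p j z M + D.betaAnn p z M

end Data

/-! ### Normally ordered products and currents -/

/-- Formal expressions inside a normal ordering sign: polynomials in commuting symbols,
`X (j, ζ)` standing for `Λ̃_j(ζ)`. -/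
abbrev Sym (n : ℕ) : Type := MvPolynomial (Fin n × ℂ) ℂ

/-- Series `∑_k X_k(z) q_3^{-k D_z}` with coefficients inside a normal ordering sign. -/
abbrev ShiftSeries (n : ℕ) : Type := ℕ → ℂ → Sym n

namespace Data

variable (D : Data n) (p : ℂ)

/-- The normally ordered product `:∏ Λ̃_j(ζ)^{e(j,ζ)}:`, in which all creation operators stand to
the left of all annihilation operators. -/
def nordMonomial (e : (Fin n × ℂ) →₀ ℕ) (v : Fock n) : FockHat n :=
  (e.prod fun x k => D.u x.1 ^ k) •
    D.expOp p (fun M => e.sum fun x k => (k : ℂ) * D.decCre p x.1 x.2 M)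
      (fun M => e.sum fun x k => (k : ℂ) * D.decAnn p x.1 x.2 M) v

/-- The operator `:P:` of a formal expression `P`. -/
def nord (P : Sym n) (v : Fock n) : FockHat n :=
  ∑ e ∈ P.support, P.coeff e • D.nordMonomial p e v

/-- Product of shift series, from `q_3^{-k D_z} Y(z) = Y(q_3^{-k} z) q_3^{-k D_z}`. -/
def shiftMul (S T : ShiftSeries n) : ShiftSeries n :=
  fun m z => ∑ kl ∈ Finset.HasAntidiagonal.antidiagonal m, S kl.1 z * T kl.2 ((D.q 2 ^ kl.1)⁻¹ * z)

/-- The Miura factor `R_i^{(c_i)}(z)`: the coefficient of `q_3^{-k D_z}` is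
`(-1)^k q_3^{k²/2} q_{c_i}^{-k/2} Θ(q_3^{1-k} q_{c_i};q_3,p)_k / Θ(q_3;q_3,p)_k`
times `Λ̃_i(z) Λ̃_i(q_3⁻¹ z) ⋯ Λ̃_i(q_3^{-(k-1)} z)`. -/
def miuraFactor (i : Fin n) : ShiftSeries n := fun k z =>
  MvPolynomial.C ((-1) ^ k * D.qh 2 ^ (k ^ 2) * (D.qh (D.c i) ^ k)⁻¹
      * (thetaShift p (D.q 2) (D.q 2 ^ (1 - (k : ℤ)) * D.q (D.c i)) k
          / thetaShift p (D.q 2) (D.q 2) k))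
    * ∏ j ∈ Finset.range k, MvPolynomial.X (i, (D.q 2 ^ j)⁻¹ * z)

/-- `R_1(z) R_2(z) ⋯ R_n(z)` -/
def miura : ShiftSeries n :=
  (List.ofFn (D.miuraFactor p)).foldr D.shiftMul (fun k _ => if k = 0 then 1 else 0)

/-- The decoupled current `T̃_m(z)`, as an operator from the Fock space to its completion, from
`:R_1(z) ⋯ R_n(z): = ∑_m (-1)^m T̃_m(z) q_3^{-m D_z}`. -/
def current (m : ℕ) (z : ℂ) (v : Fock n) : FockHat n :=
  D.nord p ((-1) ^ m * D.miura p m z) v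

end Data

/-- Matrix element `⟨μ| S |ν⟩` in the monomial basis of the Fock space. -/
def entry (S : Fock n → FockHat n) (mu nu : Mode n →₀ ℕ) : ℂ :=
  MvPowerSeries.coeff mu (S (MvPolynomial.monomial nu 1))

/-- The matrix element `⟨μ| S T |λ⟩` of a product converges, as a sum over intermediate states. -/
def ProdConverges (S T : Fock n → FockHat n) (mu lam : Mode n →₀ ℕ) : Prop :=
  Summable fun nu => entry S mu nu * entry T nu lam

/-- The matrix element `⟨μ| S T |λ⟩ = ∑_ν ⟨μ| S |ν⟩ ⟨ν| T |λ⟩` of a product. -/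
def prodEntry (S T : Fock n → FockHat n) (mu lam : Mode n →₀ ℕ) : ℂ :=
  ∑' nu, entry S mu nu * entry T nu lam

/-! ### The structure function -/

namespace Data

variable (D : Data n) (p : ℂ)

/-- The coefficient
`(1/k) (q_3^{rk/2} - q_3^{-rk/2}) (q_c^{k/2} q_3^{-mk/2} - q_c^{-k/2} q_3^{mk/2})
(q_1^{k/2} - q_1^{-k/2}) (q_2^{k/2} - q_2^{-k/2})
/ ((q_c^{k/2} - q_c^{-k/2}) (q_3^{k/2} - q_3^{-k/2}))`. -/
def fCoeff (r m k : ℕ) : ℂ :=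
  1 / k * (D.qh 2 ^ (r * k) - (D.qh 2 ^ (r * k))⁻¹)
    * (D.qch ^ k * (D.qh 2 ^ (m * k))⁻¹ - (D.qch ^ k)⁻¹ * D.qh 2 ^ (m * k))
    * ((D.qh 0 ^ k - (D.qh 0 ^ k)⁻¹) * (D.qh 1 ^ k - (D.qh 1 ^ k)⁻¹)
      / ((D.qch ^ k - (D.qch ^ k)⁻¹) * (D.qh 2 ^ k - (D.qh 2 ^ k)⁻¹)))

/-- Term of index `k ≥ 1` of the first series in the exponent of `f_{r,m}(x;p)`, `r ≤ m`. -/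
def fTermPos (r m : ℕ) (x : ℂ) (k : ℕ+) : ℂ :=
  x ^ (k : ℕ) * (1 / (1 - p ^ (k : ℕ))) * D.fCoeff r m k

/-- Term of index `k ≥ 1` of the second series in the exponent of `f_{r,m}(x;p)`, `r ≤ m`. -/
def fTermNeg (r m : ℕ) (x : ℂ) (k : ℕ+) : ℂ :=
  (x ^ (k : ℕ))⁻¹ * (p ^ (k : ℕ) / (1 - p ^ (k : ℕ))) * D.fCoeff r m k

/-- Both series defining `f_{r,m}(x;p)` converge. -/
def FConverges (r m : ℕ) (x : ℂ) : Prop :=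
  Summable (D.fTermPos p (min r m) (max r m) x) ∧ Summable (D.fTermNeg p (min r m) (max r m) x)

/-- The structure function `f_{r,m}(x;p) = f_{m,r}(x;p)`. -/
def f (r m : ℕ) (x : ℂ) : ℂ :=
  Complex.exp (∑' k, D.fTermPos p (min r m) (max r m) x k)
    * Complex.exp (∑' k, D.fTermNeg p (min r m) (max r m) x k)

/-! ### Domains -/

/-- `0 < |p| < 1` and `q_3^l` is not an integral power of `p` for `1 ≤ l ≤ N`, that is,
`θ_p(q_3^l) ≠ 0` for these `l`. -/
def Nome (N : ℕ) : Prop :=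
  0 < ‖p‖ ∧ ‖p‖ < 1 ∧ ∀ l : ℕ, 1 ≤ l → l ≤ N → ∀ k : ℤ, D.q 2 ^ l ≠ p ^ k

/-- The domain of the continued product of `T̃_r(z;p)` and `T̃_m(w;p)`: `z, w ≠ 0`, the nome is
generic, and `θ_p(q_3^j w/z) ≠ 0` for `-m ≤ j ≤ r`. -/
def Regular (r m : ℕ) (z w : ℂ) : Prop :=
  D.Nome p (m + r) ∧ z ≠ 0 ∧ w ≠ 0 ∧
    ∀ j : ℤ, -(m : ℤ) ≤ j → j ≤ r → ∀ k : ℤ, D.q 2 ^ j * (w / z) ≠ p ^ k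

/-- The constant
`θ_p(q_1⁻¹) θ_p(q_2⁻¹) / θ_p(q_3)
∏_{1 ≤ l ≤ r-1} θ_p(q_2 q_3^{-l}) θ_p(q_1 q_3^{-l}) / (θ_p(q_3^{-l-1}) θ_p(q_3^{-l}))`. -/
def fusionConst (r : ℕ) : ℂ :=
  theta p ((D.q 0)⁻¹) * theta p ((D.q 1)⁻¹) / theta p (D.q 2)
    * ∏ l ∈ Finset.Icc 1 (r - 1),
        theta p (D.q 1 * (D.q 2 ^ l)⁻¹) * theta p (D.q 0 * (D.q 2 ^ l)⁻¹)
          / (theta p ((D.q 2 ^ (l + 1))⁻¹) * theta p ((D.q 2 ^ l)⁻¹))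

end Data

end EllipticCorner

end

open Filter Topology

noncomputable section

namespace EllipticCorner

/-! The proof turns the infinite-mode product into a finite sum of theta quotients and reads off its
pole at `x = w/z = q_3^m`.

Expanding the Miura product, each current is a finite sum, over compositions of its degree into `n`
parts, of a scalar times one normally ordered exponential (`current_eq`). The product of two such
exponentials is a third one times `exp` of a contraction (`hasSum_entry_expOp`, Wick's theorem),
provided the contraction converges absolutely over the modes. In the contraction of `Λ̃_i(z)` and
`Λ̃_j(w)` the sum over tensor factors telescopes, leaving the coefficient `κ_k/k · (1/(q_c^k - 1) +
[i<j] - [i=j]/(q_{c_i}^k - 1))` of `x^k/(1-p^k)` (`sum_modeCoef`). The `b` bosons give the same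
expression for the inverted parameters (`dual`), with `x` replaced by `p/x`.

The structure function is designed to cancel the term `1/(q_c^k - 1)`. Distributed over the letters
of the first composition, it combines with the geometric sums over the letters of the second one,
and each letter retains only the data of the block of its own tensor factor (`rowCoef_eq`). For
colours 1 and 2, and for an empty block of colour 3, this is a signed sum of four pure powers, the
logarithm of a quotient of four thetas. For colour 3 a one-letter block contributes nothing, and
longer blocks have Miura coefficient zero. Hence `f_{r,m}` times the exponentiated contraction is
the finite product `wordTheta` (`f_mul_exp_contraction`), and the finite sum `continuation` is the
required extension.

At `x = q_3^m` only the first letter of the first composition can have a pole, and only when the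
second composition is exhausted by the end of that letter's tensor factor. After multiplication by
`θ_p(q_3^{-m} x)` the surviving pairs are the `Joined` ones. They correspond bijectively to
compositions of `m + r` cut after `m` letters (`sum_joined`), and at `z = q_3^{-m} w` their
exponents concatenate. The scalar identity `block_fusion` converts the two coefficients and the
theta residue into the coefficient of the concatenation times one `fusionFactor` per letter of the
first composition. The product of these factors is the fusion constant (`prod_fusionFactor`). -/

/-! ### The infinite product `(x;p)_∞` -/

/-- `(x;p)_∞ = ∏_{k ≥ 0} (1 - p^k x)` -/
def qPoch (p x : ℂ) : ℂ := ∏' k : ℕ, (1 - p ^ k * x)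

theorem theta_eq_qPoch (p x : ℂ) : theta p x = qPoch p x * qPoch p (p * x⁻¹) := rfl

theorem summable_norm_pow_mul {p : ℂ} (hp : ‖p‖ < 1) (x : ℂ) :
    Summable fun k : ℕ => ‖-(p ^ k * x)‖ := by
  simpa using (summable_geometric_of_lt_one (norm_nonneg p) hp).mul_right ‖x‖

theorem multipliable_qPoch {p : ℂ} (hp : ‖p‖ < 1) (x : ℂ) :
    Multipliable fun k : ℕ => 1 - p ^ k * x := by
  simpa [sub_eq_add_neg] using multipliable_one_add_of_summable (summable_norm_pow_mul hp x)

theorem qPoch_eq_one_sub_mul {p : ℂ} (hp : ‖p‖ < 1) (x : ℂ) :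
    qPoch p x = (1 - x) * qPoch p (p * x) := by
  have h := multipliable_qPoch hp (p * x)
  have h2 : Multipliable fun k : ℕ => 1 - p ^ (k + 1) * x := by
    refine h.congr fun k => ?_
    ring
  have := _root_.tprod_eq_zero_mul' (f := fun k : ℕ => 1 - p ^ k * x) h2
  rw [qPoch, this, qPoch]
  simp only [pow_zero, one_mul]
  congr 1
  exact tprod_congr fun k => by ring

theorem qPoch_ne_zero {p : ℂ} (hp : ‖p‖ < 1) {x : ℂ} (hx : ∀ k : ℕ, p ^ k * x ≠ 1) :
    qPoch p x ≠ 0 := by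
  have := tprod_one_add_ne_zero_of_summable (f := fun k : ℕ => -(p ^ k * x))
    (fun k h => hx k (by linear_combination -h)) (summable_norm_pow_mul hp x)
  simpa [qPoch, sub_eq_add_neg] using this

/-- Normal convergence makes the partial products converge locally uniformly, so holomorphy passes
to the limit. The general `g` lets either the argument or the nome be the variable. -/
theorem differentiableOn_tprod_one_sub {U : Set ℂ} (hU : IsOpen U) {g : ℕ → ℂ → ℂ}
    (hg : ∀ k, DifferentiableOn ℂ (g k) U) {u : ℕ → ℝ} (hu : Summable u)
    (hgu : ∀ k, ∀ t ∈ U, ‖g k t‖ ≤ u k) :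
    DifferentiableOn ℂ (fun t => ∏' k, (1 - g k t)) U := by
  have h := Summable.hasProdLocallyUniformlyOn_nat_one_add (f := fun k t => -g k t) hU hu
    (.of_forall fun k t ht => by simpa using hgu k t ht) (fun k => (hg k).continuousOn.neg)
  have h2 := TendstoLocallyUniformlyOn.differentiableOn (φ := (atTop : Filter (Finset ℕ))) h
    (.of_forall fun s => by
      simpa [Finset.prod_fn] using
        DifferentiableOn.finsetProd (u := s) fun k _ => ((hg k).neg.const_add 1)) hU
  simpa [sub_eq_add_neg] using h2

theorem differentiableAt_qPoch {p : ℂ} (hp : ‖p‖ < 1) (x : ℂ) :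
    DifferentiableAt ℂ (qPoch p) x := by
  refine (differentiableOn_tprod_one_sub (U := Metric.ball 0 (‖x‖ + 1)) Metric.isOpen_ball
    (g := fun k t => p ^ k * t) (fun k => by fun_prop)
    ((summable_geometric_of_lt_one (norm_nonneg p) hp).mul_right (‖x‖ + 1))
    fun k t ht => ?_).differentiableAt (Metric.isOpen_ball.mem_nhds (by simp))
  rw [norm_mul, norm_pow]
  have : ‖t‖ < ‖x‖ + 1 := by simpa using ht
  gcongr

theorem differentiableAt_qPoch_nome {p : ℂ} (hp : ‖p‖ < 1) (x : ℂ) :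
    DifferentiableAt ℂ (fun p => qPoch p x) p := by
  obtain ⟨ρ, h1, h2⟩ := exists_between hp
  have h0 := (norm_nonneg p).trans h1.le
  refine (differentiableOn_tprod_one_sub (U := Metric.ball 0 ρ) Metric.isOpen_ball
    (g := fun k t => t ^ k * x) (fun k => by fun_prop)
    ((summable_geometric_of_lt_one h0 h2).mul_right ‖x‖)
    fun k t ht => ?_).differentiableAt (Metric.isOpen_ball.mem_nhds (by simpa using h1))
  rw [norm_mul, norm_pow]
  have : ‖t‖ < ρ := by simpa using ht
  gcongr

theorem differentiableAt_qPoch_nome_mul {p : ℂ} (hp : ‖p‖ < 1) (x : ℂ) :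
    DifferentiableAt ℂ (fun p => qPoch p (p * x)) p := by
  obtain ⟨ρ, h1, h2⟩ := exists_between hp
  have h0 := (norm_nonneg p).trans h1.le
  refine (differentiableOn_tprod_one_sub (U := Metric.ball 0 ρ) Metric.isOpen_ball
    (g := fun k t => t ^ k * (t * x)) (fun k => by fun_prop)
    ((summable_geometric_of_lt_one h0 h2).mul_right (ρ * ‖x‖))
    fun k t ht => ?_).differentiableAt (Metric.isOpen_ball.mem_nhds (by simpa using h1))
  rw [norm_mul, norm_pow, norm_mul]
  have : ‖t‖ < ρ := by simpa using ht
  gcongr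

/-- The logarithmic series of `(x;p)_∞`. -/
theorem hasSum_qPoch_log {p : ℂ} (hp : ‖p‖ < 1) {x : ℂ} (hx : ‖x‖ < 1) :
    qPoch p x = Complex.exp (-∑' k : ℕ+, x ^ (k : ℕ) * (1 / (1 - p ^ (k : ℕ))) * (1 / k)) := by
  have hxj : ∀ j : ℕ, ‖p ^ j * x‖ < 1 := fun j => by
    rw [norm_mul, norm_pow]
    exact (mul_le_of_le_one_left (norm_nonneg _) (pow_le_one₀ (norm_nonneg _) hp.le)).trans_lt hx
  have hne : ∀ j : ℕ, 1 - p ^ j * x ≠ 0 := fun j h => by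
    have := hxj j
    rw [← sub_eq_zero.1 h] at this
    simp at this
  have hlog : Summable fun j : ℕ => Complex.log (1 - p ^ j * x) := by
    simpa [sub_eq_add_neg] using
      Complex.summable_log_one_add_of_summable (f := fun j : ℕ => -(p ^ j * x))
        (summable_norm_pow_mul hp x).of_norm
  rw [qPoch, ← Complex.cexp_tsum_eq_tprod hne hlog]
  congr 1
  rw [← tsum_neg]
  have hlogj : ∀ j : ℕ, HasSum (fun k : ℕ+ => -((p ^ j * x) ^ (k : ℕ) / k))
      (Complex.log (1 - p ^ j * x)) := fun j => by
    have h := (Complex.hasSum_taylorSeries_neg_log (hxj j)).neg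
    rw [neg_neg] at h
    -- The Taylor series runs over `ℕ`; its term at `0` is `0` because division by `0` yields `0`,
    -- so it may be restricted to positive indices.
    have := (hasSum_subtype_iff_of_support_subset (s := {k : ℕ | 0 < k}) (f := fun k : ℕ =>
      -((p ^ j * x) ^ k / (k : ℂ))) (a := Complex.log (1 - p ^ j * x)) (fun k hk => by
        rcases Nat.eq_zero_or_pos k with rfl | h
        · simp at hk
        · exact h)).2 h
    exact this
  rw [tsum_congr fun j => (hlogj j).tsum_eq.symm]
  -- The domination by `‖p‖^j ‖x‖^k` permits exchanging the two sums; the sum over `j` is then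
  -- geometric.
  have hsum : Summable (Function.uncurry fun (j : ℕ) (k : ℕ+) => -((p ^ j * x) ^ (k : ℕ) / (k : ℂ))) := by
    have hx0 : Summable fun k : ℕ+ => ‖x‖ ^ (k : ℕ) :=
      (summable_geometric_of_lt_one (norm_nonneg x) hx).comp_injective PNat.coe_injective
    refine Summable.of_norm_bounded ((summable_geometric_of_lt_one (norm_nonneg p) hp).mul_of_nonneg
      hx0 (fun _ => by positivity) (fun _ => by positivity)) ?_
    rintro ⟨j, k⟩
    simp only [Function.uncurry, norm_neg, norm_div, norm_pow, norm_mul, Complex.norm_natCast]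
    have hk : (1 : ℝ) ≤ (k : ℕ) := by exact_mod_cast k.pos
    rw [mul_pow, mul_div_assoc]
    have h1 : (‖p‖ ^ j) ^ (k : ℕ) ≤ ‖p‖ ^ j :=
      pow_le_of_le_one (by positivity) (pow_le_one₀ (norm_nonneg _) hp.le) k.pos.ne'
    have h2 : ‖x‖ ^ (k : ℕ) / (k : ℕ) ≤ ‖x‖ ^ (k : ℕ) := div_le_self (by positivity) hk
    gcongr
  rw [← hsum.tsum_comm]
  refine tsum_congr fun k => ?_
  have hpk : ‖p ^ (k : ℕ)‖ < 1 := by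
    rw [norm_pow]; exact pow_lt_one₀ (norm_nonneg _) hp k.pos.ne'
  have hg := ((hasSum_geometric_of_norm_lt_one hpk).mul_right (x ^ (k : ℕ) / (k : ℂ))).neg
  rw [tsum_congr (g := fun j : ℕ => -((p ^ (k : ℕ)) ^ j * (x ^ (k : ℕ) / (k : ℂ)))) fun j => by
    rw [mul_pow, ← pow_mul, ← pow_mul, mul_comm j, mul_div_assoc], hg.tsum_eq]
  rw [one_div, one_div, div_eq_mul_inv]
  ring

/-! ### Theta functions -/

theorem differentiableAt_theta {p : ℂ} (hp : ‖p‖ < 1) {x : ℂ} (hx : x ≠ 0) :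
    DifferentiableAt ℂ (theta p) x := by
  have h : theta p = fun x => qPoch p x * qPoch p (p * x⁻¹) := rfl
  rw [h]
  exact (differentiableAt_qPoch hp x).mul ((differentiableAt_qPoch hp (p * x⁻¹)).comp x
    ((differentiableAt_inv hx).const_mul p))

theorem differentiableAt_theta_nome {p : ℂ} (hp : ‖p‖ < 1) (x : ℂ) :
    DifferentiableAt ℂ (fun p => theta p x) p :=
  (differentiableAt_qPoch_nome hp x).mul (differentiableAt_qPoch_nome_mul hp x⁻¹)

theorem theta_one {p : ℂ} (hp : ‖p‖ < 1) : theta p 1 = 0 := by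
  rw [theta_eq_qPoch, qPoch_eq_one_sub_mul hp 1]
  simp

theorem theta_inv {p : ℂ} (hp : ‖p‖ < 1) {x : ℂ} (hx : x ≠ 0) :
    theta p x⁻¹ = -x⁻¹ * theta p x := by
  rw [theta_eq_qPoch, theta_eq_qPoch, qPoch_eq_one_sub_mul hp x⁻¹, qPoch_eq_one_sub_mul hp x, inv_inv]
  field_simp
  ring

theorem theta_ne_zero {p : ℂ} (hp0 : p ≠ 0) (hp : ‖p‖ < 1) {x : ℂ} (hx : x ≠ 0)
    (h : ∀ k : ℤ, x ≠ p ^ k) : theta p x ≠ 0 := by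
  rw [theta_eq_qPoch]
  refine mul_ne_zero (qPoch_ne_zero hp fun k hk => h (-k) ?_) (qPoch_ne_zero hp fun k hk => h (k + 1) ?_)
  · rw [zpow_neg, zpow_natCast]
    exact eq_inv_of_mul_eq_one_right hk
  · rw [zpow_add₀ hp0, zpow_natCast, zpow_one]
    field_simp at hk
    exact hk.symm

/-- Logarithm of the theta function in its annulus of convergence. -/
theorem theta_eq_exp {p : ℂ} (hp : ‖p‖ < 1) {x : ℂ} (hx : ‖x‖ < 1) (hx' : ‖p * x⁻¹‖ < 1) :
    theta p x = Complex.exp (-(∑' k : ℕ+, x ^ (k : ℕ) * (1 / (1 - p ^ (k : ℕ))) * (1 / k)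
      + ∑' k : ℕ+, (x ^ (k : ℕ))⁻¹ * (p ^ (k : ℕ) / (1 - p ^ (k : ℕ))) * (1 / k))) := by
  rw [theta_eq_qPoch, hasSum_qPoch_log hp hx, hasSum_qPoch_log hp hx', ← Complex.exp_add, neg_add]
  congr 3
  refine tsum_congr fun k => ?_
  rw [mul_pow, inv_pow]
  ring

/-! ### Sums over finitely supported exponents -/

theorem sum_finsupp_prod {ι R : Type*} [CommSemiring R] (s : Finset ι)
    (t : ι → Finset ℕ) (g : ι → ℕ → R) :
    ∑ τ ∈ s.finsupp t, ∏ i ∈ s, g i (τ i) = ∏ i ∈ s, ∑ k ∈ t i, g i k := by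
  classical
  rw [Finset.prod_sum, Finset.finsupp, Finset.sum_map]
  refine Finset.sum_congr rfl fun f _ => ?_
  rw [← Finset.prod_attach]
  refine Finset.prod_congr rfl fun i _ => ?_
  simp [Finsupp.indicator_of_mem i.2]

/-- The term `∏_i y_i^{τ_i} / τ_i!` -/
def expTerm {ι 𝕜 : Type*} [Field 𝕜] (y : ι → 𝕜) (τ : ι →₀ ℕ) : 𝕜 :=
  τ.prod fun i k => y i ^ k / (k.factorial : 𝕜)

theorem expTerm_eq_prod {ι 𝕜 : Type*} [Field 𝕜] (y : ι → 𝕜) {τ : ι →₀ ℕ} {s : Finset ι}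
    (hs : τ.support ⊆ s) : expTerm y τ = ∏ i ∈ s, (y i ^ (τ i) / ((τ i).factorial : 𝕜)) :=
  Finsupp.prod_of_support_subset _ hs _ (by simp)

theorem sum_box_expTerm {ι 𝕜 : Type*} [Field 𝕜] (y : ι → 𝕜) (s : Finset ι) (N : ℕ) :
    ∑ τ ∈ s.finsupp (fun _ => Finset.range N), expTerm y τ
      = ∏ i ∈ s, ∑ k ∈ Finset.range N, y i ^ k / (k.factorial : 𝕜) := by
  rw [← sum_finsupp_prod]
  exact Finset.sum_congr rfl fun τ hτ => expTerm_eq_prod y (Finset.mem_finsupp_iff.1 hτ).1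

/-- Boxes are cofinal among finite sets of exponents, so a summable series over exponents can be
evaluated along boxes, where it factorizes. -/
theorem exists_subset_box {ι : Type*} (F : Finset (ι →₀ ℕ)) :
    ∃ (s : Finset ι) (N : ℕ), ∀ s' N', s ⊆ s' → N ≤ N' →
      F ⊆ s'.finsupp (fun _ => Finset.range N') := by
  classical
  refine ⟨F.biUnion Finsupp.support, (F.sup fun τ => τ.support.sup τ) + 1, fun s' N' hs hN τ hτ => ?_⟩
  rw [Finset.mem_finsupp_iff]
  have h1 : τ.support ⊆ s' := (Finset.subset_biUnion_of_mem Finsupp.support hτ).trans hs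
  refine ⟨h1, fun i _ => ?_⟩
  rw [Finset.mem_range]
  refine lt_of_lt_of_le (Nat.lt_succ_of_le ?_) hN
  by_cases hi : i ∈ τ.support
  · exact (Finset.le_sup (f := τ) hi).trans (Finset.le_sup (f := fun τ => τ.support.sup τ) hτ)
  · simp [Finsupp.notMem_support_iff.1 hi]

theorem norm_expTerm {ι : Type*} (y : ι → ℂ) (τ : ι →₀ ℕ) :
    ‖expTerm y τ‖ = expTerm (fun i => ‖y i‖) τ := by
  simp [expTerm, Finsupp.prod]

theorem summable_expTerm {ι : Type*} {y : ι → ℂ} (hy : Summable fun i => ‖y i‖) :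
    Summable fun τ : ι →₀ ℕ => ‖expTerm y τ‖ := by
  classical
  refine summable_of_sum_le (c := Real.exp (∑' i, ‖y i‖)) (fun _ => norm_nonneg _) fun F => ?_
  obtain ⟨s, N, h⟩ := exists_subset_box F
  refine (Finset.sum_le_sum_of_subset_of_nonneg (h s N le_rfl le_rfl)
    fun _ _ _ => norm_nonneg _).trans ?_
  simp_rw [norm_expTerm]
  rw [sum_box_expTerm]
  refine (Finset.prod_le_prod (fun i _ => Finset.sum_nonneg fun k _ => by positivity)
    fun i _ => Real.sum_le_exp_of_nonneg (norm_nonneg (y i)) N).trans ?_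
  rw [← Real.exp_sum]
  exact Real.exp_le_exp.2 (hy.sum_le_tsum _ fun _ _ => norm_nonneg _)

theorem tendsto_sum_range_exp (x : ℂ) :
    Tendsto (fun N => ∑ k ∈ Finset.range N, x ^ k / (k.factorial : ℂ)) atTop (𝓝 (Complex.exp x)) := by
  have := (NormedSpace.expSeries_div_hasSum_exp x).tendsto_sum_nat
  rwa [← Complex.exp_eq_exp_ℂ] at this

theorem hasSum_expTerm {ι : Type*} {y : ι → ℂ} (hy : Summable fun i => ‖y i‖) :
    HasSum (expTerm y) (Complex.exp (∑' i, y i)) := by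
  classical
  have hs := (summable_expTerm hy).of_norm
  have hbox : Tendsto (fun x : Finset ι × ℕ => ∑ τ ∈ x.1.finsupp (fun _ => Finset.range x.2),
      expTerm y τ) (atTop ×ˢ atTop) (𝓝 (∑' τ, expTerm y τ)) := by
    refine hs.hasSum.comp ?_
    rw [prod_atTop_atTop_eq]
    refine tendsto_atTop.2 fun F => ?_
    obtain ⟨s, N, h⟩ := exists_subset_box F
    filter_upwards [eventually_ge_atTop (s, N)] with x hx
    exact h _ _ hx.1 hx.2
  have hlim : Tendsto (fun s : Finset ι => Complex.exp (∑ i ∈ s, y i)) atTop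
      (𝓝 (∑' τ, expTerm y τ)) := by
    -- The joint limit over boxes becomes an iterated one: for fixed `s` the side of the box tends
    -- to infinity first, and membership in a closed neighbourhood survives that limit.
    refine (closed_nhds_basis _).tendsto_right_iff.2 fun V hV => ?_
    filter_upwards [(hbox.eventually_mem hV.1).curry] with s hs
    refine hV.2.mem_of_tendsto (b := atTop) ?_ hs
    simp_rw [sum_box_expTerm, Complex.exp_sum]
    exact tendsto_finsetProd _ fun i _ => tendsto_sum_range_exp (y i)
  have hlim2 := (Complex.continuous_exp.tendsto _).comp hy.of_norm.hasSum
  rw [tendsto_nhds_unique hlim2 hlim]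
  exact hs.hasSum

/-! ### Translations and exponentials of creation operators -/

variable {n : ℕ}

/-- The translation `X M ↦ X M + b M` of polynomials. -/
def translate {ι : Type*} (b : ι → ℂ) : MvPolynomial ι ℂ →ₐ[ℂ] MvPolynomial ι ℂ :=
  MvPolynomial.aeval fun i => MvPolynomial.X i + MvPolynomial.C (b i)

theorem translate_translate {ι : Type*} (b b' : ι → ℂ) (P : MvPolynomial ι ℂ) :
    translate b (translate b' P) = translate (b + b') P := by
  have : (translate b).comp (translate b') = translate (b + b') := by
    refine MvPolynomial.algHom_ext fun i => ?_
    simp [translate, add_assoc]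
  exact congrArg (fun f => f P) this

theorem coeff_translate_monomial {ι : Type*} (b : ι → ℂ) (τ κ : ι →₀ ℕ) :
    MvPolynomial.coeff κ (translate b (MvPolynomial.monomial τ 1))
      = if κ ≤ τ then τ.prod fun i k => b i ^ (k - κ i) * (k.choose (κ i) : ℂ) else 0 := by
  classical
  have h1 : translate b (MvPolynomial.monomial τ 1)
      = ∏ i ∈ τ.support, ∑ j ∈ Finset.range (τ i + 1),
        MvPolynomial.monomial (Finsupp.single i j) (b i ^ (τ i - j) * ((τ i).choose j : ℂ)) := by
    rw [translate, MvPolynomial.aeval_monomial, map_one, one_mul, Finsupp.prod]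
    refine Finset.prod_congr rfl fun i _ => ?_
    rw [add_pow]
    refine Finset.sum_congr rfl fun j _ => ?_
    rw [← mul_one (b i ^ (τ i - j) * ((τ i).choose j : ℂ)), ← MvPolynomial.C_mul_monomial,
      ← MvPolynomial.X_pow_eq_monomial]
    simp
    ring
  rw [h1, ← sum_finsupp_prod, MvPolynomial.coeff_sum]
  have h2 : ∀ x ∈ τ.support.finsupp (fun i => Finset.range (τ i + 1)),
      MvPolynomial.coeff κ (∏ i ∈ τ.support, MvPolynomial.monomial (Finsupp.single i (x i))
        (b i ^ (τ i - x i) * ((τ i).choose (x i) : ℂ)))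
      = if x = κ then ∏ i ∈ τ.support, (b i ^ (τ i - x i) * ((τ i).choose (x i) : ℂ)) else 0 := by
    intro x hx
    have hsum : ∑ i ∈ τ.support, Finsupp.single i (x i) = x := by
      conv_rhs => rw [← Finsupp.sum_single x]
      exact (Finsupp.sum_of_support_subset x (Finset.mem_finsupp_iff.1 hx).1 _ (by simp)).symm
    rw [← MvPolynomial.monomial_sum_prod, MvPolynomial.coeff_monomial, hsum]
  rw [Finset.sum_congr rfl h2]
  have h3 : κ ∈ τ.support.finsupp (fun i => Finset.range (τ i + 1)) ↔ κ ≤ τ := by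
    rw [Finset.mem_finsupp_iff]
    constructor
    · rintro ⟨hs, h⟩ i
      by_cases hi : i ∈ τ.support
      · exact Nat.lt_succ_iff.1 (Finset.mem_range.1 (h i hi))
      · rw [Finsupp.notMem_support_iff.1 fun h => hi (hs h)]
        exact Nat.zero_le _
    · intro h
      exact ⟨Finsupp.support_mono h, fun i _ => Finset.mem_range.2 (Nat.lt_succ_of_le (h i))⟩
  rw [Finset.sum_ite_eq']
  simp only [h3, Finsupp.prod]

/-- The coefficient sum of `exp(∑ A_M X_M)` against the translation by `b`. -/
theorem hasSum_expTerm_mul_coeff {ι : Type*} {A b : ι → ℂ} (h : Summable fun i => ‖b i * A i‖)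
    (κ : ι →₀ ℕ) :
    HasSum (fun τ : ι →₀ ℕ => expTerm A τ
        * MvPolynomial.coeff κ (translate b (MvPolynomial.monomial τ 1)))
      (expTerm A κ * Complex.exp (∑' i, b i * A i)) := by
  classical
  -- Only exponents `κ + σ` contribute. The binomial coefficients absorb the factorials, which
  -- splits the term into `expTerm A κ` and the exponential term of `b * A` at `σ`.
  have hinj : Function.Injective fun σ : ι →₀ ℕ => κ + σ := add_right_injective κ
  refine (hinj.hasSum_iff fun τ hτ => ?_).1 ?_
  · rw [coeff_translate_monomial, if_neg, mul_zero]
    intro hle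
    exact hτ ⟨τ - κ, add_tsub_cancel_of_le hle⟩
  · refine (congrArg (fun g => HasSum g _) (funext fun σ => ?_)).mpr
      ((hasSum_expTerm h).mul_left (expTerm A κ))
    rw [Function.comp_apply, coeff_translate_monomial, if_pos (le_add_of_nonneg_right zero_le),
      Finsupp.prod, expTerm_eq_prod A (subset_refl _), expTerm_eq_prod A (s := (κ + σ).support),
      expTerm_eq_prod _ (s := (κ + σ).support), ← Finset.prod_mul_distrib, ← Finset.prod_mul_distrib]
    · refine Finset.prod_congr rfl fun i _ => ?_
      have hc : (((κ + σ) i).choose (κ i) : ℂ) * (κ i).factorial * (σ i).factorial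
          = ((κ + σ) i).factorial := by
        rw [Finsupp.add_apply, Nat.choose_symm_add]
        have := Nat.add_choose_mul_factorial_mul_factorial (κ i) (σ i)
        exact_mod_cast this
      have h1 : ((κ i).factorial : ℂ) ≠ 0 := by exact_mod_cast (κ i).factorial_ne_zero
      have h2 : ((σ i).factorial : ℂ) ≠ 0 := by exact_mod_cast (σ i).factorial_ne_zero
      have h3 : (((κ + σ) i).factorial : ℂ) ≠ 0 := by exact_mod_cast ((κ + σ) i).factorial_ne_zero
      have h4 : (κ + σ) i - κ i = σ i := by simp
      rw [h4]
      field_simp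
      rw [← hc, Finsupp.add_apply, pow_add, mul_pow]
      ring
    · exact Finsupp.support_mono (le_add_of_nonneg_left zero_le)
    · exact Finsupp.support_mono (le_add_of_nonneg_right zero_le)

/-- The exponential of a linear combination of variables. -/
def expSeries {ι : Type*} (A : ι → ℂ) : MvPowerSeries ι ℂ := fun τ => expTerm A τ

theorem coeff_expSeries {ι : Type*} (A : ι → ℂ) (τ : ι →₀ ℕ) :
    MvPowerSeries.coeff τ (expSeries A) = expTerm A τ := rfl

theorem expSeries_add {ι : Type*} (A B : ι → ℂ) :
    expSeries A * expSeries B = expSeries (A + B) := by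
  classical
  ext τ
  rw [MvPowerSeries.coeff_mul, coeff_expSeries]
  simp only [coeff_expSeries]
  rw [expTerm_eq_prod (A + B) (subset_refl τ.support)]
  have h1 : ∀ i ∈ τ.support, (A + B) i ^ τ i / ((τ i).factorial : ℂ)
      = ∑ k ∈ Finset.range (τ i + 1),
        (A i ^ k / (k.factorial : ℂ)) * (B i ^ (τ i - k) / ((τ i - k).factorial : ℂ)) := by
    intro i _
    rw [Pi.add_apply, add_pow, Finset.sum_div]
    refine Finset.sum_congr rfl fun k hk => ?_
    rw [Nat.cast_choose ℂ (Nat.lt_succ_iff.1 (Finset.mem_range.1 hk))]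
    have h3 : ((τ i).factorial : ℂ) ≠ 0 := by exact_mod_cast (τ i).factorial_ne_zero
    field_simp
  rw [Finset.prod_congr rfl h1, ← sum_finsupp_prod]
  refine Finset.sum_bij' (fun x _ => x.1) (fun κ _ => (κ, τ - κ)) ?_ ?_ ?_ ?_ ?_
  · intro x hx
    rw [Finset.HasAntidiagonal.mem_antidiagonal] at hx
    have hle : x.1 ≤ τ := hx ▸ le_add_of_nonneg_right zero_le
    exact Finset.mem_finsupp_iff.2 ⟨Finsupp.support_mono hle,
      fun i _ => Finset.mem_range.2 (Nat.lt_succ_of_le (hle i))⟩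
  · intro κ hκ
    rw [Finset.mem_finsupp_iff] at hκ
    rw [Finset.HasAntidiagonal.mem_antidiagonal]
    refine add_tsub_cancel_of_le fun i => ?_
    by_cases hi : i ∈ τ.support
    · exact Nat.lt_succ_iff.1 (Finset.mem_range.1 (hκ.2 i hi))
    · rw [Finsupp.notMem_support_iff.1 fun h => hi (hκ.1 h)]
      exact Nat.zero_le _
  · intro x hx
    rw [Finset.HasAntidiagonal.mem_antidiagonal] at hx
    ext1
    · rfl
    · rw [← hx]; simp
  · intro κ _
    rfl
  · intro x hx
    rw [Finset.HasAntidiagonal.mem_antidiagonal] at hx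
    have hle : x.1 ≤ τ := hx ▸ le_add_of_nonneg_right zero_le
    have hle' : x.2 ≤ τ := hx ▸ le_add_of_nonneg_left zero_le
    rw [expTerm_eq_prod A (Finsupp.support_mono hle), expTerm_eq_prod B (Finsupp.support_mono hle'),
      ← Finset.prod_mul_distrib]
    refine Finset.prod_congr rfl fun i _ => ?_
    have : τ i - x.1 i = x.2 i := by rw [← hx]; simp
    rw [this]

/-- Translation is multiplicative, so the coefficient of the translate of `X^(τ + σ)` is a finite
convolution, and the sum over `τ` can be taken in each of its terms. -/
theorem hasSum_coeff_mul_monomial {ι : Type*} {A b : ι → ℂ} (h : Summable fun i => ‖b i * A i‖)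
    (σ κ : ι →₀ ℕ) (a : ℂ) :
    HasSum (fun ν : ι →₀ ℕ =>
        MvPowerSeries.coeff ν (expSeries A * ((MvPolynomial.monomial σ a : MvPolynomial ι ℂ) : MvPowerSeries ι ℂ))
          * MvPolynomial.coeff κ (translate b (MvPolynomial.monomial ν 1)))
      (MvPowerSeries.coeff κ (expSeries A * ((translate b (MvPolynomial.monomial σ a) : MvPolynomial ι ℂ) : MvPowerSeries ι ℂ))
        * Complex.exp (∑' i, b i * A i)) := by
  classical
  have hinj : Function.Injective fun τ : ι →₀ ℕ => τ + σ := add_left_injective σ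
  have ha : (MvPolynomial.monomial σ a : MvPolynomial ι ℂ) = a • MvPolynomial.monomial σ 1 := by
    rw [MvPolynomial.smul_monomial, smul_eq_mul, mul_one]
  refine (hinj.hasSum_iff fun τ hτ => ?_).1 ?_
  · rw [MvPolynomial.coe_monomial, MvPowerSeries.coeff_mul_monomial, if_neg, zero_mul]
    intro hle
    exact hτ ⟨τ - σ, tsub_add_cancel_of_le hle⟩
  · have hterm : ∀ τ : ι →₀ ℕ, ((fun ν : ι →₀ ℕ =>
        MvPowerSeries.coeff ν (expSeries A * ((MvPolynomial.monomial σ a : MvPolynomial ι ℂ) : MvPowerSeries ι ℂ))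
          * MvPolynomial.coeff κ (translate b (MvPolynomial.monomial ν 1))) ∘ fun τ => τ + σ) τ
        = ∑ x ∈ Finset.HasAntidiagonal.antidiagonal κ, (expTerm A τ
            * MvPolynomial.coeff x.1 (translate b (MvPolynomial.monomial τ 1)))
          * MvPolynomial.coeff x.2 (translate b (MvPolynomial.monomial σ a)) := by
      intro τ
      have h1 : (MvPolynomial.monomial (τ + σ) (1 : ℂ))
          = MvPolynomial.monomial τ 1 * MvPolynomial.monomial σ 1 := by
        simp [MvPolynomial.monomial_mul]
      rw [Function.comp_apply, MvPolynomial.coe_monomial, MvPowerSeries.coeff_mul_monomial,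
        if_pos (le_add_of_nonneg_left zero_le), add_tsub_cancel_right, h1, map_mul,
        MvPolynomial.coeff_mul, Finset.mul_sum]
      refine Finset.sum_congr rfl fun x _ => ?_
      rw [coeff_expSeries, ha, map_smul, MvPolynomial.coeff_smul, smul_eq_mul]
      ring
    rw [funext hterm, MvPowerSeries.coeff_mul, Finset.sum_mul]
    refine hasSum_sum fun x _ => ?_
    have := (hasSum_expTerm_mul_coeff h x.1).mul_right
      (MvPolynomial.coeff x.2 (translate b (MvPolynomial.monomial σ a)))
    rw [MvPolynomial.coeff_coe, coeff_expSeries]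
    rwa [mul_right_comm]

/-- This is the exchange of an annihilation exponential with a creation exponential. The latter
leaves the polynomial Fock space, so their composition has a meaning only as a sum over intermediate
states. -/
theorem hasSum_coeff_mul_coeff {ι : Type*} {A b : ι → ℂ} (h : Summable fun i => ‖b i * A i‖)
    (P : MvPolynomial ι ℂ) (κ : ι →₀ ℕ) :
    HasSum (fun ν : ι →₀ ℕ => MvPowerSeries.coeff ν (expSeries A * (P : MvPowerSeries ι ℂ))
          * MvPolynomial.coeff κ (translate b (MvPolynomial.monomial ν 1)))
      (MvPowerSeries.coeff κ (expSeries A * ((translate b P : MvPolynomial ι ℂ) : MvPowerSeries ι ℂ))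
        * Complex.exp (∑' i, b i * A i)) := by
  induction P using MvPolynomial.induction_on' with
  | monomial σ a => exact hasSum_coeff_mul_monomial h σ κ a
  | add P Q hP hQ =>
    simp only [MvPolynomial.coe_add, map_add, mul_add, add_mul]
    exact hP.add hQ

namespace Data

variable (D : Data n) (p : ℂ)

theorem expCre_eq (A : Mode n → ℂ) : expCre A = expSeries A := rfl

theorem expAnn_eq (B : Mode n → ℂ) (v : Fock n) :
    D.expAnn p B v = translate (fun M => B M * D.comm p M) v := rfl

/-- Wick's theorem for two normally ordered exponentials. -/
theorem hasSum_entry_expOp {A B A' B' : Mode n → ℂ}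
    (h : Summable fun M => ‖B M * D.comm p M * A' M‖) (mu lam : Mode n →₀ ℕ) :
    HasSum (fun nu => entry (D.expOp p A B) mu nu * entry (D.expOp p A' B') nu lam)
      (Complex.exp (∑' M, B M * D.comm p M * A' M)
        * entry (D.expOp p (A + A') (B + B')) mu lam) := by
  have hB : (fun M => (B + B') M * D.comm p M)
      = (fun M => B M * D.comm p M) + fun M => B' M * D.comm p M := by
    funext M
    simp [add_mul]
  simp only [entry, expOp, expAnn_eq, expCre_eq]
  rw [← expSeries_add, hB, ← translate_translate, mul_assoc, MvPowerSeries.coeff_mul, Finset.mul_sum]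
  -- The outer creation exponential involves only the finitely many splittings of `mu`, so the
  -- infinite sum over `nu` is treated for each splitting separately.
  simp_rw [MvPowerSeries.coeff_mul _ (expSeries A), Finset.sum_mul]
  refine hasSum_sum fun x _ => ?_
  have := (hasSum_coeff_mul_coeff h (translate (fun M => B' M * D.comm p M)
    (MvPolynomial.monomial lam 1)) x.2).mul_left (MvPowerSeries.coeff x.1 (expSeries A))
  rw [mul_left_comm, mul_comm (Complex.exp _)]
  refine (congrArg (fun g => HasSum g _) (funext fun ν => ?_)).mpr this
  rw [MvPolynomial.coeff_coe]
  ring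

end Data

/-! ### Compositions -/

/-- `k_1 + ⋯ + k_{i-1}` -/
def offset {N : ℕ} (k : Fin N → ℕ) (i : Fin N) : ℕ := ∑ l ∈ Finset.Iio i, k l

theorem offset_eq_sum_ite {N : ℕ} (k : Fin N → ℕ) (i : Fin N) :
    offset k i = ∑ l, if l < i then k l else 0 := by
  rw [offset, ← Finset.sum_filter]
  congr 1
  ext
  simp

theorem offset_cons_zero {N : ℕ} (a : ℕ) (k : Fin N → ℕ) :
    offset (Fin.cons a k : Fin (N + 1) → ℕ) 0 = 0 := by
  simp [offset_eq_sum_ite]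

theorem offset_cons_succ {N : ℕ} (a : ℕ) (k : Fin N → ℕ) (i : Fin N) :
    offset (Fin.cons a k : Fin (N + 1) → ℕ) i.succ = a + offset k i := by
  simp [offset_eq_sum_ite, Fin.sum_univ_succ]

/-- The compositions of `m` into `N` parts `≥ 0`. -/
abbrev comps (N m : ℕ) : Finset (Fin N → ℕ) := Finset.piAntidiag Finset.univ m

theorem mem_comps {N m : ℕ} {k : Fin N → ℕ} : k ∈ comps N m ↔ ∑ i, k i = m := by
  simp [comps]

/-! ### Expansion of the currents over compositions -/

namespace Data

variable (D : Data n) (p : ℂ)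

/-- Moving every `q_3^{-k D_z}` to the right rescales the arguments of the later factors, and the
accumulated exponent is `offset`. -/
theorem foldr_shiftMul {N : ℕ} (S : Fin N → ShiftSeries n) (m : ℕ) (z : ℂ) :
    (List.ofFn S).foldr D.shiftMul (fun k _ => if k = 0 then 1 else 0) m z
      = ∑ k ∈ comps N m, ∏ i, S i (k i) ((D.q 2 ^ offset k i)⁻¹ * z) := by
  induction N generalizing m z with
  | zero =>
    by_cases hm : m = 0
    · subst hm; simp [comps]
    · simp [comps, hm]
  | succ N ih =>
    rw [List.ofFn_succ, List.foldr_cons, shiftMul]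
    simp_rw [ih, Finset.mul_sum]
    rw [Finset.sum_sigma']
    refine Finset.sum_bij' (fun x _ => (Fin.cons x.1.1 x.2 : Fin (N + 1) → ℕ))
      (fun k _ => ⟨(k 0, ∑ i : Fin N, k i.succ), Fin.tail k⟩) ?_ ?_ ?_ ?_ ?_
    · rintro ⟨x, k⟩ h
      simp only [Finset.mem_sigma, Finset.HasAntidiagonal.mem_antidiagonal, mem_comps] at h
      simp only [mem_comps, Fin.sum_univ_succ, Fin.cons_zero, Fin.cons_succ, h.2, h.1]
    · intro k h
      simp only [mem_comps, Fin.sum_univ_succ] at h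
      simp only [Finset.mem_sigma, Finset.HasAntidiagonal.mem_antidiagonal, mem_comps, h, true_and]
      rfl
    · rintro ⟨⟨a, b⟩, k⟩ h
      simp only [Finset.mem_sigma, Finset.HasAntidiagonal.mem_antidiagonal, mem_comps] at h
      obtain ⟨-, rfl⟩ := h
      simp
    · intro k h
      simp
    · rintro ⟨⟨a, b⟩, k⟩ h
      rw [Fin.prod_univ_succ, offset_cons_zero]
      simp only [Fin.cons_zero, Fin.cons_succ, offset_cons_succ, pow_zero, inv_one, one_mul,
        pow_add, mul_inv]
      congr 1
      refine Finset.prod_congr rfl fun i _ => ?_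
      congr 1
      ring

/-- The coefficient of `:Λ̃_i(z) ⋯ Λ̃_i(q_3^{-(k-1)} z):` in the Miura factor, up to the sign. -/
def blockCoef (i : Fin n) (k : ℕ) : ℂ :=
  D.qh 2 ^ (k ^ 2) * (D.qh (D.c i) ^ k)⁻¹
      * (thetaShift p (D.q 2) (D.q 2 ^ (1 - (k : ℤ)) * D.q (D.c i)) k
          / thetaShift p (D.q 2) (D.q 2) k)

/-- The factors `Λ̃_i(q_3^{-a} z)` of the normally ordered monomial of a composition. -/
def word (k : Fin n → ℕ) (z : ℂ) : (Fin n × ℂ) →₀ ℕ :=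
  ∑ i, ∑ a ∈ Finset.range (k i), Finsupp.single (i, (D.q 2 ^ (offset k i + a))⁻¹ * z) 1

/-- Creation exponents of the normally ordered monomial of a composition. -/
def wordCre (k : Fin n → ℕ) (z : ℂ) (M : Mode n) : ℂ :=
  ∑ i, ∑ a ∈ Finset.range (k i), D.decCre p i ((D.q 2 ^ (offset k i + a))⁻¹ * z) M

/-- Annihilation exponents of the normally ordered monomial of a composition. -/
def wordAnn (k : Fin n → ℕ) (z : ℂ) (M : Mode n) : ℂ :=
  ∑ i, ∑ a ∈ Finset.range (k i), D.decAnn p i ((D.q 2 ^ (offset k i + a))⁻¹ * z) M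

/-- The coefficient of the normally ordered monomial of a composition in a current. -/
def wordCoef (k : Fin n → ℕ) : ℂ := (∏ i, D.u i ^ k i) * ∏ i, D.blockCoef p i (k i)

theorem miura_eq (m : ℕ) (z : ℂ) :
    D.miura p m z = ∑ k ∈ comps n m,
      MvPolynomial.monomial (D.word k z) ((-1) ^ m * ∏ i, D.blockCoef p i (k i)) := by
  rw [miura, foldr_shiftMul]
  refine Finset.sum_congr rfl fun k hk => ?_
  rw [mem_comps] at hk
  rw [word, ← hk, ← Finset.prod_pow_eq_pow_sum, ← Finset.prod_mul_distrib,
    MvPolynomial.monomial_sum_prod]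
  refine Finset.prod_congr rfl fun i _ => ?_
  rw [MvPolynomial.monomial_sum_index, miuraFactor, blockCoef]
  congr 1
  · congr 1
    ring
  · refine Finset.prod_congr rfl fun j _ => ?_
    rw [MvPolynomial.X, pow_add, mul_inv, mul_assoc, mul_left_comm]

/-- Since `nord` sums over a support, cancelling or coinciding monomials must be allowed for;
summing over a common larger finite set makes the linearity visible. -/
theorem nord_sum_monomial {ι : Type*} (s : Finset ι) (e : ι → (Fin n × ℂ) →₀ ℕ) (c : ι → ℂ)
    (v : Fock n) :
    D.nord p (∑ k ∈ s, MvPolynomial.monomial (e k) (c k)) v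
      = ∑ k ∈ s, c k • D.nordMonomial p (e k) v := by
  classical
  have h1 : ∀ P : Sym n, D.nord p P v = ∑ x ∈ P.support ∪ s.image e,
      P.coeff x • D.nordMonomial p x v := fun P => by
    refine Finset.sum_subset Finset.subset_union_left fun x _ hx => ?_
    rw [MvPolynomial.notMem_support_iff.1 hx, zero_smul]
  rw [h1]
  simp_rw [MvPolynomial.coeff_sum, MvPolynomial.coeff_monomial, Finset.sum_smul, ite_smul, zero_smul]
  rw [Finset.sum_comm]
  refine Finset.sum_congr rfl fun k hk => ?_
  rw [Finset.sum_ite_eq, if_pos (Finset.mem_union_right _ (Finset.mem_image_of_mem e hk))]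

theorem sum_word {E : Type*} [AddCommMonoid E] (k : Fin n → ℕ) (z : ℂ)
    (F : (Fin n × ℂ) → ℕ → E) (h0 : ∀ x, F x 0 = 0) (hadd : ∀ x a b, F x (a + b) = F x a + F x b) :
    (D.word k z).sum F
      = ∑ i, ∑ a ∈ Finset.range (k i), F (i, (D.q 2 ^ (offset k i + a))⁻¹ * z) 1 := by
  classical
  rw [word, ← Finsupp.sum_finsetSum_index h0 hadd]
  refine Finset.sum_congr rfl fun i _ => ?_
  rw [← Finsupp.sum_finsetSum_index h0 hadd]
  exact Finset.sum_congr rfl fun a _ => Finsupp.sum_single_index (h0 _)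

theorem prod_word (k : Fin n → ℕ) (z : ℂ) :
    ((D.word k z).prod fun x a => D.u x.1 ^ a) = ∏ i, D.u i ^ k i := by
  have := D.sum_word (E := Additive ℂ) k z (fun x a => Additive.ofMul (D.u x.1 ^ a))
    (by simp) (fun x a b => by rw [pow_add]; rfl)
  refine (congrArg Additive.toMul this).trans ?_
  rw [toMul_sum]
  refine Finset.prod_congr rfl fun i _ => ?_
  rw [toMul_sum]
  simp

theorem nordMonomial_word (k : Fin n → ℕ) (z : ℂ) (v : Fock n) :
    D.nordMonomial p (D.word k z) v
      = (∏ i, D.u i ^ k i) • D.expOp p (D.wordCre p k z) (D.wordAnn p k z) v := by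
  rw [nordMonomial, prod_word]
  congr 2
  · funext M
    rw [sum_word _ _ _ _ (by simp) (by intros; push_cast; ring), wordCre]
    simp
  · funext M
    rw [sum_word _ _ _ _ (by simp) (by intros; push_cast; ring), wordAnn]
    simp

/-- The currents as sums over compositions. -/
theorem current_eq (m : ℕ) (z : ℂ) (v : Fock n) :
    D.current p m z v = ∑ k ∈ comps n m,
      D.wordCoef p k • D.expOp p (D.wordCre p k z) (D.wordAnn p k z) v := by
  have h : (-1 : Sym n) ^ m * D.miura p m z = ∑ k ∈ comps n m,
      MvPolynomial.monomial (D.word k z) (∏ i, D.blockCoef p i (k i)) := by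
    rw [miura_eq, Finset.mul_sum]
    refine Finset.sum_congr rfl fun k _ => ?_
    have : (-1 : Sym n) ^ m = MvPolynomial.C ((-1) ^ m) := by simp
    rw [this, MvPolynomial.C_mul_monomial, ← mul_assoc, ← mul_pow]
    simp
  rw [current, h, nord_sum_monomial]
  refine Finset.sum_congr rfl fun k _ => ?_
  rw [nordMonomial_word, smul_smul, wordCoef, mul_comm]

theorem entry_current (m : ℕ) (z : ℂ) (mu nu : Mode n →₀ ℕ) :
    entry (D.current p m z) mu nu = ∑ k ∈ comps n m,
      D.wordCoef p k * entry (D.expOp p (D.wordCre p k z) (D.wordAnn p k z)) mu nu := by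
  simp only [entry, current_eq, map_sum, map_smul, smul_eq_mul]

/-! ### Products of currents -/

/-- The logarithm of the contraction of two normally ordered monomials. -/
def contraction (k l : Fin n → ℕ) (z w : ℂ) : ℂ :=
  ∑' M, D.wordAnn p k z M * D.comm p M * D.wordCre p l w M

theorem hasSum_entry_current (r m : ℕ) (z w : ℂ)
    (h : ∀ k l : Fin n → ℕ, k ∈ comps n r → l ∈ comps n m →
      Summable fun M => ‖D.wordAnn p k z M * D.comm p M * D.wordCre p l w M‖)
    (mu lam : Mode n →₀ ℕ) :
    HasSum (fun nu => entry (D.current p r z) mu nu * entry (D.current p m w) nu lam)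
      (∑ k ∈ comps n r, ∑ l ∈ comps n m, D.wordCoef p k * D.wordCoef p l
        * (Complex.exp (D.contraction p k l z w)
          * entry (D.expOp p (D.wordCre p k z + D.wordCre p l w)
            (D.wordAnn p k z + D.wordAnn p l w)) mu lam)) := by
  simp_rw [entry_current, Finset.sum_mul_sum]
  refine hasSum_sum fun k hk => hasSum_sum fun l hl => ?_
  have := (D.hasSum_entry_expOp p (A := D.wordCre p k z) (B' := D.wordAnn p l w)
    (h k l hk hl) mu lam).mul_left (D.wordCoef p k * D.wordCoef p l)
  refine (congrArg (fun g => HasSum g _) (funext fun ν => ?_)).mpr this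
  ring

end Data

/-! ### Differentiability of matrix elements -/

theorem differentiableAt_coeff_translate {ι : Type*} {b : ℂ → ι → ℂ} {t₀ : ℂ}
    (hb : ∀ i, DifferentiableAt ℂ (fun t => b t i) t₀) (κ τ : ι →₀ ℕ) :
    DifferentiableAt ℂ (fun t => MvPolynomial.coeff κ (translate (b t) (MvPolynomial.monomial τ 1)))
      t₀ := by
  simp only [coeff_translate_monomial]
  split_ifs
  · simp only [Finsupp.prod]
    refine DifferentiableAt.fun_finsetProd fun i _ => ?_
    exact ((hb i).pow _).mul_const _
  · exact differentiableAt_const _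

theorem differentiableAt_expTerm {ι : Type*} {A : ℂ → ι → ℂ} {t₀ : ℂ}
    (hA : ∀ i, DifferentiableAt ℂ (fun t => A t i) t₀) (τ : ι →₀ ℕ) :
    DifferentiableAt ℂ (fun t => expTerm (A t) τ) t₀ := by
  simp only [expTerm, Finsupp.prod]
  exact DifferentiableAt.fun_finsetProd fun i _ => ((hA i).pow _).div_const _

/-- A matrix element is a polynomial in finitely many exponents, and the annihilation exponents
enter it only through their products with the commutators. -/
theorem differentiableAt_entry_expOp (D : Data n) {p : ℂ → ℂ} {A B : ℂ → Mode n → ℂ} {t₀ : ℂ}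
    (hA : ∀ M, DifferentiableAt ℂ (fun t => A t M) t₀)
    (hB : ∀ M, DifferentiableAt ℂ (fun t => B t M * D.comm (p t) M) t₀) (mu nu : Mode n →₀ ℕ) :
    DifferentiableAt ℂ (fun t => entry (D.expOp (p t) (A t) (B t)) mu nu) t₀ := by
  classical
  simp only [entry, Data.expOp, Data.expAnn_eq, Data.expCre_eq, MvPowerSeries.coeff_mul,
    MvPolynomial.coeff_coe, coeff_expSeries]
  exact DifferentiableAt.fun_sum fun x _ => (differentiableAt_expTerm hA _).mul
    (differentiableAt_coeff_translate hB _ _)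

/-! ### Geometrically bounded sequences -/

/-- Sequences with `‖α_k‖ ≤ K^k` for `k ≥ 1`. -/
def GeomBdd (α : ℕ → ℂ) : Prop := ∃ K : ℝ, 0 ≤ K ∧ ∀ k : ℕ, 1 ≤ k → ‖α k‖ ≤ K ^ k

namespace GeomBdd

theorem pow (c : ℂ) : GeomBdd fun k => c ^ k :=
  ⟨‖c‖, norm_nonneg _, fun k _ => (norm_pow c k).le⟩

theorem const (c : ℂ) : GeomBdd fun _ => c :=
  ⟨max 1 ‖c‖, zero_le_one.trans (le_max_left _ _), fun k hk =>
    (le_max_right 1 ‖c‖).trans (le_self_pow₀ (le_max_left _ _) (by omega))⟩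

theorem mul {α β : ℕ → ℂ} (hα : GeomBdd α) (hβ : GeomBdd β) : GeomBdd fun k => α k * β k := by
  obtain ⟨K, hK, h⟩ := hα
  obtain ⟨K', hK', h'⟩ := hβ
  refine ⟨K * K', by positivity, fun k hk => ?_⟩
  rw [norm_mul, mul_pow]
  exact mul_le_mul (h k hk) (h' k hk) (norm_nonneg _) (by positivity)

theorem add {α β : ℕ → ℂ} (hα : GeomBdd α) (hβ : GeomBdd β) : GeomBdd fun k => α k + β k := by
  obtain ⟨K, hK, h⟩ := hα
  obtain ⟨K', hK', h'⟩ := hβ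
  refine ⟨K + K', by positivity, fun k hk => ?_⟩
  refine (norm_add_le _ _).trans ((add_le_add (h k hk) (h' k hk)).trans ?_)
  exact pow_add_pow_le hK hK' (by omega)

theorem neg {α : ℕ → ℂ} (hα : GeomBdd α) : GeomBdd fun k => -α k := by
  simpa using (const (-1)).mul hα

theorem sub {α β : ℕ → ℂ} (hα : GeomBdd α) (hβ : GeomBdd β) : GeomBdd fun k => α k - β k := by
  simpa [sub_eq_add_neg] using hα.add hβ.neg

theorem sum {ι : Type*} (s : Finset ι) {α : ι → ℕ → ℂ} (h : ∀ i ∈ s, GeomBdd (α i)) :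
    GeomBdd fun k => ∑ i ∈ s, α i k := by
  classical
  induction s using Finset.induction_on with
  | empty => simpa using const 0
  | insert i s hi ih =>
    simp only [Finset.sum_insert hi]
    exact (h i (Finset.mem_insert_self _ _)).add
      (ih fun j hj => h j (Finset.mem_insert_of_mem hj))

theorem prod {ι : Type*} (s : Finset ι) {α : ι → ℕ → ℂ} (h : ∀ i ∈ s, GeomBdd (α i)) :
    GeomBdd fun k => ∏ i ∈ s, α i k := by
  classical
  induction s using Finset.induction_on with
  | empty => simpa using const 1
  | insert i s hi ih =>
    simp only [Finset.prod_insert hi]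
    exact (h i (Finset.mem_insert_self _ _)).mul
      (ih fun j hj => h j (Finset.mem_insert_of_mem hj))

theorem inv_natCast : GeomBdd fun k => (k : ℂ)⁻¹ :=
  ⟨1, zero_le_one, fun k hk => by
    rw [norm_inv, Complex.norm_natCast, one_pow]
    exact inv_le_one_of_one_le₀ (by exact_mod_cast hk)⟩

theorem inv_pow (c : ℂ) : GeomBdd fun k => (c ^ k)⁻¹ := by
  simpa using pow c⁻¹

theorem congr {α β : ℕ → ℂ} (hα : GeomBdd α) (h : ∀ k, 1 ≤ k → β k = α k) : GeomBdd β := by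
  obtain ⟨K, hK, h'⟩ := hα
  exact ⟨K, hK, fun k hk => by rw [h k hk]; exact h' k hk⟩

/-- A common constant for finitely many geometrically bounded sequences. -/
theorem exists_common {ι : Type*} (s : Finset ι) {α : ι → ℕ → ℂ} (h : ∀ i ∈ s, GeomBdd (α i)) :
    ∃ K : ℝ, 0 ≤ K ∧ ∀ i ∈ s, ∀ k : ℕ, 1 ≤ k → ‖α i k‖ ≤ K ^ k := by
  classical
  induction s using Finset.induction_on with
  | empty => exact ⟨0, le_rfl, by simp⟩
  | insert i s hi ih =>
    obtain ⟨K, hK, h1⟩ := h i (Finset.mem_insert_self _ _)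
    obtain ⟨K', hK', h2⟩ := ih fun j hj => h j (Finset.mem_insert_of_mem hj)
    refine ⟨max K K', hK.trans (le_max_left _ _), fun j hj k hk => ?_⟩
    rcases Finset.mem_insert.1 hj with rfl | hj
    · exact (h1 k hk).trans (pow_le_pow_left₀ hK (le_max_left _ _) k)
    · exact (h2 j hj k hk).trans (pow_le_pow_left₀ hK' (le_max_right _ _) k)

end GeomBdd

/-! ### Telescoping sums over `Fin n` -/

theorem sum_fin_telescope (F : ℕ → ℂ) : ∑ a : Fin n, (F (a + 1) - F a) = F n - F 0 := by
  rw [Fin.sum_univ_eq_sum_range (fun a => F (a + 1) - F a) n, Finset.sum_range_sub]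

theorem sum_fin_lt_telescope (F : ℕ → ℂ) (j : Fin n) :
    ∑ a : Fin n, (if a < j then F (a + 1) - F a else 0) = F j - F 0 := by
  have : ∀ a : Fin n, (if a < j then F (a + 1) - F a else 0)
      = (fun a : ℕ => if a < (j : ℕ) then F (a + 1) - F a else 0) a := fun a => by
    simp only [Fin.lt_def]
  rw [Finset.sum_congr rfl fun a _ => this a, Fin.sum_univ_eq_sum_range (fun a : ℕ => if a < (j : ℕ) then F (a + 1) - F a else 0) n,
    ← Finset.sum_filter, ← Finset.sum_range_sub]
  congr 1
  ext a
  simp only [Finset.mem_filter, Finset.mem_range]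
  omega

/-! ### Genericity, duality of the parameters and small divisors -/

namespace Data

/-- The data with all parameters `q_i` replaced by their inverses. -/
def dual (D : Data n) : Data n := ⟨fun i => (D.s i)⁻¹, D.c, D.u⟩

/-- The genericity assumptions on the parameters. -/
structure Generic (D : Data n) : Prop where
  hprod : D.qh 0 * D.qh 1 * D.qh 2 = 1
  s_ne_zero : ∀ i, D.s i ≠ 0
  q_pow_ne_one : ∀ i, ∀ k : ℕ, 1 ≤ k → D.q i ^ k ≠ 1
  exists_le : ∃ ε : ℝ, 0 < ε ∧ ∀ k : ℕ, 1 ≤ k → ε ^ k ≤ ‖D.qc ^ k - 1‖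

variable (D : Data n) (p : ℂ)

theorem dual_c : D.dual.c = D.c := rfl
theorem dual_s (i : Fin 3) : D.dual.s i = (D.s i)⁻¹ := rfl
theorem dual_qh (i : Fin 3) : D.dual.qh i = (D.qh i)⁻¹ := by simp [qh, dual_s]
theorem dual_q (i : Fin 3) : D.dual.q i = (D.q i)⁻¹ := by simp [q, dual_s]
theorem dual_qch : D.dual.qch = D.qch⁻¹ := by simp [qch, dual_qh, dual_c]
theorem dual_qc : D.dual.qc = D.qc⁻¹ := by simp [qc, dual_q, dual_c]
theorem dual_left (i : Fin n) : D.dual.left i = (D.left i)⁻¹ := by simp [left, dual_qh, dual_c]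
theorem dual_right (i : Fin n) : D.dual.right i = (D.right i)⁻¹ := by simp [right, dual_qh, dual_c]
theorem qh_sq (i : Fin 3) : D.qh i ^ 2 = D.q i := by rw [qh, q, ← pow_mul]
theorem qch_sq : D.qch ^ 2 = D.qc := by simp [qch, qc, ← Finset.prod_pow, qh_sq]

namespace Generic

variable {D}

theorem qh_ne_zero (h : D.Generic) (i : Fin 3) : D.qh i ≠ 0 := pow_ne_zero _ (h.s_ne_zero i)
theorem q_ne_zero (h : D.Generic) (i : Fin 3) : D.q i ≠ 0 := pow_ne_zero _ (h.s_ne_zero i)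
theorem qch_ne_zero (h : D.Generic) : D.qch ≠ 0 := Finset.prod_ne_zero_iff.2 fun _ _ => h.qh_ne_zero _
theorem qc_ne_zero (h : D.Generic) : D.qc ≠ 0 := Finset.prod_ne_zero_iff.2 fun _ _ => h.q_ne_zero _
theorem left_ne_zero (h : D.Generic) (i : Fin n) : D.left i ≠ 0 :=
  Finset.prod_ne_zero_iff.2 fun _ _ => h.qh_ne_zero _
theorem right_ne_zero (h : D.Generic) (i : Fin n) : D.right i ≠ 0 :=
  Finset.prod_ne_zero_iff.2 fun _ _ => h.qh_ne_zero _

theorem kap_ne_zero (h : D.Generic) {k : ℕ} (hk : 1 ≤ k) : D.kap k ≠ 0 :=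
  Finset.prod_ne_zero_iff.2 fun i _ => sub_ne_zero.2 (h.q_pow_ne_one i k hk)

theorem qc_pow_ne_one (h : D.Generic) {k : ℕ} (hk : 1 ≤ k) : D.qc ^ k - 1 ≠ 0 := by
  obtain ⟨ε, hε, hb⟩ := h.exists_le
  exact norm_pos_iff.1 ((pow_pos hε k).trans_le (hb k hk))

theorem q_prod (h : D.Generic) : D.q 0 * D.q 1 * D.q 2 = 1 := by
  simp only [← qh_sq, ← mul_pow, h.hprod, one_pow]

theorem dual (h : D.Generic) : D.dual.Generic where
  hprod := by
    simp only [dual_qh, ← mul_inv, h.hprod, inv_one]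
  s_ne_zero i := inv_ne_zero (h.s_ne_zero i)
  q_pow_ne_one i k hk := by
    rw [dual_q, inv_pow, Ne, inv_eq_one]
    exact h.q_pow_ne_one i k hk
  exists_le := by
    obtain ⟨ε, hε, hb⟩ := h.exists_le
    have h0 : 0 < ‖D.qc‖ := norm_pos_iff.2 h.qc_ne_zero
    refine ⟨ε / ‖D.qc‖, by positivity, fun k hk => ?_⟩
    have h1 : D.dual.qc ^ k - 1 = -(D.qc ^ k - 1) / D.qc ^ k := by
      have := pow_ne_zero k h.qc_ne_zero
      rw [dual_qc, inv_pow]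
      field_simp
      ring
    rw [h1, norm_div, norm_neg, norm_pow, div_pow]
    exact div_le_div_of_nonneg_right (hb k hk) (by positivity)

theorem qh_sub_inv_ne_zero (h : D.Generic) (i : Fin 3) {k : ℕ} (hk : 1 ≤ k) :
    D.qh i ^ k - (D.qh i ^ k)⁻¹ ≠ 0 := by
  have h0 := pow_ne_zero k (h.qh_ne_zero i)
  intro he
  refine h.q_pow_ne_one i k hk ?_
  rw [← qh_sq, ← pow_mul, mul_comm, pow_mul]
  field_simp at he
  linear_combination he

theorem q_pow_sub_one (h : D.Generic) (i : Fin 3) (k : ℕ) :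
    D.q i ^ k - 1 = D.qh i ^ k * (D.qh i ^ k - (D.qh i ^ k)⁻¹) := by
  have h0 := pow_ne_zero k (h.qh_ne_zero i)
  rw [← qh_sq, ← pow_mul, mul_comm 2, pow_mul]
  field_simp

theorem qc_pow_sub_one (h : D.Generic) (k : ℕ) :
    D.qc ^ k - 1 = D.qch ^ k * (D.qch ^ k - (D.qch ^ k)⁻¹) := by
  have h0 := pow_ne_zero k h.qch_ne_zero
  rw [← qch_sq, ← pow_mul, mul_comm 2, pow_mul]
  field_simp

theorem qch_sub_inv_ne_zero (h : D.Generic) {k : ℕ} (hk : 1 ≤ k) :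
    D.qch ^ k - (D.qch ^ k)⁻¹ ≠ 0 := fun he =>
  h.qc_pow_ne_one hk (by rw [h.qc_pow_sub_one, he, mul_zero])

theorem dual_kap (h : D.Generic) (k : ℕ) : D.dual.kap k = -D.kap k := by
  have h1 : (D.q 0 ^ k) * (D.q 1 ^ k) * (D.q 2 ^ k) = 1 := by
    rw [← mul_pow, ← mul_pow, h.q_prod, one_pow]
  have h0 := pow_ne_zero k (h.q_ne_zero 0)
  have h1' := pow_ne_zero k (h.q_ne_zero 1)
  have h2 := pow_ne_zero k (h.q_ne_zero 2)
  simp only [kap, Fin.prod_univ_three, dual_q, inv_pow]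
  field_simp
  linear_combination ((D.q 0 ^ k - 1) * (D.q 1 ^ k - 1) * (D.q 2 ^ k - 1)) * h1

theorem geomBdd_inv_qc (h : D.Generic) : GeomBdd fun k => (D.qc ^ k - 1)⁻¹ := by
  obtain ⟨ε, hε, hb⟩ := h.exists_le
  refine ⟨ε⁻¹, by positivity, fun k hk => ?_⟩
  rw [norm_inv, inv_pow]
  exact inv_anti₀ (by positivity) (hb k hk)

theorem geomBdd_inv_qch (h : D.Generic) : GeomBdd fun k => (D.qch ^ k - (D.qch ^ k)⁻¹)⁻¹ := by
  refine ((GeomBdd.pow D.qch).mul h.geomBdd_inv_qc).congr fun k _ => ?_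
  have h0 := pow_ne_zero k h.qch_ne_zero
  rw [h.qc_pow_sub_one, mul_inv, ← mul_assoc, mul_inv_cancel₀ h0, one_mul]

/-- The factor `q_i^k - 1` of `kap` cancels the small divisor, so no lower bound on `‖q_i^k - 1‖` is
needed. -/
theorem geomBdd_kap_div (h : D.Generic) (i : Fin 3) :
    GeomBdd fun k => D.kap k * (D.qh i ^ k - (D.qh i ^ k)⁻¹)⁻¹ := by
  refine ((GeomBdd.pow (D.qh i)).mul (GeomBdd.prod (Finset.univ.erase i)
    (α := fun j k => D.q j ^ k - 1) fun j _ => (GeomBdd.pow _).sub (GeomBdd.const 1))).congr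
    fun k hk => ?_
  rw [kap, ← Finset.mul_prod_erase Finset.univ _ (Finset.mem_univ i), h.q_pow_sub_one]
  have := h.qh_sub_inv_ne_zero i hk
  generalize D.qh i ^ k - (D.qh i ^ k)⁻¹ = e at this ⊢
  field_simp

end Generic

theorem geomBdd_kap : GeomBdd D.kap :=
  GeomBdd.prod Finset.univ fun _ _ => (GeomBdd.pow _).sub (GeomBdd.const 1)

/-! ### Partial products of `q_c^{1/2}` -/

/-- `C_1 ⋯ C_i` for a natural number `i`. -/
def leftNat (i : ℕ) : ℂ := ∏ l ∈ Finset.univ.filter (fun l : Fin n => (l : ℕ) < i), D.qh (D.c l)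

theorem left_eq (i : Fin n) : D.left i = D.leftNat i := by
  rw [left, leftNat]
  congr 1
  ext l
  simp only [Finset.mem_filter, Finset.mem_univ, true_and, Finset.mem_Iio, Fin.lt_def]

theorem leftNat_zero : D.leftNat 0 = 1 := by simp [leftNat]

theorem leftNat_last : D.leftNat n = D.qch := by
  rw [leftNat, qch]
  congr 1
  ext l
  simp

theorem leftNat_succ (i : Fin n) : D.leftNat (i + 1) = D.left i * D.qh (D.c i) := by
  rw [left, leftNat, mul_comm, ← Finset.prod_insert (f := fun l => D.qh (D.c l)) (by simp)]
  congr 1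
  ext l
  simp only [Finset.mem_filter, Finset.mem_univ, true_and, Finset.mem_insert, Finset.mem_Iio,
    Fin.lt_def, Fin.ext_iff]
  omega

theorem left_mul_right (i : Fin n) : D.left i * D.qh (D.c i) * D.right i = D.qch := by
  rw [left, right, qch, mul_comm _ (D.qh (D.c i)), ← Finset.prod_insert (f := fun l => D.qh (D.c l)) (by simp),
    ← Finset.prod_union]
  · congr 1
    ext l
    simp only [Finset.mem_union, Finset.mem_insert, Finset.mem_Iio, Finset.mem_Ioi,
      Finset.mem_univ, iff_true, Fin.lt_def, Fin.ext_iff]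
    omega
  · rw [Finset.disjoint_left]
    intro l
    simp only [Finset.mem_insert, Finset.mem_Iio, Finset.mem_Ioi, Fin.lt_def, Fin.ext_iff]
    omega

/-! ### Contractions of vertex operators -/

/-- `q_{c_a}^{k/2} - q_{c_a}^{-k/2}` -/
def qDiff (a : Fin n) (k : ℕ) : ℂ := D.qh (D.c a) ^ k - (D.qh (D.c a) ^ k)⁻¹

/-- `q_c^{k/2} - q_c^{-k/2}` -/
def qcDiff (k : ℕ) : ℂ := D.qch ^ k - (D.qch ^ k)⁻¹

/-- The annihilation part of a vertex operator in the `a`-th tensor factor, normalized. -/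
def annCoef (i a : Fin n) (k : ℕ) : ℂ :=
  (if a = i then -(D.qh (D.c a) ^ k * D.qDiff a k * D.left a ^ k)⁻¹ else 0)
    + (D.qch ^ k)⁻¹ * D.left a ^ k * (D.qcDiff k)⁻¹

/-- The creation part of a vertex operator in the `a`-th tensor factor, normalized. -/
def creCoef (j a : Fin n) (k : ℕ) : ℂ :=
  -((D.right a ^ k)⁻¹ * (D.qcDiff k)⁻¹)
    + if a < j then -(D.left a * D.qh (D.c a)) ^ k
      else if a = j then (D.qDiff a k)⁻¹ * D.left a ^ k else 0

/-- The coefficient of `x^k / (1 - p^k)` in the contraction of two vertex operators that comes from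
the `k`-th modes of the `a`-th tensor factor. -/
def modeCoef (i j a : Fin n) (k : ℕ) : ℂ :=
  D.kap k * (k : ℂ)⁻¹ * D.qDiff a k * D.annCoef i a k * D.creCoef j a k

theorem qDiff_def (a : Fin n) (k : ℕ) :
    D.qh (D.c a) ^ k - (D.qh (D.c a) ^ k)⁻¹ = D.qDiff a k := rfl

theorem qcDiff_def (k : ℕ) : D.qch ^ k - (D.qch ^ k)⁻¹ = D.qcDiff k := rfl

variable {D p}

theorem decAnn_inl (h : D.Generic) (i a : Fin n) (k : ℕ+) (ζ : ℂ) :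
    D.decAnn p i ζ (.inl (a, k)) = (1 / (1 - p ^ (k : ℕ))) * (D.kap k / k) * D.s (D.c a) ^ (k : ℕ)
      * (ζ ^ (k : ℕ))⁻¹ * D.annCoef i a k := by
  simp only [decAnn, lamAnn, betaAnn, bPos, annCoef, h.q_pow_sub_one, qDiff, qcDiff]
  split_ifs
  · simp only [mul_pow, mul_inv, div_eq_mul_inv]; ring
  · simp only [div_eq_mul_inv]; ring

theorem decCre_inl (j a : Fin n) (k : ℕ+) (ω : ℂ) :
    D.decCre p j ω (.inl (a, k)) = (1 / (1 - p ^ (k : ℕ))) * (D.kap k / k)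
      * (D.s (D.c a) ^ (k : ℕ))⁻¹ * ω ^ (k : ℕ) * D.creCoef j a k := by
  simp only [decCre, lamCre, alphaCre, bNeg, creCoef, qDiff, qcDiff]
  split_ifs
  · simp only [mul_pow, div_eq_mul_inv]; ring
  · simp only [mul_pow, div_eq_mul_inv]; ring
  · simp only [div_eq_mul_inv]; ring

theorem dual_qDiff (a : Fin n) (k : ℕ) : D.dual.qDiff a k = -D.qDiff a k := by
  simp [qDiff, dual_qh, dual_c]

theorem dual_qcDiff (k : ℕ) : D.dual.qcDiff k = -D.qcDiff k := by
  simp [qcDiff, dual_qch]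

/-- Up to sign and the nome factor, the `b` modes are the `a` modes of the dual data at the inverted
argument. This lets every coefficient computation be done once, for the `a` modes. -/
theorem decAnn_inr (h : D.Generic) (i a : Fin n) (k : ℕ+) (ζ : ℂ) :
    D.decAnn p i ζ (.inr (a, k)) = -((p ^ (k : ℕ) / (1 - p ^ (k : ℕ))) * (D.kap k / k)
      * (D.s (D.c a) ^ (k : ℕ))⁻¹ * ζ ^ (k : ℕ) * D.dual.annCoef i a k) := by
  have h1 : (D.q (D.c a) ^ (k : ℕ))⁻¹ - 1
      = (D.qh (D.c a) ^ (k : ℕ))⁻¹ * -D.qDiff a k := by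
    have := h.dual.q_pow_sub_one (D.c a) k
    simp only [dual_q, dual_qh, inv_pow, inv_inv] at this
    rw [this, qDiff, neg_sub]
  simp only [decAnn, lamAnn, betaAnn, bPos, annCoef, dual_qDiff, dual_qcDiff, dual_qh, dual_c,
    dual_left, dual_qch, h1, qcDiff_def]
  split_ifs
  · simp only [mul_pow, mul_inv, inv_pow, inv_neg, inv_inv, div_eq_mul_inv]; ring
  · simp only [inv_pow, inv_neg, inv_inv, div_eq_mul_inv]; ring

theorem decCre_inr (j a : Fin n) (k : ℕ+) (ω : ℂ) :
    D.decCre p j ω (.inr (a, k)) = -((p ^ (k : ℕ) / (1 - p ^ (k : ℕ))) * (D.kap k / k)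
      * (D.s (D.c a) ^ (k : ℕ)) * (ω ^ (k : ℕ))⁻¹ * D.dual.creCoef j a k) := by
  simp only [decCre, lamCre, alphaCre, bNeg, creCoef, dual_qDiff, dual_qcDiff, dual_qh, dual_c,
    dual_left, dual_right, qcDiff_def, qDiff_def]
  split_ifs
  · simp only [mul_pow, mul_inv, inv_pow, inv_neg, inv_inv, div_eq_mul_inv]; ring
  · simp only [mul_pow, mul_inv, inv_pow, inv_neg, inv_inv, div_eq_mul_inv]; ring
  · simp only [inv_pow, inv_neg, inv_inv, div_eq_mul_inv]; ring

theorem contraction_inl (h : D.Generic) (i j a : Fin n) (k : ℕ+) (ζ ω : ℂ)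
    (hp : 1 - p ^ (k : ℕ) ≠ 0) :
    D.decAnn p i ζ (.inl (a, k)) * D.comm p (.inl (a, k)) * D.decCre p j ω (.inl (a, k))
      = ω ^ (k : ℕ) * (ζ ^ (k : ℕ))⁻¹ * (1 / (1 - p ^ (k : ℕ))) * D.modeCoef i j a k := by
  have h1 := h.kap_ne_zero k.pos
  have h2 : (k : ℂ) ≠ 0 := by exact_mod_cast k.ne_zero
  have h3 := pow_ne_zero (k : ℕ) (h.s_ne_zero (D.c a))
  rw [decAnn_inl h, decCre_inl, modeCoef, comm, ← qDiff]
  field_simp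

theorem contraction_inr (h : D.Generic) (i j a : Fin n) (k : ℕ+) (ζ ω : ℂ) (hp0 : p ≠ 0)
    (hp : 1 - p ^ (k : ℕ) ≠ 0) :
    D.decAnn p i ζ (.inr (a, k)) * D.comm p (.inr (a, k)) * D.decCre p j ω (.inr (a, k))
      = (ω ^ (k : ℕ))⁻¹ * ζ ^ (k : ℕ) * (p ^ (k : ℕ) / (1 - p ^ (k : ℕ)))
        * D.dual.modeCoef i j a k := by
  have h1 := h.kap_ne_zero k.pos
  have h2 : (k : ℂ) ≠ 0 := by exact_mod_cast k.ne_zero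
  have h3 := pow_ne_zero (k : ℕ) (h.s_ne_zero (D.c a))
  have h4 := pow_ne_zero (k : ℕ) hp0
  rw [decAnn_inr h, decCre_inr, modeCoef, comm, ← qDiff, dual_qDiff, h.dual_kap]
  field_simp

/-- Only the small divisors of `q_c` survive, and these are controlled by assumption. The `qDiff` of
the commutator removes the divisor on the annihilation side, and the one on the creation side is
removed by `kap`; the product is split so that each cancellation occurs in a separate term. -/
theorem geomBdd_modeCoef (h : D.Generic) (i j a : Fin n) : GeomBdd (D.modeCoef i j a) := by
  have hC := GeomBdd.inv_pow D.qch
  have hd : GeomBdd fun k => (D.qcDiff k)⁻¹ := h.geomBdd_inv_qch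
  have hL := GeomBdd.pow (D.left a)
  have hLi := GeomBdd.inv_pow (D.left a)
  have hh := GeomBdd.inv_pow (D.qh (D.c a))
  have hR := GeomBdd.inv_pow (D.right a)
  have hLh := GeomBdd.pow (D.left a * D.qh (D.c a))
  have he : GeomBdd (D.qDiff a) := (GeomBdd.pow _).sub (GeomBdd.inv_pow _)
  have hk : GeomBdd fun k => D.kap k * (k : ℂ)⁻¹ := D.geomBdd_kap.mul GeomBdd.inv_natCast
  have hke : GeomBdd fun k => D.kap k * (D.qDiff a k)⁻¹ * (k : ℂ)⁻¹ :=
    (h.geomBdd_kap_div (D.c a)).mul GeomBdd.inv_natCast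
  have hif : ∀ (P : Prop) [Decidable P] {α : ℕ → ℂ}, GeomBdd α →
      GeomBdd fun k => if P then α k else 0 := fun P _ α hα => by
    by_cases hP : P
    · simpa [hP] using hα
    · simpa [hP] using GeomBdd.const 0
  have hV : GeomBdd fun k => -((D.right a ^ k)⁻¹ * (D.qcDiff k)⁻¹)
      + if a < j then -(D.left a * D.qh (D.c a)) ^ k else 0 := (hR.mul hd).neg.add (hif _ hLh.neg)
  have hU1 : GeomBdd fun k => if a = i then -((D.qh (D.c a) ^ k)⁻¹ * (D.left a ^ k)⁻¹) else 0 :=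
    hif _ (hh.mul hLi).neg
  have hU2 := (hC.mul hL).mul hd
  have hW : GeomBdd fun k => if a = j then D.left a ^ k else 0 := hif _ hL
  refine (((hk.mul (hU1.add (he.mul hU2))).mul hV).add (((hke.mul hU1).mul hW).add
    ((hk.mul hU2).mul hW))).congr fun k hk1 => ?_
  have h0 := h.qh_sub_inv_ne_zero (D.c a) hk1
  rw [← qDiff] at h0
  simp only [modeCoef, annCoef, creCoef]
  by_cases h1 : a = i <;> by_cases h2 : a < j
  · simp only [if_pos h1, if_pos h2, if_neg h2.ne, mul_inv]
    field_simp
    ring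
  · by_cases h3 : a = j
    · simp only [if_pos h1, if_neg h2, if_pos h3, mul_inv]
      field_simp
      ring
    · simp only [if_pos h1, if_neg h2, if_neg h3, mul_inv]
      field_simp
      ring
  · simp only [if_neg h1, if_pos h2, if_neg h2.ne]
    ring
  · by_cases h3 : a = j
    · simp only [if_neg h1, if_neg h2, if_pos h3]
      field_simp
      ring
    · simp only [if_neg h1, if_neg h2, if_neg h3]
      ring

variable (D) in
/-- The coefficient of `x^k / (1 - p^k)` in the logarithm of the contraction of `Λ̃_i(z)` and
`Λ̃_j(w)`, where `x = w / z`. -/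
def pairCoef (i j : Fin n) (k : ℕ) : ℂ :=
  D.kap k * (k : ℂ)⁻¹ * ((D.qc ^ k - 1)⁻¹ + (if i < j then 1 else 0)
    - if i = j then (D.q (D.c i) ^ k - 1)⁻¹ else 0)

/-- The part not confined to `a = i` is built from increments of the partial products of the
`q_{c_l}^k` and from the value at `j`. After telescoping these cancel completely, and the terms at
`a = i` form the answer. -/
theorem sum_modeCoef (h : D.Generic) (i j : Fin n) {k : ℕ} (hk : 1 ≤ k) :
    ∑ a, D.modeCoef i j a k = D.pairCoef i j k := by
  have hC := pow_ne_zero k h.qch_ne_zero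
  have hd : D.qcDiff k ≠ 0 := h.qch_sub_inv_ne_zero hk
  have he : ∀ a, D.qDiff a k ≠ 0 := fun a => h.qh_sub_inv_ne_zero _ hk
  have hL : ∀ a, D.left a ^ k ≠ 0 := fun a => pow_ne_zero k (h.left_ne_zero a)
  have hR : ∀ a, D.right a ^ k ≠ 0 := fun a => pow_ne_zero k (h.right_ne_zero a)
  have hh : ∀ a, D.qh (D.c a) ^ k ≠ 0 := fun a => pow_ne_zero k (h.qh_ne_zero _)
  have hLR : ∀ a, D.left a ^ k * D.qh (D.c a) ^ k * D.right a ^ k = D.qch ^ k := fun a => by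
    rw [← mul_pow, ← mul_pow, D.left_mul_right]
  -- `F a` is the `k`-th power of the product of the first `a` parameters `q_{c_l}`; thus `F 0 = 1`
  -- and `F n = q_c^k`.
  set F : ℕ → ℂ := fun a => (D.leftNat a ^ k) ^ 2 with hF
  have hFa : ∀ a : Fin n, F (a + 1) - F a
      = D.qDiff a k * (D.left a ^ k) ^ 2 * D.qh (D.c a) ^ k := fun a => by
    have := hh a
    simp only [hF, leftNat_succ, ← left_eq, qDiff, mul_pow]
    field_simp
  have key : ∀ a, D.qDiff a k * D.annCoef i a k * D.creCoef j a k
      = (if a = i then (D.qch ^ k * D.qcDiff k)⁻¹ + (if a < j then 1 else 0)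
          - (if a = j then (D.qh (D.c a) ^ k * D.qDiff a k)⁻¹ else 0) else 0)
        + (D.qch ^ k)⁻¹ * (D.qcDiff k)⁻¹ * (-(D.qch ^ k * D.qcDiff k)⁻¹ * (F (a + 1) - F a)
          - (if a < j then F (a + 1) - F a else 0) + (if a = j then F a else 0)) := fun a => by
    have hea := he a
    have hLa := hL a
    have hRa := hR a
    have hha := hh a
    rw [hFa a, annCoef, creCoef, ← hLR a]
    simp only [hF, ← left_eq, mul_pow]
    by_cases h1 : a = i <;> by_cases h2 : a < j
    · simp only [if_pos h1, if_pos h2, if_neg h2.ne]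
      field_simp
      ring
    · by_cases h3 : a = j
      · simp only [if_pos h1, if_neg h2, if_pos h3]
        field_simp
        ring
      · simp only [if_pos h1, if_neg h2, if_neg h3]
        field_simp
        ring
    · simp only [if_neg h1, if_pos h2, if_neg h2.ne]
      field_simp
      ring
    · by_cases h3 : a = j
      · simp only [if_neg h1, if_neg h2, if_pos h3]
        field_simp
        ring
      · simp only [if_neg h1, if_neg h2, if_neg h3]
        field_simp
        ring
  have hCd : D.qch ^ k * D.qcDiff k = (D.qch ^ k) ^ 2 - 1 := by
    rw [qcDiff]; field_simp
  have hsum : ∑ a, D.qDiff a k * D.annCoef i a k * D.creCoef j a k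
      = (D.qc ^ k - 1)⁻¹ + (if i < j then 1 else 0)
        - if i = j then (D.q (D.c i) ^ k - 1)⁻¹ else 0 := by
    rw [Finset.sum_congr rfl fun a _ => key a, Finset.sum_add_distrib, Finset.sum_ite_eq',
      if_pos (Finset.mem_univ i), ← Finset.mul_sum, Finset.sum_add_distrib, Finset.sum_sub_distrib,
      ← Finset.mul_sum, sum_fin_telescope, sum_fin_lt_telescope, Finset.sum_ite_eq',
      if_pos (Finset.mem_univ j), h.qc_pow_sub_one, h.q_pow_sub_one, ← qcDiff, ← qDiff]
    have hFn : F n = (D.qch ^ k) ^ 2 := by simp only [hF, leftNat_last]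
    have hF0 : F 0 = 1 := by simp only [hF, leftNat_zero, one_pow]
    have h1 : (D.qch ^ k * D.qcDiff k)⁻¹ * ((D.qch ^ k) ^ 2 - 1) = 1 := by
      rw [← hCd, inv_mul_cancel₀ (mul_ne_zero hC hd)]
    rw [hFn, hF0]
    linear_combination (-(D.qch ^ k)⁻¹ * (D.qcDiff k)⁻¹) * h1
  rw [pairCoef, ← hsum, Finset.mul_sum]
  exact Finset.sum_congr rfl fun a _ => by rw [modeCoef]; ring

end Data

/-! ### Pairs of exponential series -/

/-- Term of index `k` of the series `∑ x^k α_k / (1 - p^k) + ∑ p^k x^{-k} β_k / (1 - p^k)`. -/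
def logTerm (p x : ℂ) (α β : ℕ → ℂ) (k : ℕ+) : ℂ :=
  x ^ (k : ℕ) * (1 / (1 - p ^ (k : ℕ))) * α k
    + (x ^ (k : ℕ))⁻¹ * (p ^ (k : ℕ) / (1 - p ^ (k : ℕ))) * β k

theorem norm_one_sub_pow_ge {p : ℂ} (hp : ‖p‖ < 1) (k : ℕ+) : 1 - ‖p‖ ≤ ‖1 - p ^ (k : ℕ)‖ := by
  have h1 : ‖p ^ (k : ℕ)‖ ≤ ‖p‖ := by
    rw [norm_pow]
    exact pow_le_of_le_one (norm_nonneg _) hp.le k.ne_zero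
  have h2 := norm_sub_norm_le (1 : ℂ) (p ^ (k : ℕ))
  rw [norm_one] at h2
  linarith

theorem one_sub_pow_ne_zero {p : ℂ} (hp : ‖p‖ < 1) (k : ℕ+) : 1 - p ^ (k : ℕ) ≠ 0 :=
  norm_pos_iff.1 ((sub_pos.2 hp).trans_le (norm_one_sub_pow_ge hp k))

theorem summable_norm_pos {p x : ℂ} (hp : ‖p‖ < 1) {α : ℕ → ℂ} {K : ℝ}
    (hα : ∀ k : ℕ, 1 ≤ k → ‖α k‖ ≤ K ^ k) (hK : 0 ≤ K) (hx : K * ‖x‖ < 1) :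
    Summable fun k : ℕ+ => ‖x ^ (k : ℕ) * (1 / (1 - p ^ (k : ℕ))) * α k‖ := by
  have hp' := sub_pos.2 hp
  have h0 : Summable fun k : ℕ+ => (K * ‖x‖) ^ (k : ℕ) * (1 - ‖p‖)⁻¹ :=
    ((summable_geometric_of_lt_one (by positivity) hx).comp_injective PNat.coe_injective).mul_right _
  refine h0.of_nonneg_of_le (fun _ => norm_nonneg _) fun k => ?_
  rw [norm_mul, norm_mul, norm_pow, norm_div, norm_one, one_div]
  have h1 : ‖1 - p ^ (k : ℕ)‖⁻¹ ≤ (1 - ‖p‖)⁻¹ := inv_anti₀ hp' (norm_one_sub_pow_ge hp k)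
  calc ‖x‖ ^ (k : ℕ) * ‖1 - p ^ (k : ℕ)‖⁻¹ * ‖α k‖ ≤ ‖x‖ ^ (k : ℕ) * (1 - ‖p‖)⁻¹ * K ^ (k : ℕ) := by
        gcongr
        exact hα k k.pos
    _ = (K * ‖x‖) ^ (k : ℕ) * (1 - ‖p‖)⁻¹ := by ring

theorem summable_norm_neg {p x : ℂ} (hp : ‖p‖ < 1) {β : ℕ → ℂ} {K : ℝ}
    (hβ : ∀ k : ℕ, 1 ≤ k → ‖β k‖ ≤ K ^ k) (hK : 0 ≤ K) (hx : K * ‖p * x⁻¹‖ < 1) :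
    Summable fun k : ℕ+ => ‖(x ^ (k : ℕ))⁻¹ * (p ^ (k : ℕ) / (1 - p ^ (k : ℕ))) * β k‖ := by
  refine (summable_norm_pos hp hβ hK hx).congr fun k => ?_
  rw [mul_pow, inv_pow]
  congr 1
  ring

theorem hasSum_logTerm {p x : ℂ} (hp : ‖p‖ < 1) {α β : ℕ → ℂ} {K : ℝ}
    (hα : ∀ k : ℕ, 1 ≤ k → ‖α k‖ ≤ K ^ k) (hβ : ∀ k : ℕ, 1 ≤ k → ‖β k‖ ≤ K ^ k) (hK : 0 ≤ K)
    (hx : K * ‖x‖ < 1) (hx' : K * ‖p * x⁻¹‖ < 1) :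
    HasSum (logTerm p x α β) (∑' k : ℕ+, x ^ (k : ℕ) * (1 / (1 - p ^ (k : ℕ))) * α k
      + ∑' k : ℕ+, (x ^ (k : ℕ))⁻¹ * (p ^ (k : ℕ) / (1 - p ^ (k : ℕ))) * β k) :=
  (summable_norm_pos hp hα hK hx).of_norm.hasSum.add (summable_norm_neg hp hβ hK hx').of_norm.hasSum

theorem logTerm_congr {p x : ℂ} {α β α' β' : ℕ → ℂ} (hα : ∀ k : ℕ, 1 ≤ k → α k = α' k)
    (hβ : ∀ k : ℕ, 1 ≤ k → β k = β' k) : logTerm p x α β = logTerm p x α' β' := by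
  funext k
  rw [logTerm, logTerm, hα k k.pos, hβ k k.pos]

theorem exists_hasSum_theta {p x c : ℂ} {K : ℝ} (hp : ‖p‖ < 1) (hc : ‖c‖ ≤ K) (hc' : ‖c⁻¹‖ ≤ K)
    (hx : K * ‖x‖ < 1) (hx' : K * ‖p * x⁻¹‖ < 1) :
    ∃ s, HasSum (logTerm p x (fun k => (k : ℂ)⁻¹ * c ^ k) (fun k => (k : ℂ)⁻¹ * c⁻¹ ^ k)) s ∧
      theta p (c * x) = Complex.exp (-s) := by
  have hK : 0 ≤ K := (norm_nonneg _).trans hc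
  have hb : ∀ c : ℂ, ‖c‖ ≤ K → ∀ k : ℕ, 1 ≤ k → ‖(k : ℂ)⁻¹ * c ^ k‖ ≤ K ^ k := fun c hc k hk => by
    rw [norm_mul, norm_inv, Complex.norm_natCast, norm_pow]
    refine (mul_le_of_le_one_left (by positivity) ?_).trans (pow_le_pow_left₀ (norm_nonneg _) hc k)
    exact inv_le_one_of_one_le₀ (by exact_mod_cast hk)
  refine ⟨_, hasSum_logTerm hp (hb c hc) (hb _ hc') hK hx hx', ?_⟩
  rw [theta_eq_exp hp]
  · congr 3
    · exact tsum_congr fun k => by rw [mul_pow, one_div, one_div]; ring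
    · exact tsum_congr fun k => by rw [mul_pow, mul_inv, inv_pow, one_div]; ring
  · rw [norm_mul]
    exact (mul_le_mul_of_nonneg_right hc (norm_nonneg _)).trans_lt hx
  · rw [mul_inv, mul_left_comm, norm_mul]
    exact (mul_le_mul_of_nonneg_right hc' (norm_nonneg _)).trans_lt hx'

namespace Data

variable (D : Data n) (p : ℂ)

/-! ### Contractions of normally ordered monomials -/

/-- A weighted double sum over the letters of two compositions. -/
def letterSum (k l : Fin n → ℕ) (P : Fin n → Fin n → ℂ) (κ : ℕ) : ℂ :=
  ∑ i, ∑ a ∈ Finset.range (k i), ∑ j, ∑ b ∈ Finset.range (l j),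
    (D.q 2 ^ (offset k i + a)) ^ κ * ((D.q 2 ^ (offset l j + b)) ^ κ)⁻¹ * P i j

/-- Contribution of the `κ`-th modes of the `a`-th tensor factor to a contraction. -/
def wordModeCoef (k l : Fin n → ℕ) (a : Fin n) (κ : ℕ) : ℂ :=
  D.letterSum k l (fun i j => D.modeCoef i j a κ) κ

/-- The coefficient of `x^κ / (1 - p^κ)` in the logarithm of a contraction. -/
def wordPairCoef (k l : Fin n → ℕ) (κ : ℕ) : ℂ :=
  D.letterSum k l (fun i j => D.pairCoef i j κ) κ

variable {D p}

theorem sum_wordModeCoef (h : D.Generic) (k l : Fin n → ℕ) {κ : ℕ} (hκ : 1 ≤ κ) :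
    ∑ a, D.wordModeCoef k l a κ = D.wordPairCoef k l κ := by
  simp only [wordModeCoef, wordPairCoef, letterSum]
  rw [Finset.sum_comm]
  refine Finset.sum_congr rfl fun i _ => ?_
  rw [Finset.sum_comm]
  refine Finset.sum_congr rfl fun a _ => ?_
  rw [Finset.sum_comm]
  refine Finset.sum_congr rfl fun j _ => ?_
  rw [Finset.sum_comm]
  refine Finset.sum_congr rfl fun b _ => ?_
  rw [← Finset.mul_sum, sum_modeCoef h i j hκ]

theorem geomBdd_wordModeCoef (h : D.Generic) (k l : Fin n → ℕ) (a : Fin n) :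
    GeomBdd (D.wordModeCoef k l a) :=
  GeomBdd.sum _ fun _ _ => GeomBdd.sum _ fun _ _ => GeomBdd.sum _ fun _ _ => GeomBdd.sum _ fun _ _ =>
    ((GeomBdd.pow _).mul (GeomBdd.inv_pow _)).mul (geomBdd_modeCoef h _ _ _)

theorem sum_mul_mul_sum (k l : Fin n → ℕ) (X Y : Fin n → ℕ → ℂ) (c : ℂ) :
    (∑ i, ∑ a ∈ Finset.range (k i), X i a) * c * ∑ j, ∑ b ∈ Finset.range (l j), Y j b
      = ∑ i, ∑ a ∈ Finset.range (k i), ∑ j, ∑ b ∈ Finset.range (l j), X i a * c * Y j b := by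
  simp only [Finset.sum_mul]
  simp only [Finset.mul_sum]

theorem mul_letterSum (k l : Fin n → ℕ) (P : Fin n → Fin n → ℂ) (κ : ℕ) (c : ℂ) :
    c * D.letterSum k l P κ = ∑ i, ∑ a ∈ Finset.range (k i), ∑ j, ∑ b ∈ Finset.range (l j),
      c * ((D.q 2 ^ (offset k i + a)) ^ κ * ((D.q 2 ^ (offset l j + b)) ^ κ)⁻¹ * P i j) := by
  simp only [letterSum, Finset.mul_sum]

theorem word_contraction_inl (h : D.Generic) (hp : ‖p‖ < 1) (k l : Fin n → ℕ) (z w : ℂ)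
    (a : Fin n) (κ : ℕ+) :
    D.wordAnn p k z (.inl (a, κ)) * D.comm p (.inl (a, κ)) * D.wordCre p l w (.inl (a, κ))
      = (w / z) ^ (κ : ℕ) * (1 / (1 - p ^ (κ : ℕ))) * D.wordModeCoef k l a κ := by
  rw [wordAnn, wordCre, sum_mul_mul_sum, wordModeCoef, mul_letterSum]
  refine Finset.sum_congr rfl fun i _ => Finset.sum_congr rfl fun b _ =>
    Finset.sum_congr rfl fun j _ => Finset.sum_congr rfl fun b' _ => ?_
  rw [contraction_inl h i j a κ _ _ (one_sub_pow_ne_zero hp κ)]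
  simp only [mul_pow, mul_inv, inv_pow, inv_inv, div_eq_mul_inv]
  ring

theorem word_contraction_inr (h : D.Generic) (hp0 : p ≠ 0) (hp : ‖p‖ < 1) (k l : Fin n → ℕ)
    (z w : ℂ) (a : Fin n) (κ : ℕ+) :
    D.wordAnn p k z (.inr (a, κ)) * D.comm p (.inr (a, κ)) * D.wordCre p l w (.inr (a, κ))
      = ((w / z) ^ (κ : ℕ))⁻¹ * (p ^ (κ : ℕ) / (1 - p ^ (κ : ℕ))) * D.dual.wordModeCoef k l a κ := by
  rw [wordAnn, wordCre, sum_mul_mul_sum, wordModeCoef, mul_letterSum]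
  refine Finset.sum_congr rfl fun i _ => Finset.sum_congr rfl fun b _ =>
    Finset.sum_congr rfl fun j _ => Finset.sum_congr rfl fun b' _ => ?_
  rw [contraction_inr h i j a κ _ _ hp0 (one_sub_pow_ne_zero hp κ)]
  simp only [dual_q, mul_pow, mul_inv, inv_pow, inv_inv, div_eq_mul_inv]
  ring

theorem summable_fin_prod {f : Fin n × ℕ+ → ℂ} (h : ∀ a, Summable fun κ => ‖f (a, κ)‖) :
    Summable fun x => ‖f x‖ :=
  (summable_prod_of_nonneg fun _ => norm_nonneg _).2 ⟨h, Summable.of_finite⟩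

theorem hasSum_fin_prod {f : Fin n × ℕ+ → ℂ} (h : ∀ a, Summable fun κ => ‖f (a, κ)‖) :
    HasSum f (∑' κ, ∑ a, f (a, κ)) := by
  have hs := (summable_fin_prod h).of_norm
  have h1 : ∑' x, f x = ∑' κ, ∑ a, f (a, κ) := by
    rw [hs.tsum_prod' fun a => (h a).of_norm, tsum_fintype,
      Summable.tsum_finsetSum fun a _ => (h a).of_norm]
  exact h1 ▸ hs.hasSum

/-- Wick's theorem needs absolute convergence over individual modes, hence bounds in each tensor
factor. Only afterwards may the tensor factors be summed first, which replaces `wordModeCoef` by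
`wordPairCoef`. -/
theorem hasSum_contraction {k l : Fin n → ℕ} {z w : ℂ} {K : ℝ} (h : D.Generic) (hp0 : p ≠ 0)
    (hp : ‖p‖ < 1)
    (h1 : ∀ a, ∀ κ : ℕ, 1 ≤ κ → ‖D.wordModeCoef k l a κ‖ ≤ K ^ κ)
    (h2 : ∀ a, ∀ κ : ℕ, 1 ≤ κ → ‖D.dual.wordModeCoef k l a κ‖ ≤ K ^ κ) (hK : 0 ≤ K)
    (hx : K * ‖w / z‖ < 1) (hx' : K * ‖p * (w / z)⁻¹‖ < 1) :
    (Summable fun M => ‖D.wordAnn p k z M * D.comm p M * D.wordCre p l w M‖) ∧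
      HasSum (logTerm p (w / z) (D.wordPairCoef k l) (D.dual.wordPairCoef k l))
        (D.contraction p k l z w) := by
  have s1 : ∀ a, Summable fun κ : ℕ+ =>
      ‖D.wordAnn p k z (.inl (a, κ)) * D.comm p (.inl (a, κ)) * D.wordCre p l w (.inl (a, κ))‖ :=
    fun a => by
      simp only [word_contraction_inl h hp]
      exact summable_norm_pos hp (h1 a) hK hx
  have s2 : ∀ a, Summable fun κ : ℕ+ =>
      ‖D.wordAnn p k z (.inr (a, κ)) * D.comm p (.inr (a, κ)) * D.wordCre p l w (.inr (a, κ))‖ :=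
    fun a => by
      simp only [word_contraction_inr h hp0 hp]
      exact summable_norm_neg hp (h2 a) hK hx'
  have hs : Summable fun M => ‖D.wordAnn p k z M * D.comm p M * D.wordCre p l w M‖ :=
    Summable.sum _ (summable_fin_prod (f := fun x => D.wordAnn p k z (.inl x) * D.comm p (.inl x)
      * D.wordCre p l w (.inl x)) s1) (summable_fin_prod (f := fun x => D.wordAnn p k z (.inr x)
      * D.comm p (.inr x) * D.wordCre p l w (.inr x)) s2)
  refine ⟨hs, ?_⟩
  have t1 := hasSum_fin_prod (f := fun x => D.wordAnn p k z (.inl x) * D.comm p (.inl x)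
      * D.wordCre p l w (.inl x)) s1
  have t2 := hasSum_fin_prod (f := fun x => D.wordAnn p k z (.inr x) * D.comm p (.inr x)
      * D.wordCre p l w (.inr x)) s2
  have t3 : D.contraction p k l z w = _ := (HasSum.sum (f := fun M => D.wordAnn p k z M * D.comm p M
      * D.wordCre p l w M) t1 t2).tsum_eq
  have e1 : ∀ κ : ℕ+, ∑ a, D.wordAnn p k z (.inl (a, κ)) * D.comm p (.inl (a, κ))
      * D.wordCre p l w (.inl (a, κ))
      = (w / z) ^ (κ : ℕ) * (1 / (1 - p ^ (κ : ℕ))) * D.wordPairCoef k l κ := fun κ => by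
    simp only [word_contraction_inl h hp]
    rw [← Finset.mul_sum, sum_wordModeCoef h k l κ.pos]
  have e2 : ∀ κ : ℕ+, ∑ a, D.wordAnn p k z (.inr (a, κ)) * D.comm p (.inr (a, κ))
      * D.wordCre p l w (.inr (a, κ))
      = ((w / z) ^ (κ : ℕ))⁻¹ * (p ^ (κ : ℕ) / (1 - p ^ (κ : ℕ))) * D.dual.wordPairCoef k l κ :=
    fun κ => by
      simp only [word_contraction_inr h hp0 hp]
      rw [← Finset.mul_sum, sum_wordModeCoef h.dual k l κ.pos]
  simp only [e1, e2] at t3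
  rw [t3]
  have u1 : Summable fun κ : ℕ+ =>
      (w / z) ^ (κ : ℕ) * (1 / (1 - p ^ (κ : ℕ))) * D.wordPairCoef k l κ := by
    simp only [← e1]
    exact summable_sum fun a _ => (s1 a).of_norm
  have u2 : Summable fun κ : ℕ+ => ((w / z) ^ (κ : ℕ))⁻¹ * (p ^ (κ : ℕ) / (1 - p ^ (κ : ℕ)))
      * D.dual.wordPairCoef k l κ := by
    simp only [← e2]
    exact summable_sum fun a _ => (s2 a).of_norm
  exact u1.hasSum.add u2.hasSum

/-! ### The exponent of the structure function -/

variable (D) in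
/-- The coefficient of `x^κ / (1 - p^κ)` in the logarithm of `f_{r,m}(q_3^{(r-m)/2} x; p)`. -/
def structCoef (r m κ : ℕ) : ℂ := (D.qh 2 ^ ((r : ℤ) - m)) ^ κ * D.fCoeff r m κ

variable (D) in
/-- The contribution of one letter of the first composition to `structCoef`. -/
def letterCoef (m κ : ℕ) : ℂ :=
  (κ : ℂ)⁻¹ * (1 - (D.q 0 ^ κ)⁻¹) * (1 - (D.q 1 ^ κ)⁻¹) * (D.qc ^ κ * ((D.q 2 ^ m) ^ κ)⁻¹ - 1)
    * (D.qc ^ κ - 1)⁻¹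

theorem dual_fCoeff (r m κ : ℕ) : D.dual.fCoeff r m κ = D.fCoeff r m κ := by
  simp only [fCoeff, dual_qh, dual_qch, inv_pow, inv_inv]
  rw [← neg_sub (D.qh 0 ^ κ), ← neg_sub (D.qh 1 ^ κ), ← neg_sub (D.qh 2 ^ κ), ← neg_sub (D.qch ^ κ),
    ← neg_sub (D.qh 2 ^ (r * κ)), ← neg_sub (D.qch ^ κ * (D.qh 2 ^ (m * κ))⁻¹)]
  simp only [neg_mul, mul_neg, neg_neg]

/-- The quotient of the two `q_3` differences in `fCoeff` is a geometric sum with `r` terms, one for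
each letter of the first composition. The shift by `q_3^{(r-m)/2}` makes it start at exponent `0`.
-/
theorem structCoef_eq (h : D.Generic) (r m : ℕ) {κ : ℕ} (hκ : 1 ≤ κ) :
    D.structCoef r m κ = (∑ a ∈ Finset.range r, (D.q 2 ^ a) ^ κ) * D.letterCoef m κ := by
  have hx0 := pow_ne_zero κ (h.qh_ne_zero 0)
  have hy0 := pow_ne_zero κ (h.qh_ne_zero 1)
  have ht0 := pow_ne_zero κ (h.qh_ne_zero 2)
  have hC0 := pow_ne_zero κ h.qch_ne_zero
  have hd := h.qch_sub_inv_ne_zero hκ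
  have ht := h.qh_sub_inv_ne_zero 2 hκ
  have hxyt : D.qh 0 ^ κ * D.qh 1 ^ κ * D.qh 2 ^ κ = 1 := by
    rw [← mul_pow, ← mul_pow, h.hprod, one_pow]
  have e1 : (D.qh 2 ^ ((r : ℤ) - m)) ^ κ = (D.qh 2 ^ κ) ^ r * ((D.qh 2 ^ κ) ^ m)⁻¹ := by
    rw [zpow_sub₀ (h.qh_ne_zero 2), zpow_natCast, zpow_natCast, div_pow, div_eq_mul_inv]
    ring
  have e2 : ∀ a : ℕ, (D.q 2 ^ a) ^ κ = ((D.qh 2 ^ κ) ^ 2) ^ a := fun a => by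
    rw [← qh_sq]; ring
  have e3 : ∀ i, D.q i ^ κ = (D.qh i ^ κ) ^ 2 := fun i => by rw [← qh_sq]; ring
  have e4 : D.qc ^ κ = (D.qch ^ κ) ^ 2 := by rw [← qch_sq]; ring
  have e5 : ∀ a : ℕ, D.qh 2 ^ (a * κ) = (D.qh 2 ^ κ) ^ a := fun a => by ring
  have hgeom : (∑ a ∈ Finset.range r, ((D.qh 2 ^ κ) ^ 2) ^ a) * ((D.qh 2 ^ κ) ^ 2 - 1)
      = ((D.qh 2 ^ κ) ^ r) ^ 2 - 1 := by
    rw [geom_sum_mul]; ring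
  have hd' := h.qc_pow_ne_one hκ
  have ht' := sub_ne_zero.2 (h.q_pow_ne_one 2 κ hκ)
  rw [e4] at hd'
  rw [e3] at ht'
  rw [structCoef, fCoeff, letterCoef, e1]
  simp only [e2, e3, e4, e5]
  generalize D.qh 0 ^ κ = x at *
  generalize D.qh 1 ^ κ = y at *
  generalize D.qh 2 ^ κ = t at *
  generalize D.qch ^ κ = C at *
  have hr0 := pow_ne_zero r ht0
  have hm0 := pow_ne_zero m ht0
  have hκ0 : (κ : ℂ) ≠ 0 := by exact_mod_cast (by omega : κ ≠ 0)
  have g1 : ∑ a ∈ Finset.range r, (t ^ 2) ^ a = ((t ^ r) ^ 2 - 1) / (t ^ 2 - 1) := by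
    rw [eq_div_iff ht', hgeom]
  rw [g1]
  have d1 : t - t⁻¹ = (t ^ 2 - 1) / t := by field_simp
  have d2 : C - C⁻¹ = (C ^ 2 - 1) / C := by field_simp
  rw [d1, d2]
  have q1 : (t ^ 2) ^ m = (t ^ m) ^ 2 := by ring
  rw [q1]
  generalize t ^ r = tr at *
  generalize t ^ m = tm at *
  generalize ht3 : t ^ 2 - 1 = u at *
  generalize C ^ 2 - 1 = v at *
  field_simp
  linear_combination ((tr ^ 2 - 1) * (C ^ 2 - tm ^ 2) * (x ^ 2 - 1) * (y ^ 2 - 1)) * hxyt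

end Data

/-! ### Sums over the letters of a composition -/

/-- `l_1 + ⋯ + l_i` for a natural number `i`. -/
def offsetNat (l : Fin n → ℕ) (i : ℕ) : ℕ := ∑ j ∈ Finset.univ.filter (fun j : Fin n => (j : ℕ) < i), l j

theorem offset_eq_offsetNat (l : Fin n → ℕ) (i : Fin n) : offset l i = offsetNat l i := by
  rw [offset, offsetNat]
  congr 1
  ext j
  simp only [Finset.mem_filter, Finset.mem_univ, true_and, Finset.mem_Iio, Fin.lt_def]

theorem offsetNat_zero (l : Fin n → ℕ) : offsetNat l 0 = 0 := by simp [offsetNat]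

theorem offsetNat_last (l : Fin n → ℕ) : offsetNat l n = ∑ i, l i := by
  rw [offsetNat]
  congr 1
  ext j
  simp

theorem offsetNat_succ (l : Fin n → ℕ) (i : Fin n) : offsetNat l (i + 1) = offset l i + l i := by
  rw [offset, offsetNat, add_comm _ (l i), ← Finset.sum_insert (f := l) (by simp)]
  congr 1
  ext j
  simp only [Finset.mem_filter, Finset.mem_univ, true_and, Finset.mem_insert, Finset.mem_Iio,
    Fin.lt_def, Fin.ext_iff]
  omega

theorem offset_add_le (l : Fin n → ℕ) (i : Fin n) : offset l i + l i ≤ ∑ j, l j := by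
  rw [← offsetNat_succ]
  exact Finset.sum_le_sum_of_subset (Finset.filter_subset _ _)

theorem sum_block (g : ℕ → ℂ) (a b : ℕ) :
    ∑ x ∈ Finset.range b, g (a + x) = ∑ x ∈ Finset.range (a + b), g x - ∑ x ∈ Finset.range a, g x := by
  rw [Finset.sum_range_add]
  ring

theorem sum_blocks (l : Fin n → ℕ) (g : ℕ → ℂ) :
    ∑ j, ∑ b ∈ Finset.range (l j), g (offset l j + b) = ∑ b ∈ Finset.range (∑ j, l j), g b := by
  simp only [sum_block, ← offsetNat_succ]
  simp only [offset_eq_offsetNat]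
  rw [sum_fin_telescope fun j => ∑ b ∈ Finset.range (offsetNat l j), g b, offsetNat_last,
    offsetNat_zero, Finset.sum_range_zero, sub_zero]

theorem sum_blocks_gt (l : Fin n → ℕ) (g : ℕ → ℂ) (i : Fin n) :
    ∑ j, (if i < j then ∑ b ∈ Finset.range (l j), g (offset l j + b) else 0)
      = ∑ b ∈ Finset.range (∑ j, l j), g b - ∑ b ∈ Finset.range (offset l i + l i), g b := by
  have h1 : ∀ j, (if i < j then ∑ b ∈ Finset.range (l j), g (offset l j + b) else 0)
      = ∑ b ∈ Finset.range (l j), g (offset l j + b)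
        - ((if j < i then ∑ b ∈ Finset.range (l j), g (offset l j + b) else 0)
          + if j = i then ∑ b ∈ Finset.range (l j), g (offset l j + b) else 0) := fun j => by
    rcases lt_trichotomy i j with h | h | h
    · simp [h, h.not_gt, h.ne']
    · simp [h]
    · simp [h, h.not_gt, h.ne]
  rw [Finset.sum_congr rfl fun j _ => h1 j, Finset.sum_sub_distrib, sum_blocks,
    Finset.sum_add_distrib, Finset.sum_ite_eq', if_pos (Finset.mem_univ i)]
  simp only [sum_block, ← offsetNat_succ]
  simp only [offset_eq_offsetNat]
  rw [sum_fin_lt_telescope fun j => ∑ b ∈ Finset.range (offsetNat l j), g b, offsetNat_zero,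
    Finset.sum_range_zero]
  ring

/-! ### Cancellation of `q_c` between the structure function and the contractions -/

namespace Data

variable {D : Data n} {p : ℂ}

theorem geomBdd_structCoef (h : D.Generic) (r m : ℕ) : GeomBdd (D.structCoef r m) := by
  have h1 : GeomBdd (D.letterCoef m) :=
    (((GeomBdd.inv_natCast.mul ((GeomBdd.const 1).sub (GeomBdd.inv_pow _))).mul
      ((GeomBdd.const 1).sub (GeomBdd.inv_pow _))).mul
      (((GeomBdd.pow _).mul (GeomBdd.inv_pow _)).sub (GeomBdd.const 1))).mul h.geomBdd_inv_qc
  exact ((GeomBdd.sum _ fun a _ => GeomBdd.pow (D.q 2 ^ a)).mul h1).congr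
    fun κ hκ => structCoef_eq h r m hκ

variable (D) in
/-- The contribution of one letter of the first composition to the logarithm of
`f_{r,m}` times a contraction, up to a power of `q_3`. -/
def rowCoef (i : Fin n) (l : Fin n → ℕ) (κ : ℕ) : ℂ :=
  D.letterCoef (∑ j, l j) κ
    + ∑ j, ∑ b ∈ Finset.range (l j), ((D.q 2 ^ (offset l j + b)) ^ κ)⁻¹ * D.pairCoef i j κ

theorem structCoef_add_wordPairCoef (h : D.Generic) {r m : ℕ} {k l : Fin n → ℕ}
    (hk : k ∈ comps n r) (hl : l ∈ comps n m) {κ : ℕ} (hκ : 1 ≤ κ) :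
    D.structCoef r m κ + D.wordPairCoef k l κ
      = ∑ i, ∑ a ∈ Finset.range (k i), (D.q 2 ^ (offset k i + a)) ^ κ * D.rowCoef i l κ := by
  rw [mem_comps] at hk hl
  rw [structCoef_eq h r m hκ, ← hk, ← sum_blocks k fun a => (D.q 2 ^ a) ^ κ, wordPairCoef, letterSum]
  simp only [rowCoef, mul_add, Finset.sum_add_distrib, Finset.sum_mul, Finset.mul_sum, hl, mul_assoc]

/-- Summing powers of `q_3^{-κ}` divides `kap` by `q_3^{-κ} - 1`, which removes its third factor
because `q_1 q_2 q_3 = 1`. The full-length sums then cancel against `letterCoef`, together with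
every occurrence of `q_c`; the ends of the `i`-th block remain. -/
theorem rowCoef_eq (h : D.Generic) (i : Fin n) (l : Fin n → ℕ) {κ : ℕ} (hκ : 1 ≤ κ) :
    D.rowCoef i l κ = (κ : ℂ)⁻¹ * (1 - (D.q 0 ^ κ)⁻¹) * (1 - (D.q 1 ^ κ)⁻¹)
      * (D.q (D.c i) ^ κ * ((D.q 2 ^ (offset l i + l i)) ^ κ)⁻¹ - ((D.q 2 ^ offset l i) ^ κ)⁻¹)
      * (D.q (D.c i) ^ κ - 1)⁻¹ := by
  have hT : ∀ b : ℕ, ((D.q 2 ^ b) ^ κ)⁻¹ = ((D.q 2 ^ κ)⁻¹) ^ b := fun b => by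
    rw [inv_pow]; congr 1; ring
  have hT1 : (D.q 2 ^ κ)⁻¹ ≠ 1 := by
    rw [Ne, inv_eq_one]; exact h.q_pow_ne_one 2 κ hκ
  have hprod : D.q 0 ^ κ * D.q 1 ^ κ * D.q 2 ^ κ = 1 := by
    rw [← mul_pow, ← mul_pow, h.q_prod, one_pow]
  have hsum : ∑ j, ∑ b ∈ Finset.range (l j), ((D.q 2 ^ (offset l j + b)) ^ κ)⁻¹ * D.pairCoef i j κ
      = D.kap κ * (κ : ℂ)⁻¹ * ((D.qc ^ κ - 1)⁻¹ * ∑ b ∈ Finset.range (∑ j, l j), ((D.q 2 ^ κ)⁻¹) ^ b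
        + (∑ b ∈ Finset.range (∑ j, l j), ((D.q 2 ^ κ)⁻¹) ^ b
          - ∑ b ∈ Finset.range (offset l i + l i), ((D.q 2 ^ κ)⁻¹) ^ b)
        - (D.q (D.c i) ^ κ - 1)⁻¹ * (∑ b ∈ Finset.range (offset l i + l i), ((D.q 2 ^ κ)⁻¹) ^ b
          - ∑ b ∈ Finset.range (offset l i), ((D.q 2 ^ κ)⁻¹) ^ b)) := by
    simp only [hT]
    rw [← sum_blocks_gt, ← sum_blocks l, ← sum_block]
    have h1 : ∀ j, ∑ b ∈ Finset.range (l j), ((D.q 2 ^ κ)⁻¹) ^ (offset l j + b) * D.pairCoef i j κ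
        = D.kap κ * (κ : ℂ)⁻¹ * ((D.qc ^ κ - 1)⁻¹
            * ∑ b ∈ Finset.range (l j), ((D.q 2 ^ κ)⁻¹) ^ (offset l j + b)
          + (if i < j then ∑ b ∈ Finset.range (l j), ((D.q 2 ^ κ)⁻¹) ^ (offset l j + b) else 0)
          - if j = i then (D.q (D.c i) ^ κ - 1)⁻¹
            * ∑ b ∈ Finset.range (l j), ((D.q 2 ^ κ)⁻¹) ^ (offset l j + b) else 0) := fun j => by
      rw [← Finset.sum_mul, pairCoef]
      by_cases h1 : i < j
      · simp only [if_pos h1, if_neg h1.ne, if_neg h1.ne']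
        ring
      · by_cases h2 : i = j
        · simp only [if_neg h1, if_pos h2, if_pos h2.symm]
          ring
        · simp only [if_neg h1, if_neg h2, if_neg (Ne.symm h2)]
          ring
    rw [Finset.sum_congr rfl fun j _ => h1 j, ← Finset.mul_sum, Finset.sum_sub_distrib,
      Finset.sum_add_distrib, ← Finset.mul_sum, Finset.sum_ite_eq', if_pos (Finset.mem_univ i)]
  rw [rowCoef, hsum, letterCoef]
  simp only [hT]
  rw [geom_sum_eq hT1, geom_sum_eq hT1, geom_sum_eq hT1]
  have hqc := h.qc_pow_ne_one hκ
  have hq := sub_ne_zero.2 (h.q_pow_ne_one (D.c i) κ hκ)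
  have h0 := pow_ne_zero κ (h.q_ne_zero 0)
  have h1 := pow_ne_zero κ (h.q_ne_zero 1)
  have hkap : D.kap κ * ((D.q 2 ^ κ)⁻¹ - 1)⁻¹
      = -((1 - (D.q 0 ^ κ)⁻¹) * (1 - (D.q 1 ^ κ)⁻¹)) := by
    have h2 := pow_ne_zero κ (h.q_ne_zero 2)
    rw [← div_eq_mul_inv, div_eq_iff (sub_ne_zero.2 hT1), kap, Fin.prod_univ_three]
    field_simp
    linear_combination ((D.q 0 ^ κ - 1) * (D.q 1 ^ κ - 1) * (D.q 2 ^ κ - 1)) * hprod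
  generalize (D.q 2 ^ κ)⁻¹ = T at *
  have e1 : ∀ N : ℕ, (T ^ N - 1) / (T - 1) = (T - 1)⁻¹ * (T ^ N - 1) := fun N => by
    rw [div_eq_mul_inv, mul_comm]
  simp only [e1]
  generalize D.qc ^ κ = Q at *
  generalize D.q (D.c i) ^ κ = q at *
  have e2 : Q = (Q - 1) + 1 := by ring
  have e3 : q = (q - 1) + 1 := by ring
  generalize Q - 1 = Q' at *
  generalize q - 1 = q' at *
  subst e2 e3
  generalize (T - 1)⁻¹ = u at *
  generalize (1 - (D.q 0 ^ κ)⁻¹) = x at *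
  generalize (1 - (D.q 1 ^ κ)⁻¹) = y at *
  have f1 := mul_inv_cancel₀ hqc
  have f2 := mul_inv_cancel₀ hq
  rw [pow_add]
  linear_combination ((κ : ℂ)⁻¹ * (T ^ (∑ j, l j) * Q'⁻¹ + T ^ (∑ j, l j)
      - T ^ offset l i * T ^ l i - T ^ offset l i * T ^ l i * q'⁻¹ + T ^ offset l i * q'⁻¹ - Q'⁻¹)) * hkap
    + ((κ : ℂ)⁻¹ * x * y * T ^ (∑ j, l j)) * f1 - ((κ : ℂ)⁻¹ * x * y * T ^ offset l i * T ^ l i) * f2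

end Data

namespace Data

/-! ### Theta quotients -/

/-- The parameter attached to the leading letter of a block. -/
def colA (c : Fin 3) : Fin 3 := if c = 1 then 1 else 0

/-- The parameter attached to the trailing letter of a block. -/
def colB (c : Fin 3) : Fin 3 := if c = 1 then 0 else 1

variable (D : Data n) (p : ℂ)

/-- `q_3^{A-B} g` -/
def arg (A B : ℕ) (g : ℂ) : ℂ := D.q 2 ^ A * (D.q 2 ^ B)⁻¹ * g

/-- The factor contributed by the letter in position `A` of the first composition, of colour `c`,
when the letters of the same tensor factor in the second composition are in positions
`B, …, B + l - 1`. -/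
def rowTheta (c : Fin 3) (A B l : ℕ) (x : ℂ) : ℂ :=
  if c = 2 ∧ l ≠ 0 then 1 else
    theta p (D.arg A B (D.q (colA c))⁻¹ * x) * theta p (D.arg A (B + l) (D.q (colB c))⁻¹ * x)
      / (theta p (D.arg A (B + l) 1 * x) * theta p (D.arg A B (D.q 2) * x))

/-- The product of `f_{r,m}` and of the contraction of two normally ordered monomials. -/
def wordTheta (k l : Fin n → ℕ) (x : ℂ) : ℂ :=
  ∏ i, ∏ a ∈ Finset.range (k i), D.rowTheta p (D.c i) (offset k i + a) (offset l i) (l i) x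

variable {D p}

theorem dual_arg (A B : ℕ) (g : ℂ) : D.dual.arg A B g⁻¹ = (D.arg A B g)⁻¹ := by
  simp only [arg, dual_q, mul_inv, inv_pow]

theorem arg_pow (A B : ℕ) (g : ℂ) (κ : ℕ) :
    D.arg A B g ^ κ = (D.q 2 ^ A) ^ κ * ((D.q 2 ^ B) ^ κ)⁻¹ * g ^ κ := by
  rw [arg, mul_pow, mul_pow, inv_pow]

/-- The two ends of a one-letter block differ by the factor `q_3`, which is here the colour
parameter itself. Longer blocks of colour 3 never contribute, by `blockCoef_eq_zero`. -/
theorem rowCoef_eq_zero (h : D.Generic) {i : Fin n} {l : Fin n → ℕ} (hc : D.c i = 2) (hl : l i = 1)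
    {κ : ℕ} (hκ : 1 ≤ κ) : D.rowCoef i l κ = 0 := by
  have h2 := pow_ne_zero κ (h.q_ne_zero 2)
  rw [rowCoef_eq h i l hκ, hc, hl, pow_succ, mul_pow, mul_inv, mul_left_comm, mul_inv_cancel₀ h2]
  ring

/-- For colours 1 and 2 the divisor `q_{c_i}^κ - 1` cancels against one of the prefactors; for an
empty block of colour 3 it cancels against the bracket. With `q_1^{-κ} q_2^{-κ} = q_3^κ` four pure
powers remain: the positive ones become theta denominators, the negative ones numerators. -/
theorem rowCoef_eq_theta (h : D.Generic) {i : Fin n} {l : Fin n → ℕ} (hc : ¬ (D.c i = 2 ∧ l i ≠ 0))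
    (A : ℕ) {κ : ℕ} (hκ : 1 ≤ κ) :
    (D.q 2 ^ A) ^ κ * D.rowCoef i l κ
      = (κ : ℂ)⁻¹ * D.arg A (offset l i + l i) 1 ^ κ + (κ : ℂ)⁻¹ * D.arg A (offset l i) (D.q 2) ^ κ
        - (κ : ℂ)⁻¹ * D.arg A (offset l i) (D.q (colA (D.c i)))⁻¹ ^ κ
        - (κ : ℂ)⁻¹ * D.arg A (offset l i + l i) (D.q (colB (D.c i)))⁻¹ ^ κ := by
  have h0 := pow_ne_zero κ (h.q_ne_zero 0)
  have h1 := pow_ne_zero κ (h.q_ne_zero 1)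
  have hprod : D.q 0 ^ κ * D.q 1 ^ κ * D.q 2 ^ κ = 1 := by
    rw [← mul_pow, ← mul_pow, h.q_prod, one_pow]
  have h2 : D.q 2 ^ κ = (D.q 0 ^ κ)⁻¹ * (D.q 1 ^ κ)⁻¹ := by
    field_simp
    linear_combination hprod
  have hq := sub_ne_zero.2 (h.q_pow_ne_one (D.c i) κ hκ)
  rw [rowCoef_eq h i l hκ]
  simp only [arg_pow, one_pow, inv_pow]
  rw [h2]
  rcases (by omega : D.c i = 0 ∨ D.c i = 1 ∨ D.c i = 2) with h3 | h3 | h3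
  · simp only [h3, colA, colB, if_neg (by decide : ¬ (0 : Fin 3) = 1)] at hq ⊢
    field_simp
    ring
  · simp only [h3, colA, colB, if_true] at hq ⊢
    field_simp
    ring
  · have hl : l i = 0 := by
      by_contra hl
      exact hc ⟨h3, hl⟩
    simp only [h3, hl, add_zero, colA, colB, if_neg (by decide : ¬ (2 : Fin 3) = 1)] at hq ⊢
    rw [← h2]
    have : ∀ y : ℂ, D.q 2 ^ κ * y - y = (D.q 2 ^ κ - 1) * y := fun y => by ring
    rw [this]
    generalize hu : D.q 2 ^ κ - 1 = u at *
    field_simp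
    rw [h2]
    field_simp
    ring

/-! ### Common bounds and resummation into theta quotients -/

variable (D) in
/-- `K` bounds all coefficients that occur in the product of `T̃_r(z)` and `T̃_m(w)`. -/
structure Bound (r m : ℕ) (K : ℝ) : Prop where
  nonneg : 0 ≤ K
  word : ∀ k ∈ comps n r, ∀ l ∈ comps n m, ∀ a, ∀ κ : ℕ, 1 ≤ κ → ‖D.wordModeCoef k l a κ‖ ≤ K ^ κ
  struct : ∀ κ : ℕ, 1 ≤ κ → ‖D.structCoef r m κ‖ ≤ K ^ κ
  args : ∀ A ≤ r, ∀ B ≤ m, ∀ g ∈ ({1, D.q 2, (D.q 0)⁻¹, (D.q 1)⁻¹} : Finset ℂ), ‖D.arg A B g‖ ≤ K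

theorem Bound.mono {r m : ℕ} {K K' : ℝ} (h : D.Bound r m K) (hK : K ≤ K') : D.Bound r m K' where
  nonneg := h.nonneg.trans hK
  word k hk l hl a κ hκ := (h.word k hk l hl a κ hκ).trans (pow_le_pow_left₀ h.nonneg hK κ)
  struct κ hκ := (h.struct κ hκ).trans (pow_le_pow_left₀ h.nonneg hK κ)
  args A hA B hB g hg := (h.args A hA B hB g hg).trans hK

theorem exists_bound (h : D.Generic) (r m : ℕ) : ∃ K, D.Bound r m K := by
  obtain ⟨K₁, h1, h1'⟩ := GeomBdd.exists_common ((comps n r ×ˢ comps n m) ×ˢ Finset.univ)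
    (α := fun x κ => D.wordModeCoef x.1.1 x.1.2 x.2 κ) fun x _ => geomBdd_wordModeCoef h _ _ _
  obtain ⟨K₂, h2, h2'⟩ := geomBdd_structCoef h r m
  obtain ⟨K₃, h3, h3'⟩ := GeomBdd.exists_common
    ((Finset.range (r + 1) ×ˢ Finset.range (m + 1)) ×ˢ
      ({1, D.q 2, (D.q 0)⁻¹, (D.q 1)⁻¹} : Finset ℂ))
    (α := fun x κ => D.arg x.1.1 x.1.2 x.2 ^ κ) fun x _ => GeomBdd.pow _
  have e1 : K₁ ≤ max K₁ (max K₂ K₃) := le_max_left _ _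
  have e2 : K₂ ≤ max K₁ (max K₂ K₃) := (le_max_left _ _).trans (le_max_right _ _)
  have e3 : K₃ ≤ max K₁ (max K₂ K₃) := (le_max_right _ _).trans (le_max_right _ _)
  refine ⟨max K₁ (max K₂ K₃), h1.trans e1, fun k hk l hl a κ hκ => ?_, fun κ hκ => ?_,
    fun A hA B hB g hg => ?_⟩
  · exact (h1' ((k, l), a) (by simp only [Finset.mem_product, Finset.mem_univ, hk, hl, and_self]) κ
      hκ).trans (pow_le_pow_left₀ h1 e1 κ)
  · exact (h2' κ hκ).trans (pow_le_pow_left₀ h2 e2 κ)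
  · have := h3' ((A, B), g) (by
      simp only [Finset.mem_product, Finset.mem_range]
      exact ⟨⟨by omega, by omega⟩, hg⟩) 1 le_rfl
    simp only [pow_one] at this
    exact this.trans e3

theorem bound_arg {r m A B : ℕ} {K : ℝ} (hb : D.Bound r m K) (hb' : D.dual.Bound r m K)
    (hA : A ≤ r) (hB : B ≤ m) {g : ℂ} (hg : g ∈ ({1, D.q 2, (D.q 0)⁻¹, (D.q 1)⁻¹} : Finset ℂ)) :
    ‖D.arg A B g‖ ≤ K ∧ ‖(D.arg A B g)⁻¹‖ ≤ K := by
  refine ⟨hb.args A hA B hB g hg, ?_⟩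
  rw [← dual_arg]
  refine hb'.args A hA B hB _ ?_
  simp only [Finset.mem_insert, Finset.mem_singleton, dual_q] at hg ⊢
  rcases hg with rfl | rfl | rfl | rfl <;> simp

theorem mem_args_colA (c : Fin 3) :
    (D.q (colA c))⁻¹ ∈ ({1, D.q 2, (D.q 0)⁻¹, (D.q 1)⁻¹} : Finset ℂ) := by
  rw [colA]
  split_ifs <;> simp

theorem mem_args_colB (c : Fin 3) :
    (D.q (colB c))⁻¹ ∈ ({1, D.q 2, (D.q 0)⁻¹, (D.q 1)⁻¹} : Finset ℂ) := by
  rw [colB]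
  split_ifs <;> simp

theorem dual_row (i : Fin n) (l : Fin n → ℕ) (A κ : ℕ) :
    (κ : ℂ)⁻¹ * D.dual.arg A (offset l i + l i) 1 ^ κ
        + (κ : ℂ)⁻¹ * D.dual.arg A (offset l i) (D.dual.q 2) ^ κ
        - (κ : ℂ)⁻¹ * D.dual.arg A (offset l i) (D.dual.q (colA (D.c i)))⁻¹ ^ κ
        - (κ : ℂ)⁻¹ * D.dual.arg A (offset l i + l i) (D.dual.q (colB (D.c i)))⁻¹ ^ κ
      = (κ : ℂ)⁻¹ * (D.arg A (offset l i + l i) 1)⁻¹ ^ κ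
        + (κ : ℂ)⁻¹ * (D.arg A (offset l i) (D.q 2))⁻¹ ^ κ
        - (κ : ℂ)⁻¹ * (D.arg A (offset l i) (D.q (colA (D.c i)))⁻¹)⁻¹ ^ κ
        - (κ : ℂ)⁻¹ * (D.arg A (offset l i + l i) (D.q (colB (D.c i)))⁻¹)⁻¹ ^ κ := by
  rw [← dual_arg, ← dual_arg, ← dual_arg, ← dual_arg]
  simp only [dual_q, inv_one]

theorem logTerm_add {p x : ℂ} (α β α' β' : ℕ → ℂ) (k : ℕ+) :
    logTerm p x (fun k => α k + α' k) (fun k => β k + β' k) k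
      = logTerm p x α β k + logTerm p x α' β' k := by
  simp only [logTerm]
  ring

theorem exists_hasSum_row (h : D.Generic) {r m : ℕ} {K : ℝ} (hb : D.Bound r m K)
    (hb' : D.dual.Bound r m K) {x : ℂ} (hp : ‖p‖ < 1) (hx : K * ‖x‖ < 1)
    (hx' : K * ‖p * x⁻¹‖ < 1) {l : Fin n → ℕ} (hl : l ∈ comps n m) (i : Fin n)
    (hi : D.c i = 2 → l i ≤ 1) {A : ℕ} (hA : A ≤ r) :
    ∃ s, HasSum (logTerm p x (fun κ => (D.q 2 ^ A) ^ κ * D.rowCoef i l κ)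
        (fun κ => (D.dual.q 2 ^ A) ^ κ * D.dual.rowCoef i l κ)) s ∧
      Complex.exp s = D.rowTheta p (D.c i) A (offset l i) (l i) x := by
  by_cases hc : D.c i = 2 ∧ l i ≠ 0
  · have hl1 : l i = 1 := by have := hi hc.1; have := hc.2; omega
    refine ⟨0, ?_, by rw [rowTheta, if_pos hc, Complex.exp_zero]⟩
    rw [logTerm_congr (α' := fun _ => 0) (β' := fun _ => 0)
      (fun κ hκ => by rw [rowCoef_eq_zero h hc.1 hl1 hκ, mul_zero])
      (fun κ hκ => by rw [rowCoef_eq_zero h.dual (show D.dual.c i = 2 from hc.1) hl1 hκ, mul_zero])]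
    convert hasSum_zero (α := ℂ) (β := ℕ+) using 2
    simp [logTerm]
  · rw [mem_comps] at hl
    have hB' : offset l i + l i ≤ m := hl ▸ offset_add_le l i
    have hB : offset l i ≤ m := le_of_add_le_left hB'
    have H : ∀ {B : ℕ} {g : ℂ}, B ≤ m → g ∈ ({1, D.q 2, (D.q 0)⁻¹, (D.q 1)⁻¹} : Finset ℂ) →
        ∃ s, HasSum (logTerm p x (fun k => (k : ℂ)⁻¹ * D.arg A B g ^ k)
          (fun k => (k : ℂ)⁻¹ * (D.arg A B g)⁻¹ ^ k)) s ∧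
          theta p (D.arg A B g * x) = Complex.exp (-s) := fun hB hg =>
      exists_hasSum_theta hp (bound_arg hb hb' hA hB hg).1 (bound_arg hb hb' hA hB hg).2 hx hx'
    obtain ⟨s3, t3, u3⟩ := H hB' (g := 1) (by simp)
    obtain ⟨s4, t4, u4⟩ := H hB (g := D.q 2) (by simp)
    obtain ⟨s1, t1, u1⟩ := H hB (mem_args_colA (D.c i))
    obtain ⟨s2, t2, u2⟩ := H hB' (mem_args_colB (D.c i))
    refine ⟨s3 + s4 - s1 - s2, ?_, ?_⟩
    · rw [logTerm_congr (fun κ hκ => rowCoef_eq_theta h hc A hκ) (fun κ hκ =>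
        (rowCoef_eq_theta h.dual hc A hκ).trans (dual_row i l A κ))]
      refine (congrArg (fun g => HasSum g _) (funext fun κ => ?_)).mpr
        (((t3.add t4).sub t1).sub t2)
      simp only [logTerm]
      ring
    · rw [rowTheta, if_neg hc, u1, u2, u3, u4, ← Complex.exp_add, ← Complex.exp_add,
        ← Complex.exp_sub]
      congr 1
      ring

theorem hasSum_struct {r m : ℕ} (hrm : r ≤ m) {K : ℝ} (hb : D.Bound r m K)
    (hb' : D.dual.Bound r m K) {x : ℂ} (hp : ‖p‖ < 1) (hx : K * ‖x‖ < 1)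
    (hx' : K * ‖p * x⁻¹‖ < 1) :
    D.FConverges p r m (D.qh 2 ^ ((r : ℤ) - m) * x) ∧ ∃ s,
      HasSum (logTerm p x (D.structCoef r m) (D.dual.structCoef r m)) s ∧
      D.f p r m (D.qh 2 ^ ((r : ℤ) - m) * x) = Complex.exp s := by
  have e1 : D.fTermPos p r m (D.qh 2 ^ ((r : ℤ) - m) * x)
      = fun k : ℕ+ => x ^ (k : ℕ) * (1 / (1 - p ^ (k : ℕ))) * D.structCoef r m k := by
    funext k
    rw [fTermPos, structCoef, mul_pow]
    ring
  have e2 : D.fTermNeg p r m (D.qh 2 ^ ((r : ℤ) - m) * x)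
      = fun k : ℕ+ => (x ^ (k : ℕ))⁻¹ * (p ^ (k : ℕ) / (1 - p ^ (k : ℕ))) * D.dual.structCoef r m k := by
    funext k
    rw [fTermNeg, structCoef, dual_fCoeff, dual_qh, inv_zpow, inv_pow, mul_pow, mul_inv]
    ring
  rw [FConverges, f, min_eq_left hrm, max_eq_right hrm, e1, e2]
  exact ⟨⟨(summable_norm_pos hp hb.struct hb.nonneg hx).of_norm,
    (summable_norm_neg hp hb'.struct hb.nonneg hx').of_norm⟩, _,
    hasSum_logTerm hp hb.struct hb'.struct hb.nonneg hx hx', (Complex.exp_add _ _).symm⟩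

/-- The logarithms agree term by term in the mode number, by `structCoef_add_wordPairCoef` for the
data and for its dual. The right-hand side is a finite theta product, so it makes sense beyond the
region of convergence. -/
theorem f_mul_exp_contraction (h : D.Generic) {r m : ℕ} (hrm : r ≤ m) {K : ℝ} (hb : D.Bound r m K)
    (hb' : D.dual.Bound r m K) {z w : ℂ} (hp0 : p ≠ 0) (hp : ‖p‖ < 1) (hx : K * ‖w / z‖ < 1)
    (hx' : K * ‖p * (w / z)⁻¹‖ < 1) {k l : Fin n → ℕ} (hk : k ∈ comps n r) (hl : l ∈ comps n m)
    (hi : ∀ i, D.c i = 2 → l i ≤ 1) :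
    D.f p r m (D.qh 2 ^ ((r : ℤ) - m) * (w / z)) * Complex.exp (D.contraction p k l z w)
      = D.wordTheta p k l (w / z) := by
  obtain ⟨-, s, hs, hf⟩ := hasSum_struct hrm hb hb' hp hx hx'
  have hc := (hasSum_contraction h hp0 hp (hb.word k hk l hl) (hb'.word k hk l hl) hb.nonneg hx hx').2
  have hA : ∀ i, ∀ a ∈ Finset.range (k i), offset k i + a ≤ r := fun i a ha => by
    have h1 := offset_add_le k i
    rw [mem_comps.1 hk] at h1
    have := Finset.mem_range.1 ha
    omega
  choose! S hS hS' using fun (i : Fin n) (a : ℕ) (ha : a ∈ Finset.range (k i)) =>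
    exists_hasSum_row h hb hb' hp hx hx' hl i (hi i) (hA i a ha)
  have hsum : HasSum (fun κ : ℕ+ => ∑ i, ∑ a ∈ Finset.range (k i), logTerm p (w / z)
        (fun κ => (D.q 2 ^ (offset k i + a)) ^ κ * D.rowCoef i l κ)
        (fun κ => (D.dual.q 2 ^ (offset k i + a)) ^ κ * D.dual.rowCoef i l κ) κ)
      (∑ i, ∑ a ∈ Finset.range (k i), S i a) :=
    hasSum_sum fun i _ => hasSum_sum fun a ha => hS i a ha
  have hadd := hs.add hc
  have heq : s + D.contraction p k l z w = ∑ i, ∑ a ∈ Finset.range (k i), S i a := by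
    refine hadd.unique ((congrArg (fun g => HasSum g _) (funext fun κ => ?_)).mpr hsum)
    rw [← logTerm_add]
    simp only [logTerm]
    rw [structCoef_add_wordPairCoef h hk hl κ.pos, structCoef_add_wordPairCoef h.dual hk hl κ.pos]
    simp only [Finset.sum_add_distrib, Finset.mul_sum]
  rw [hf, ← Complex.exp_add, heq, Complex.exp_sum, wordTheta]
  refine Finset.prod_congr rfl fun i _ => ?_
  rw [Complex.exp_sum]
  exact Finset.prod_congr rfl fun a ha => hS' i a ha

theorem blockCoef_eq_zero {i : Fin n} (hp : ‖p‖ < 1) (h : D.Generic) (hc : D.c i = 2) {k : ℕ}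
    (hk : 2 ≤ k) : D.blockCoef p i k = 0 := by
  have h2 := h.q_ne_zero 2
  have : thetaShift p (D.q 2) (D.q 2 ^ (1 - (k : ℤ)) * D.q (D.c i)) k = 0 := by
    -- At `j = k - 2` the argument `q_3^j · q_3^{1-k} · q_3` equals `1`, a zero of theta.
    refine Finset.prod_eq_zero (i := k - 2) (Finset.mem_range.2 (by omega)) ?_
    rw [hc, ← zpow_natCast, ← zpow_add_one₀ h2, ← zpow_add₀ h2]
    have : ((k - 2 : ℕ) : ℤ) + (1 - (k : ℤ) + 1) = 0 := by omega
    rw [this, zpow_zero, theta_one hp]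
  rw [blockCoef, this, zero_div, mul_zero]

theorem wordCoef_eq_zero {l : Fin n → ℕ} (hp : ‖p‖ < 1) (h : D.Generic) {i : Fin n}
    (hc : D.c i = 2) (hl : 2 ≤ l i) : D.wordCoef p l = 0 := by
  rw [wordCoef, Finset.prod_eq_zero (f := fun i => D.blockCoef p i (l i)) (Finset.mem_univ i)
    (blockCoef_eq_zero hp h hc hl), mul_zero]

/-! ### The continued matrix element -/

variable (D p) in
/-- The term of the continued product of two currents that belongs to a pair of compositions. -/
def pairTerm (mu lam : Mode n →₀ ℕ) (z w : ℂ) (k l : Fin n → ℕ) : ℂ :=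
  D.wordCoef p k * D.wordCoef p l * (D.wordTheta p k l (w / z)
    * entry (D.expOp p (D.wordCre p k z + D.wordCre p l w)
      (D.wordAnn p k z + D.wordAnn p l w)) mu lam)

variable (D) in
/-- The continued matrix element of `f_{r,m} T̃_r(z) T̃_m(w)`. -/
def continuation (r m : ℕ) (mu lam : Mode n →₀ ℕ) (p z w : ℂ) : ℂ :=
  ∑ k ∈ comps n r, ∑ l ∈ comps n m, D.pairTerm p mu lam z w k l

theorem continuation_eq (h : D.Generic) {r m : ℕ} (hrm : r ≤ m) {K : ℝ} (hb : D.Bound r m K)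
    (hb' : D.dual.Bound r m K) {z w : ℂ} (hp0 : p ≠ 0) (hp : ‖p‖ < 1) (hx : K * ‖w / z‖ < 1)
    (hx' : K * ‖p * (w / z)⁻¹‖ < 1) (mu lam : Mode n →₀ ℕ) :
    D.FConverges p r m (D.qh 2 ^ ((r : ℤ) - m) * (w / z)) ∧
      ProdConverges (D.current p r z) (D.current p m w) mu lam ∧
      D.continuation r m mu lam p z w = D.f p r m (D.qh 2 ^ ((r : ℤ) - m) * (w / z)) *
        prodEntry (D.current p r z) (D.current p m w) mu lam := by
  have hs := D.hasSum_entry_current p r m z w (fun k l hk hl => (hasSum_contraction h hp0 hp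
    (hb.word k hk l hl) (hb'.word k hk l hl) hb.nonneg hx hx').1) mu lam
  refine ⟨(hasSum_struct hrm hb hb' hp hx hx').1, hs.summable, ?_⟩
  rw [prodEntry, hs.tsum_eq, continuation, Finset.mul_sum]
  refine Finset.sum_congr rfl fun k hk => ?_
  rw [Finset.mul_sum]
  refine Finset.sum_congr rfl fun l hl => ?_
  rw [pairTerm]
  -- If a block of colour 3 is longer, the resummation formula is not available, but the coefficient
  -- of the word vanishes and both sides are zero.
  by_cases hi : ∀ i, D.c i = 2 → l i ≤ 1
  · rw [← f_mul_exp_contraction h hrm hb hb' hp0 hp hx hx' hk hl hi]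
    ring
  · push Not at hi
    obtain ⟨i, hc, hi⟩ := hi
    rw [wordCoef_eq_zero hp h hc hi]
    ring

end Data

namespace Data

/-! ### Holomorphy of the continued product -/

variable {D : Data n} {p z w : ℂ → ℂ} {t₀ : ℂ}

theorem differentiableAt_decCre (hp : DifferentiableAt ℂ p t₀) (hp1 : ‖p t₀‖ < 1)
    (hz : DifferentiableAt ℂ z t₀) (hz0 : z t₀ ≠ 0) (j : Fin n) (M : Mode n) :
    DifferentiableAt ℂ (fun t => D.decCre (p t) j (z t) M) t₀ := by
  rcases M with ⟨a, k⟩ | ⟨a, k⟩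
  · simp only [decCre_inl]
    have := one_sub_pow_ne_zero hp1 k
    fun_prop (disch := assumption)
  · simp only [decCre_inr]
    have := one_sub_pow_ne_zero hp1 k
    have := pow_ne_zero (k : ℕ) hz0
    fun_prop (disch := assumption)

theorem differentiableAt_decAnn (h : D.Generic) (hp : DifferentiableAt ℂ p t₀) (hp0 : p t₀ ≠ 0)
    (hp1 : ‖p t₀‖ < 1) (hz : DifferentiableAt ℂ z t₀) (hz0 : z t₀ ≠ 0) (j : Fin n) (M : Mode n) :
    DifferentiableAt ℂ (fun t => D.decAnn (p t) j (z t) M * D.comm (p t) M) t₀ := by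
  rcases M with ⟨a, k⟩ | ⟨a, k⟩
  · simp only [decAnn_inl h, comm]
    have := one_sub_pow_ne_zero hp1 k
    have := pow_ne_zero (k : ℕ) hz0
    fun_prop (disch := assumption)
  · simp only [decAnn_inr h, comm]
    have := one_sub_pow_ne_zero hp1 k
    have := pow_ne_zero (k : ℕ) hp0
    fun_prop (disch := assumption)

theorem differentiableAt_pair_entry (h : D.Generic) (hp : DifferentiableAt ℂ p t₀) (hp0 : p t₀ ≠ 0)
    (hp1 : ‖p t₀‖ < 1) (hz : DifferentiableAt ℂ z t₀) (hz0 : z t₀ ≠ 0)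
    (hw : DifferentiableAt ℂ w t₀) (hw0 : w t₀ ≠ 0) (k l : Fin n → ℕ) (mu lam : Mode n →₀ ℕ) :
    DifferentiableAt ℂ (fun t => entry (D.expOp (p t)
      (D.wordCre (p t) k (z t) + D.wordCre (p t) l (w t))
      (D.wordAnn (p t) k (z t) + D.wordAnn (p t) l (w t))) mu lam) t₀ := by
  have hq : ∀ N : ℕ, (D.q 2 ^ N)⁻¹ ≠ 0 := fun N => inv_ne_zero (pow_ne_zero _ (h.q_ne_zero 2))
  refine differentiableAt_entry_expOp D (fun M => ?_) (fun M => ?_) mu lam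
  · simp only [Pi.add_apply, wordCre]
    exact (DifferentiableAt.fun_sum fun i _ => DifferentiableAt.fun_sum fun a _ =>
        differentiableAt_decCre hp hp1 (hz.const_mul _) (mul_ne_zero (hq _) hz0) i M).add
      (DifferentiableAt.fun_sum fun i _ => DifferentiableAt.fun_sum fun a _ =>
        differentiableAt_decCre hp hp1 (hw.const_mul _) (mul_ne_zero (hq _) hw0) i M)
  · simp only [Pi.add_apply, wordAnn, add_mul, Finset.sum_mul]
    exact (DifferentiableAt.fun_sum fun i _ => DifferentiableAt.fun_sum fun a _ =>
        differentiableAt_decAnn h hp hp0 hp1 (hz.const_mul _) (mul_ne_zero (hq _) hz0) i M).add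
      (DifferentiableAt.fun_sum fun i _ => DifferentiableAt.fun_sum fun a _ =>
        differentiableAt_decAnn h hp hp0 hp1 (hw.const_mul _) (mul_ne_zero (hq _) hw0) i M)

/-- Along the curve `t ↦ (p t, x t)`, all functions `theta (p t) (c * x t)` are differentiable
at `t₀`. -/
def ThetaCurve (p x : ℂ → ℂ) (t₀ : ℂ) : Prop :=
  ∀ c : ℂ, c ≠ 0 → DifferentiableAt ℂ (fun t => theta (p t) (c * x t)) t₀

theorem thetaCurve_nome {p₀ : ℂ} (hp : ‖p₀‖ < 1) (x : ℂ) : ThetaCurve (fun p => p) (fun _ => x) p₀ :=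
  fun c _ => differentiableAt_theta_nome hp (c * x)

theorem thetaCurve_arg {p₀ : ℂ} (hp : ‖p₀‖ < 1) {x : ℂ → ℂ} (hx : DifferentiableAt ℂ x t₀)
    (hx0 : x t₀ ≠ 0) : ThetaCurve (fun _ => p₀) x t₀ := by
  intro c hc
  have h : DifferentiableAt ℂ (theta p₀) (c * x t₀) := differentiableAt_theta hp (mul_ne_zero hc hx0)
  exact h.comp t₀ (hx.const_mul c)

theorem differentiableAt_blockCoef (h : D.Generic) {N : ℕ} (hp : D.Nome (p t₀) N)
    (hT : ThetaCurve p (fun _ => 1) t₀) (i : Fin n) {k : ℕ} (hk : k ≤ N) :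
    DifferentiableAt ℂ (fun t => D.blockCoef (p t) i k) t₀ := by
  have hT' : ∀ c : ℂ, c ≠ 0 → DifferentiableAt ℂ (fun t => theta (p t) c) t₀ := fun c hc => by
    simpa using hT c hc
  have h2 := h.q_ne_zero 2
  refine (DifferentiableAt.div ?_ ?_ ?_).const_mul _
  · refine DifferentiableAt.fun_finsetProd fun j _ => hT' _ ?_
    exact mul_ne_zero (pow_ne_zero _ h2) (mul_ne_zero (zpow_ne_zero _ h2) (h.q_ne_zero _))
  · exact DifferentiableAt.fun_finsetProd fun j _ => hT' _ (mul_ne_zero (pow_ne_zero _ h2) h2)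
  · refine Finset.prod_ne_zero_iff.2 fun j hj => ?_
    have := Finset.mem_range.1 hj
    rw [← pow_succ]
    exact theta_ne_zero (norm_pos_iff.1 hp.1) hp.2.1 (pow_ne_zero _ h2)
      (hp.2.2 (j + 1) (by omega) (by omega))

theorem differentiableAt_wordCoef (h : D.Generic) {N : ℕ} (hp : D.Nome (p t₀) N)
    (hT : ThetaCurve p (fun _ => 1) t₀) {k : Fin n → ℕ} (hk : ∀ i, k i ≤ N) :
    DifferentiableAt ℂ (fun t => D.wordCoef (p t) k) t₀ :=
  (DifferentiableAt.fun_finsetProd fun i _ =>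
    differentiableAt_blockCoef h hp hT i (hk i)).const_mul _

theorem arg_ne_zero (h : D.Generic) (A B : ℕ) {g : ℂ} (hg : g ≠ 0) : D.arg A B g ≠ 0 :=
  mul_ne_zero (mul_ne_zero (pow_ne_zero _ (h.q_ne_zero 2))
    (inv_ne_zero (pow_ne_zero _ (h.q_ne_zero 2)))) hg

theorem arg_eq_zpow (h : D.Generic) (A B : ℕ) : D.arg A B 1 = D.q 2 ^ ((A : ℤ) - B) := by
  rw [arg, mul_one, zpow_sub₀ (h.q_ne_zero 2), zpow_natCast, zpow_natCast, div_eq_mul_inv]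

theorem arg_q_eq_zpow (h : D.Generic) (A B : ℕ) : D.arg A B (D.q 2) = D.q 2 ^ ((A : ℤ) + 1 - B) := by
  rw [arg, zpow_sub₀ (h.q_ne_zero 2), zpow_add₀ (h.q_ne_zero 2), zpow_natCast, zpow_natCast, zpow_one,
    div_eq_mul_inv]
  ring

theorem differentiableAt_rowTheta (h : D.Generic) {x : ℂ → ℂ} (hT : ThetaCurve p x t₀) (c : Fin 3)
    (A B l : ℕ) (h3 : theta (p t₀) (D.arg A (B + l) 1 * x t₀) ≠ 0)
    (h4 : theta (p t₀) (D.arg A B (D.q 2) * x t₀) ≠ 0) :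
    DifferentiableAt ℂ (fun t => D.rowTheta (p t) c A B l (x t)) t₀ := by
  simp only [rowTheta]
  split_ifs
  · exact differentiableAt_const _
  · exact ((hT _ (arg_ne_zero h _ _ (inv_ne_zero (h.q_ne_zero _)))).mul
      (hT _ (arg_ne_zero h _ _ (inv_ne_zero (h.q_ne_zero _))))).div
      ((hT _ (arg_ne_zero h _ _ one_ne_zero)).mul (hT _ (arg_ne_zero h _ _ (h.q_ne_zero 2))))
      (mul_ne_zero h3 h4)

theorem letter_lt {r : ℕ} {k : Fin n → ℕ} (hk : k ∈ comps n r) {i : Fin n} {a : ℕ}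
    (ha : a ∈ Finset.range (k i)) : offset k i + a < r := by
  have h1 := offset_add_le k i
  rw [mem_comps.1 hk] at h1
  have := Finset.mem_range.1 ha
  omega

theorem block_le {m : ℕ} {l : Fin n → ℕ} (hl : l ∈ comps n m) (i : Fin n) :
    offset l i + l i ≤ m := mem_comps.1 hl ▸ offset_add_le l i

/-- Working along a curve covers the three variables by one argument. The denominators are thetas at
`q_3^j x` with `j = A - B - l` or `j = A + 1 - B`; from `A < r` and `B + l ≤ m` follows `-m ≤ j ≤
r`, the range excluded in `Regular`. -/
theorem differentiableAt_continuation (h : D.Generic) {r m : ℕ} (hp : DifferentiableAt ℂ p t₀)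
    (hz : DifferentiableAt ℂ z t₀) (hw : DifferentiableAt ℂ w t₀)
    (hreg : D.Regular (p t₀) r m (z t₀) (w t₀)) (hT : ThetaCurve p (fun _ => 1) t₀)
    (hT' : ThetaCurve p (fun t => w t / z t) t₀) (mu lam : Mode n →₀ ℕ) :
    DifferentiableAt ℂ (fun t => D.continuation r m mu lam (p t) (z t) (w t)) t₀ := by
  obtain ⟨hN, hz0, hw0, hreg⟩ := hreg
  have hp0 := norm_pos_iff.1 hN.1
  have hne : ∀ j : ℤ, -(m : ℤ) ≤ j → j ≤ r → theta (p t₀) (D.q 2 ^ j * (w t₀ / z t₀)) ≠ 0 :=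
    fun j h1 h2 => theta_ne_zero hp0 hN.2.1
      (mul_ne_zero (zpow_ne_zero _ (h.q_ne_zero 2)) (div_ne_zero hw0 hz0)) (hreg j h1 h2)
  refine DifferentiableAt.fun_sum fun k hk => DifferentiableAt.fun_sum fun l hl => ?_
  refine ((differentiableAt_wordCoef h hN hT fun i => ?_).mul
    (differentiableAt_wordCoef h hN hT fun i => ?_)).mul
    ((DifferentiableAt.fun_finsetProd fun i _ => DifferentiableAt.fun_finsetProd fun a ha =>
      differentiableAt_rowTheta h hT' _ _ _ _ ?_ ?_).mul
      (differentiableAt_pair_entry h hp hp0 hN.2.1 hz hz0 hw hw0 k l mu lam))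
  · have := block_le hk i
    omega
  · have := block_le hl i
    omega
  · have := letter_lt hk ha
    have := block_le hl i
    rw [arg_eq_zpow h]
    exact hne _ (by omega) (by omega)
  · have := letter_lt hk ha
    have := block_le hl i
    rw [arg_q_eq_zpow h]
    exact hne _ (by omega) (by omega)

end Data

/-! ### Splitting compositions -/

theorem prod_blocks {M : Type*} [CommMonoid M] {N : ℕ} (k : Fin N → ℕ) (g : ℕ → M) :
    ∏ i, ∏ a ∈ Finset.range (k i), g (offset k i + a) = ∏ a ∈ Finset.range (∑ i, k i), g a := by
  induction N generalizing g with
  | zero => simp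
  | succ N ih =>
    have hk : k = Fin.cons (k 0) (Fin.tail k) := (Fin.cons_self_tail k).symm
    rw [hk, Fin.prod_univ_succ, Fin.sum_univ_succ, Finset.prod_range_add, offset_cons_zero]
    simp only [offset_cons_succ, Fin.cons_succ, Fin.cons_zero, zero_add, add_assoc]
    rw [← ih (Fin.tail k) fun a => g (k 0 + a)]

theorem offset_add (k l : Fin n → ℕ) (i : Fin n) : offset (k + l) i = offset k i + offset l i := by
  simp only [offset, Pi.add_apply, Finset.sum_add_distrib]

theorem offset_add_le_offset (l : Fin n → ℕ) {j i : Fin n} (h : j < i) :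
    offset l j + l j ≤ offset l i := by
  rw [← offsetNat_succ, offset_eq_offsetNat]
  refine Finset.sum_le_sum_of_subset fun a ha => ?_
  simp only [Finset.mem_filter, Finset.mem_univ, true_and, Fin.lt_def] at ha h ⊢
  omega

theorem exists_of_offset_ne_zero {k : Fin n → ℕ} {i : Fin n} (h : offset k i ≠ 0) :
    ∃ j < i, k j ≠ 0 := by
  obtain ⟨j, hj, hk⟩ := Finset.exists_ne_zero_of_sum_ne_zero h
  exact ⟨j, Finset.mem_Iio.1 hj, hk⟩

/-- The letters of `k` come after those of the composition `l` of `m`, so that `k + l` is obtained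
by concatenation. -/
def Joined (m : ℕ) (k l : Fin n → ℕ) : Prop := ∀ i, k i ≠ 0 → offset l i + l i = m

/-- A letter of `k` in an earlier tensor factor already forces `l` to be exhausted there. Hence `k`
and `l` can share at most one tensor factor. -/
theorem Joined.offset_eq {m : ℕ} {k l : Fin n → ℕ} (hl : l ∈ comps n m) (h : Joined m k l)
    {i : Fin n} (hi : offset k i ≠ 0) : offset l i = m ∧ l i = 0 := by
  obtain ⟨j, hj, hk⟩ := exists_of_offset_ne_zero hi
  have h1 := h j hk
  have h2 := offset_add_le_offset l hj
  have h3 := Data.block_le hl i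
  omega

/-- The first `m` letters of a composition. -/
def initial (m : ℕ) (N : Fin n → ℕ) (i : Fin n) : ℕ :=
  min (offset N i + N i) m - min (offset N i) m

theorem offsetNat_initial (m : ℕ) (N : Fin n → ℕ) {i : ℕ} (hi : i ≤ n) :
    offsetNat (initial m N) i = min (offsetNat N i) m := by
  induction i with
  | zero => simp [offsetNat_zero]
  | succ i ih =>
    have h1 := offsetNat_succ (initial m N) ⟨i, hi⟩
    have h2 := offsetNat_succ N ⟨i, hi⟩
    rw [offset_eq_offsetNat] at h1 h2
    simp only [initial, offset_eq_offsetNat] at h1 h2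
    have := ih (by omega)
    omega

theorem offset_initial (m : ℕ) (N : Fin n → ℕ) (i : Fin n) :
    offset (initial m N) i = min (offset N i) m := by
  rw [offset_eq_offsetNat, offset_eq_offsetNat, offsetNat_initial m N i.2.le]

theorem initial_le (m : ℕ) (N : Fin n → ℕ) : initial m N ≤ N := fun i => by
  simp only [initial]; omega

/-- Concatenation is inverse to cutting after the first `m` letters. The cut may fall inside a
block, which is then divided between `k` and `l`. -/
theorem sum_joined (r m : ℕ) (X : (Fin n → ℕ) → ℂ) [DecidablePred fun x : (Fin n → ℕ) × (Fin n → ℕ) =>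
    Joined m x.1 x.2] :
    ∑ x ∈ (comps n r ×ˢ comps n m).filter (fun x => Joined m x.1 x.2), X (x.1 + x.2)
      = ∑ N ∈ comps n (m + r), X N := by
  refine Finset.sum_bij' (fun x _ => x.1 + x.2) (fun N _ => (N - initial m N, initial m N))
    ?_ ?_ ?_ ?_ ?_
  · rintro ⟨k, l⟩ hx
    simp only [Finset.mem_filter, Finset.mem_product, mem_comps] at hx
    simp only [mem_comps, Pi.add_apply, Finset.sum_add_distrib]
    omega
  · intro N hN
    rw [mem_comps] at hN
    have h1 : ∑ i, initial m N i = m := by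
      rw [← offsetNat_last, offsetNat_initial m N le_rfl, offsetNat_last, hN]
      omega
    have h2 : ∑ i, (N - initial m N) i + ∑ i, initial m N i = ∑ i, N i := by
      rw [← Finset.sum_add_distrib]
      exact Finset.sum_congr rfl fun i _ => Nat.sub_add_cancel (initial_le m N i)
    simp only [Finset.mem_filter, Finset.mem_product, mem_comps]
    refine ⟨⟨by omega, h1⟩, fun i hi => ?_⟩
    rw [offset_initial]
    simp only [Pi.sub_apply, initial] at hi ⊢
    omega
  · rintro ⟨k, l⟩ hx
    simp only [Finset.mem_filter, Finset.mem_product] at hx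
    obtain ⟨⟨hk, hl⟩, hj⟩ := hx
    have hi : initial m (k + l) = l := by
      funext i
      have h1 := Data.block_le hl i
      rw [initial, offset_add, Pi.add_apply]
      by_cases h2 : offset k i = 0
      · by_cases h3 : k i = 0
        · omega
        · have := hj i h3
          omega
      · have := hj.offset_eq hl h2
        omega
    simp only [hi]
    ext1
    · exact add_tsub_cancel_right k l
    · rfl
  · intro N _
    exact tsub_add_cancel_of_le (initial_le m N)
  · intros
    rfl

/-! ### Joined words at the pole -/

namespace Data

variable {D : Data n} {p : ℂ}

/-- At `z = q_3^{-m} w` the product of two joined monomials is the monomial of their sum. -/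
theorem letters_joined {E : Type*} [AddCommMonoid E] {m : ℕ} {k l : Fin n → ℕ}
    (hl : l ∈ comps n m) (hj : Joined m k l) (w : ℂ) (F : Fin n → ℂ → E) :
    (∑ i, ∑ a ∈ Finset.range (k i), F i ((D.q 2 ^ (offset k i + a))⁻¹ * ((D.q 2 ^ m)⁻¹ * w)))
        + ∑ i, ∑ b ∈ Finset.range (l i), F i ((D.q 2 ^ (offset l i + b))⁻¹ * w)
      = ∑ i, ∑ a ∈ Finset.range ((k + l) i), F i ((D.q 2 ^ (offset (k + l) i + a))⁻¹ * w) := by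
  rw [← Finset.sum_add_distrib]
  refine Finset.sum_congr rfl fun i _ => ?_
  rw [Pi.add_apply, add_comm (k i), Finset.sum_range_add, add_comm, offset_add]
  congr 1
  · refine Finset.sum_congr rfl fun b hb => ?_
    have := Finset.mem_range.1 hb
    have h0 : offset k i = 0 := by
      by_contra h0
      have := hj.offset_eq hl h0
      omega
    rw [h0, zero_add]
  · refine Finset.sum_congr rfl fun a ha => ?_
    have h1 := Finset.mem_range.1 ha
    have := hj i (by omega)
    rw [← mul_assoc, ← mul_inv, ← pow_add]
    congr 4
    omega

theorem wordCre_joined {m : ℕ} {k l : Fin n → ℕ}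
    (hl : l ∈ comps n m) (hj : Joined m k l) (w : ℂ) :
    D.wordCre p k ((D.q 2 ^ m)⁻¹ * w) + D.wordCre p l w = D.wordCre p (k + l) w := by
  funext M
  exact letters_joined hl hj w fun i ζ => D.decCre p i ζ M

theorem wordAnn_joined {m : ℕ} {k l : Fin n → ℕ}
    (hl : l ∈ comps n m) (hj : Joined m k l) (w : ℂ) :
    D.wordAnn p k ((D.q 2 ^ m)⁻¹ * w) + D.wordAnn p l w = D.wordAnn p (k + l) w := by
  funext M
  exact letters_joined hl hj w fun i ζ => D.decAnn p i ζ M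

/-! ### The fusion coefficients -/

variable (D p) in
/-- `θ_p(q_3^A)`, with the zero at `A = 0` removed. -/
def thetaReg (A : ℕ) : ℂ := if A = 0 then 1 else theta p (D.q 2 ^ A)

variable (D p) in
/-- The `A`-th factor of the fusion constant. -/
def fusionFactor (A : ℕ) : ℂ :=
  theta p (D.q 2 ^ A * (D.q 0)⁻¹) * theta p (D.q 2 ^ A * (D.q 1)⁻¹)
    / (D.thetaReg p A * theta p (D.q 2 ^ (A + 1)))

variable (D p) in
/-- The regularized value at `x = q_3^m` of the factor of a letter. -/
def rowLim (m : ℕ) (c : Fin 3) (A B l : ℕ) : ℂ :=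
  if A = 0 then
    if (c = 2 ∧ l ≠ 0) ∨ B + l ≠ m then 0 else
      theta p (D.arg 0 B (D.q (colA c))⁻¹ * D.q 2 ^ m) * theta p (D.arg 0 m (D.q (colB c))⁻¹ * D.q 2 ^ m)
        / theta p (D.arg 0 B (D.q 2) * D.q 2 ^ m)
  else D.rowTheta p c A B l (D.q 2 ^ m)

theorem arg_mul_pow (h : D.Generic) (A : ℕ) {B m : ℕ} (hB : B ≤ m) (g : ℂ) :
    D.arg A B g * D.q 2 ^ m = D.q 2 ^ (A + (m - B)) * g := by
  obtain ⟨e, rfl⟩ := Nat.exists_eq_add_of_le hB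
  have := pow_ne_zero B (h.q_ne_zero 2)
  rw [arg, Nat.add_sub_cancel_left, pow_add, pow_add]
  field_simp

theorem rowLim_eq (h : D.Generic) {m : ℕ} (c : Fin 3) (A : ℕ) {B l : ℕ} (hB : B + l = m)
    (hc : ¬ (c = 2 ∧ l ≠ 0)) :
    D.rowLim p m c A B l = theta p (D.q 2 ^ (A + l) * (D.q (colA c))⁻¹)
      * theta p (D.q 2 ^ A * (D.q (colB c))⁻¹)
      / (D.thetaReg p A * theta p (D.q 2 ^ (A + l + 1))) := by
  have e1 : m - B = l := by omega
  have e2 : m - (B + l) = 0 := by omega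
  rw [rowLim, thetaReg]
  split_ifs with hA h1
  · exact absurd hB (h1.resolve_left hc)
  · rw [arg_mul_pow h _ (by omega), arg_mul_pow h _ le_rfl, arg_mul_pow h _ (by omega), e1,
      Nat.sub_self, hA, one_mul, ← pow_succ]
  · rw [rowTheta, if_neg hc, arg_mul_pow h _ (by omega), arg_mul_pow h _ (by omega),
      arg_mul_pow h _ (by omega), arg_mul_pow h _ (by omega), e1, e2, add_zero, mul_one, ← pow_succ]

/-- Reversing the numerator product and inverting each theta yields monomials that absorb the power
`q_3^{k²/2}`. The resulting form, one factor per letter, can be split at any position in a block. -/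
theorem blockCoef_eq_prod (h : D.Generic) (hp : ‖p‖ < 1) (i : Fin n) (k : ℕ) :
    D.blockCoef p i k = ∏ j ∈ Finset.range k, (-(D.qh (D.c i) * D.qh 2)
      * (theta p (D.q 2 ^ j * (D.q (D.c i))⁻¹) / theta p (D.q 2 ^ (j + 1)))) := by
  have h2 := h.q_ne_zero 2
  have hh2 := h.qh_ne_zero 2
  have hc := h.qh_ne_zero (D.c i)
  -- `k²` is the sum of the first `k` odd numbers, one for each letter.
  have hsq : D.qh 2 ^ (k ^ 2) = ∏ j ∈ Finset.range k, D.qh 2 ^ (2 * j + 1) := by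
    rw [Finset.prod_pow_eq_pow_sum]
    congr 1
    induction k with
    | zero => simp
    | succ k ih => rw [Finset.sum_range_succ, ← ih]; ring
  have hnum : thetaShift p (D.q 2) (D.q 2 ^ (1 - (k : ℤ)) * D.q (D.c i)) k
      = ∏ j ∈ Finset.range k, theta p ((D.q 2 ^ j * (D.q (D.c i))⁻¹)⁻¹) := by
    rw [thetaShift, ← Finset.prod_range_reflect]
    refine Finset.prod_congr rfl fun j hj => ?_
    have hj := Finset.mem_range.1 hj
    congr 1
    rw [mul_inv, inv_inv, ← mul_assoc, ← zpow_natCast, ← zpow_natCast, ← zpow_neg, ← zpow_add₀ h2]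
    congr 2
    omega
  rw [blockCoef, hsq, hnum, thetaShift, ← Finset.prod_div_distrib, ← inv_pow,
    Finset.pow_eq_prod_const, ← Finset.prod_mul_distrib, ← Finset.prod_mul_distrib]
  refine Finset.prod_congr rfl fun j _ => ?_
  rw [theta_inv hp (mul_ne_zero (pow_ne_zero _ h2) (inv_ne_zero (h.q_ne_zero _))), mul_inv, inv_inv,
    ← pow_succ, ← qh_sq D (D.c i), ← qh_sq D 2, ← pow_mul, ← pow_mul]
  generalize theta p _ = x
  generalize theta p _ = y
  have := pow_ne_zero (2 * j) hh2
  rw [pow_succ (D.qh 2) (2 * j)]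
  field_simp

theorem colA_colB (c : Fin 3) (f : ℂ → ℂ) :
    f (D.q (colA c))⁻¹ * f (D.q (colB c))⁻¹ = f (D.q 0)⁻¹ * f (D.q 1)⁻¹ := by
  rw [colA, colB]
  split_ifs
  · rw [mul_comm]
  · rfl

/-- In a factor occupied by `k` alone, each `rowLim` is already a fusion factor. In the factor where
the cut falls, `rowLim` supplies the thetas that prolong the block coefficient from `l i` to `l i +
k i` letters, and its other thetas complete those of `blockCoef p i (k i)` to fusion factors. -/
theorem block_fusion (h : D.Generic) (hp : ‖p‖ < 1) {m : ℕ} {k l : Fin n → ℕ}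
    (hl : l ∈ comps n m) (hj : Joined m k l) (i : Fin n) :
    D.blockCoef p i (k i) * D.blockCoef p i (l i)
        * ∏ a ∈ Finset.range (k i), D.rowLim p m (D.c i) (offset k i + a) (offset l i) (l i)
      = D.blockCoef p i ((k + l) i)
        * ∏ a ∈ Finset.range (k i), D.fusionFactor p (offset k i + a) := by
  have hb0 : D.blockCoef p i 0 = 1 := by rw [blockCoef_eq_prod h hp, Finset.prod_range_zero]
  rw [Pi.add_apply]
  by_cases hk : k i = 0
  · rw [hk, Finset.prod_range_zero, Finset.prod_range_zero, hb0, zero_add, one_mul]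
  have hB := hj i hk
  by_cases hl0 : l i = 0
  · rw [hl0, hb0, mul_one, add_zero]
    congr 1
    refine Finset.prod_congr rfl fun a _ => ?_
    rw [rowLim_eq h _ _ (by omega) (by simp), fusionFactor, add_zero,
      colA_colB (D.c i) fun y => theta p (D.q 2 ^ (offset k i + a) * y)]
  have hk0 : offset k i = 0 := by
    by_contra h0
    exact hl0 (hj.offset_eq hl h0).2
  -- For colour 3 both sides vanish: the joined block has length at least `2`, and the first letter
  -- has no pole, so its regularized row is `0`.
  by_cases hc : D.c i = 2
  · rw [blockCoef_eq_zero hp h hc (by omega : 2 ≤ k i + l i), zero_mul]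
    refine mul_eq_zero_of_right _ (Finset.prod_eq_zero (Finset.mem_range.2 (Nat.pos_of_ne_zero hk)) ?_)
    rw [hk0, rowLim, if_pos rfl, if_pos (Or.inl ⟨hc, hl0⟩)]
  · have hcA : colA (D.c i) = D.c i := by
      rw [colA]
      split_ifs with h1
      · exact h1.symm
      · omega
    rw [add_comm (k i), blockCoef_eq_prod h hp i (l i + k i), Finset.prod_range_add,
      ← blockCoef_eq_prod h hp, blockCoef_eq_prod h hp i (k i), mul_right_comm, mul_comm, mul_assoc,
      ← Finset.prod_mul_distrib, ← Finset.prod_mul_distrib]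
    congr 1
    refine Finset.prod_congr rfl fun a _ => ?_
    have hcol := colA_colB (D := D) (D.c i) fun y => theta p (D.q 2 ^ a * y)
    rw [hk0, zero_add, rowLim_eq h _ _ hB (fun h => hc h.1), fusionFactor, ← hcol, hcA, add_comm (l i)]
    simp only [div_eq_mul_inv, mul_inv]
    ring

/-- The factor at `A = 0` is the prefactor of the constant. In the others all four thetas are
inverted, and the resulting monomials cancel because `q_1 q_2 q_3 = 1`. -/
theorem prod_fusionFactor (h : D.Generic) (hp : ‖p‖ < 1) {r : ℕ} (hr : 1 ≤ r) :
    ∏ A ∈ Finset.range r, D.fusionFactor p A = D.fusionConst p r := by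
  obtain ⟨s, rfl⟩ := Nat.exists_eq_add_of_le' hr
  have h2 := h.q_ne_zero 2
  have hI : Finset.Icc 1 s = Finset.Ico 1 (s + 1) := by
    ext; simp only [Finset.mem_Icc, Finset.mem_Ico]; omega
  rw [Finset.prod_range_succ', mul_comm, fusionConst, Nat.add_sub_cancel, hI,
    Finset.prod_Ico_eq_prod_range, Nat.add_sub_cancel]
  congr 1
  · simp [fusionFactor, thetaReg]
  refine Finset.prod_congr rfl fun j _ => ?_
  rw [add_comm 1 j]
  have hl := pow_ne_zero (j + 1) h2
  have e : ∀ i : Fin 3, theta p (D.q i * (D.q 2 ^ (j + 1))⁻¹)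
      = -(D.q i * (D.q 2 ^ (j + 1))⁻¹) * theta p (D.q 2 ^ (j + 1) * (D.q i)⁻¹) := fun i => by
    have := theta_inv hp (mul_ne_zero hl (inv_ne_zero (h.q_ne_zero i)))
    rwa [mul_inv, inv_inv, mul_comm _ (D.q i)] at this
  rw [fusionFactor, thetaReg, if_neg (Nat.succ_ne_zero j), e, e, theta_inv hp hl,
    theta_inv hp (pow_ne_zero (j + 1 + 1) h2)]
  have hq : D.q 1 * D.q 0 * D.q 2 = 1 := by rw [mul_comm (D.q 1)]; exact h.q_prod
  generalize theta p _ = x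
  generalize theta p _ = y
  generalize theta p _ = u
  generalize theta p _ = v
  have key : D.q 1 * (D.q 2 ^ (j + 1))⁻¹ * (D.q 0 * (D.q 2 ^ (j + 1))⁻¹)
      = (D.q 2 ^ (j + 1 + 1))⁻¹ * (D.q 2 ^ (j + 1))⁻¹ := by
    rw [pow_succ _ (j + 1)]
    field_simp
    linear_combination hq
  have hu := mul_ne_zero (inv_ne_zero (pow_ne_zero (j + 1 + 1) h2)) (inv_ne_zero hl)
  symm
  calc _ = (D.q 1 * (D.q 2 ^ (j + 1))⁻¹ * (D.q 0 * (D.q 2 ^ (j + 1))⁻¹)) * (x * y)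
        / ((D.q 2 ^ (j + 1 + 1))⁻¹ * (D.q 2 ^ (j + 1))⁻¹ * (u * v)) := by ring
    _ = _ := by rw [key, mul_div_mul_left _ _ hu]

end Data

/-- The annulus `‖p‖ < ‖y‖ < ‖p‖⁻¹` contains no integral power of `p` except `1`. This allows
cancelling the vanishing theta on a punctured neighbourhood. -/
theorem eventually_theta_ne_zero {p : ℂ} (hp0 : p ≠ 0) (hp : ‖p‖ < 1) :
    ∀ᶠ y in 𝓝[≠] (1 : ℂ), theta p y ≠ 0 := by
  have hp0' := norm_pos_iff.2 hp0
  have hn : ContinuousAt (fun y : ℂ => ‖y‖) 1 := continuous_norm.continuousAt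
  have h1 : ∀ᶠ y : ℂ in 𝓝 1, ‖p‖ < ‖y‖ := hn.eventually (lt_mem_nhds (by simpa using hp))
  have h2 : ∀ᶠ y : ℂ in 𝓝 1, ‖y‖ < ‖p‖⁻¹ :=
    hn.eventually (gt_mem_nhds (by simpa using (one_lt_inv₀ hp0').2 hp))
  filter_upwards [h1.filter_mono nhdsWithin_le_nhds, h2.filter_mono nhdsWithin_le_nhds,
    self_mem_nhdsWithin] with y h1 h2 h3
  refine theta_ne_zero hp0 hp (norm_pos_iff.1 (hp0'.trans h1)) fun k hk => ?_
  rw [hk, norm_zpow] at h1 h2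
  have h4 : k < 1 := by
    rwa [← zpow_lt_zpow_iff_right_of_lt_one₀ hp0' hp, zpow_one]
  have h5 : -1 < k := by
    rwa [← zpow_lt_zpow_iff_right_of_lt_one₀ hp0' hp, zpow_neg_one]
  have h6 : k = 0 := by omega
  rw [h6, zpow_zero] at hk
  exact h3 hk

namespace Data

variable {D : Data n} {p : ℂ}

/-! ### The limit of the continued product -/

theorem theta_pow_ne_zero (h : D.Generic) {N : ℕ} (hp : D.Nome p N) {e : ℕ} (h1 : 1 ≤ e)
    (h2 : e ≤ N) : theta p (D.q 2 ^ e) ≠ 0 :=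
  theta_ne_zero (norm_pos_iff.1 hp.1) hp.2.1 (pow_ne_zero _ (h.q_ne_zero 2)) (hp.2.2 e h1 h2)

/-- The one available theta zero is assigned to the letter in position `A = 0`, since all other rows
are regular at `q_3^m`. That row can have a pole only if `B + l = m`, and then the offending
denominator is exactly the assigned theta. -/
theorem tendsto_rowTheta (h : D.Generic) {r m : ℕ} (hp : D.Nome p (m + r)) (c : Fin 3) {A B l : ℕ}
    (hA : A < r) (hB : B + l ≤ m) :
    Tendsto (fun x => (if A = 0 then theta p ((D.q 2 ^ m)⁻¹ * x) else 1) * D.rowTheta p c A B l x)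
      (𝓝[≠] (D.q 2 ^ m)) (𝓝 (D.rowLim p m c A B l)) := by
  have hqm := pow_ne_zero m (h.q_ne_zero 2)
  have hT : ThetaCurve (fun _ => p) (fun x => x) (D.q 2 ^ m) :=
    thetaCurve_arg hp.2.1 differentiableAt_fun_id hqm
  have hθ : Tendsto (fun x => theta p ((D.q 2 ^ m)⁻¹ * x)) (𝓝[≠] (D.q 2 ^ m)) (𝓝 0) := by
    have := (hT _ (inv_ne_zero hqm)).continuousAt.tendsto.mono_left
      (nhdsWithin_le_nhds (s := {D.q 2 ^ m}ᶜ))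
    rwa [inv_mul_cancel₀ hqm, theta_one hp.2.1] at this
  have h4 : theta p (D.arg A B (D.q 2) * D.q 2 ^ m) ≠ 0 := by
    rw [arg_mul_pow h _ (by omega), ← pow_succ]
    exact theta_pow_ne_zero h hp (by omega) (by omega)
  have hrow : A + (m - (B + l)) ≠ 0 → Tendsto (D.rowTheta p c A B l) (𝓝[≠] (D.q 2 ^ m))
      (𝓝 (D.rowTheta p c A B l (D.q 2 ^ m))) := fun hne => by
    refine (differentiableAt_rowTheta h hT c A B l ?_ h4).continuousAt.tendsto.mono_left
      nhdsWithin_le_nhds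
    rw [arg_mul_pow h _ hB, mul_one]
    exact theta_pow_ne_zero h hp (by omega) (by omega)
  rw [rowLim]
  by_cases h0 : A = 0
  swap
  · simp only [if_neg h0, one_mul]
    exact hrow (by omega)
  simp only [if_pos h0]
  split_ifs with h1
  · by_cases h2 : B + l = m
    · have hc : c = 2 ∧ l ≠ 0 := h1.resolve_right (not_not.2 h2)
      simpa only [rowTheta, if_pos hc, mul_one] using hθ
    · simpa only [zero_mul] using hθ.mul (hrow (by omega))
  · push Not at h1
    have hc : ¬ (c = 2 ∧ l ≠ 0) := fun hc => hc.2 (h1.1 hc.1)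
    obtain rfl := h1.2
    subst h0
    have hy : Tendsto (fun x => (D.q 2 ^ (B + l))⁻¹ * x) (𝓝[≠] (D.q 2 ^ (B + l))) (𝓝[≠] 1) := by
      refine tendsto_nhdsWithin_iff.2 ⟨?_, ?_⟩
      · rw [← inv_mul_cancel₀ hqm]
        exact ((continuous_const_mul _).tendsto _).mono_left nhdsWithin_le_nhds
      · filter_upwards [self_mem_nhdsWithin] with x hx hx'
        exact hx ((eq_inv_mul_iff_mul_eq₀ hqm).1 (by simpa using hx'.symm) |>.symm.trans (by simp))
    have hlim := (((hT _ (arg_ne_zero h 0 B (inv_ne_zero (h.q_ne_zero (colA c))))).mul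
      (hT _ (arg_ne_zero h 0 (B + l) (inv_ne_zero (h.q_ne_zero (colB c)))))).fun_div
      (hT _ (arg_ne_zero h 0 B (h.q_ne_zero 2))) h4).continuousAt.tendsto.mono_left
      (nhdsWithin_le_nhds (s := {D.q 2 ^ (B + l)}ᶜ))
    refine hlim.congr' ?_
    filter_upwards [hy.eventually (eventually_theta_ne_zero (norm_pos_iff.1 hp.1) hp.2.1)] with x hx
    have e : D.arg 0 (B + l) 1 = (D.q 2 ^ (B + l))⁻¹ := by rw [arg, pow_zero, one_mul, mul_one]
    rw [rowTheta, if_neg hc, e, ← mul_div_assoc, mul_div_mul_left _ _ hx]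
    rfl

variable (D p) in
/-- The limit of `wordTheta` times `θ_p(q_3^{-m} x)` at `x = q_3^m`. -/
def wordLim (m : ℕ) (k l : Fin n → ℕ) : ℂ :=
  ∏ i, ∏ a ∈ Finset.range (k i), D.rowLim p m (D.c i) (offset k i + a) (offset l i) (l i)

theorem tendsto_wordTheta (h : D.Generic) {r m : ℕ} (hr : 1 ≤ r) (hp : D.Nome p (m + r))
    {k l : Fin n → ℕ} (hk : k ∈ comps n r) (hl : l ∈ comps n m) :
    Tendsto (fun x => theta p ((D.q 2 ^ m)⁻¹ * x) * D.wordTheta p k l x)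
      (𝓝[≠] (D.q 2 ^ m)) (𝓝 (D.wordLim p m k l)) := by
  have key : ∀ x, theta p ((D.q 2 ^ m)⁻¹ * x) * D.wordTheta p k l x
      = ∏ i, ∏ a ∈ Finset.range (k i),
        (if offset k i + a = 0 then theta p ((D.q 2 ^ m)⁻¹ * x) else 1)
          * D.rowTheta p (D.c i) (offset k i + a) (offset l i) (l i) x := fun x => by
    simp only [Finset.prod_mul_distrib]
    rw [prod_blocks k fun A => if A = 0 then theta p ((D.q 2 ^ m)⁻¹ * x) else 1, mem_comps.1 hk,
      Finset.prod_ite_eq' (Finset.range r) 0 fun _ => theta p ((D.q 2 ^ m)⁻¹ * x),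
      if_pos (Finset.mem_range.2 hr), wordTheta]
  simp only [key]
  exact tendsto_finsetProd _ fun i _ => tendsto_finsetProd _ fun a ha =>
    tendsto_rowTheta h hp _ (letter_lt hk ha) (block_le hl i)

/-- If `l` is exhausted at the first tensor factor used by `k`, it is exhausted at all later ones. A
pair that is not joined therefore fails at the first letter of `k`, whose row has no pole and is
killed by the theta zero. -/
theorem wordLim_eq_zero {r m : ℕ} (hr : 1 ≤ r) {k l : Fin n → ℕ} (hk : k ∈ comps n r)
    (hl : l ∈ comps n m) (hj : ¬ Joined m k l) : D.wordLim p m k l = 0 := by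
  classical
  have hex : ∃ i, k i ≠ 0 := by
    by_contra! h0
    have := mem_comps.1 hk
    simp only [h0, Finset.sum_const_zero] at this
    omega
  obtain ⟨i, hi, hmin⟩ := WellFounded.has_min (wellFounded_lt (α := Fin n)) {i | k i ≠ 0} hex
  have h0 : offset k i = 0 := by
    by_contra h0
    obtain ⟨j, hj, hkj⟩ := exists_of_offset_ne_zero h0
    exact hmin j hkj hj
  have hne : offset l i + l i ≠ m := fun he => hj fun j hkj => by
    rcases lt_trichotomy i j with hij | rfl | hij
    · have := offset_add_le_offset l hij
      have := block_le hl j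
      omega
    · exact he
    · exact absurd hij (hmin j hkj)
  refine Finset.prod_eq_zero (Finset.mem_univ i)
    (Finset.prod_eq_zero (Finset.mem_range.2 (Nat.pos_of_ne_zero hi)) ?_)
  rw [h0, rowLim, if_pos rfl, if_pos (Or.inr hne)]

theorem word_fusion (h : D.Generic) (hp : ‖p‖ < 1) {r m : ℕ} (hr : 1 ≤ r) {k l : Fin n → ℕ}
    (hk : k ∈ comps n r) (hl : l ∈ comps n m) (hj : Joined m k l) :
    D.wordCoef p k * D.wordCoef p l * D.wordLim p m k l
      = D.fusionConst p r * D.wordCoef p (k + l) := by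
  have hu : ∏ i, D.u i ^ (k + l) i = (∏ i, D.u i ^ k i) * ∏ i, D.u i ^ l i := by
    simp only [Pi.add_apply, pow_add, Finset.prod_mul_distrib]
  have hb := Finset.prod_congr rfl fun i (_ : i ∈ Finset.univ) => block_fusion h hp hl hj i
  simp only [Finset.prod_mul_distrib] at hb
  rw [prod_blocks k (D.fusionFactor p), mem_comps.1 hk, prod_fusionFactor h hp hr] at hb
  rw [wordCoef, wordCoef, wordCoef, hu, wordLim]
  linear_combination ((∏ i, D.u i ^ k i) * ∏ i, D.u i ^ l i) * hb

theorem tendsto_continuation (h : D.Generic) {r m : ℕ} (hr : 1 ≤ r) (hp : D.Nome p (m + r))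
    {w : ℂ} (hw : w ≠ 0) (mu lam : Mode n →₀ ℕ) :
    Tendsto (fun z => theta p ((D.q 2 ^ m)⁻¹ * (w / z)) * D.continuation r m mu lam p z w)
      (𝓝[≠] ((D.q 2 ^ m)⁻¹ * w))
      (𝓝 (D.fusionConst p r * entry (D.current p (m + r) w) mu lam)) := by
  classical
  have hqm := pow_ne_zero m (h.q_ne_zero 2)
  have hz0 : (D.q 2 ^ m)⁻¹ * w ≠ 0 := mul_ne_zero (inv_ne_zero hqm) hw
  have hx0 : w / ((D.q 2 ^ m)⁻¹ * w) = D.q 2 ^ m := by field_simp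
  have hx : Tendsto (fun z => w / z) (𝓝[≠] ((D.q 2 ^ m)⁻¹ * w)) (𝓝[≠] (D.q 2 ^ m)) := by
    refine tendsto_nhdsWithin_iff.2 ⟨?_, ?_⟩
    · have hc : ContinuousAt (fun z : ℂ => w / z) ((D.q 2 ^ m)⁻¹ * w) :=
        continuousAt_const.div continuousAt_id hz0
      rw [ContinuousAt, hx0] at hc
      exact hc.mono_left nhdsWithin_le_nhds
    · filter_upwards [self_mem_nhdsWithin] with z hz hz'
      refine hz ?_
      rw [Set.mem_singleton_iff] at hz' ⊢
      rw [← hz', inv_div, div_mul_cancel₀ _ hw]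
  have hent : ∀ k l : Fin n → ℕ, Tendsto (fun z => entry (D.expOp p
      (D.wordCre p k z + D.wordCre p l w) (D.wordAnn p k z + D.wordAnn p l w)) mu lam)
      (𝓝[≠] ((D.q 2 ^ m)⁻¹ * w)) (𝓝 (entry (D.expOp p
        (D.wordCre p k ((D.q 2 ^ m)⁻¹ * w) + D.wordCre p l w)
        (D.wordAnn p k ((D.q 2 ^ m)⁻¹ * w) + D.wordAnn p l w)) mu lam)) := fun k l =>
    (differentiableAt_pair_entry (p := fun _ => p) (z := fun z => z) (w := fun _ => w) h
      (differentiableAt_const _) (norm_pos_iff.1 hp.1) hp.2.1 differentiableAt_fun_id hz0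
      (differentiableAt_const _) hw k l mu lam).continuousAt.tendsto.mono_left nhdsWithin_le_nhds
  have hsum := tendsto_finsetSum (comps n r) fun k hk => tendsto_finsetSum (comps n m) fun l hl =>
    (((tendsto_wordTheta h hr hp hk hl).comp hx).mul (hent k l)).const_mul
      (D.wordCoef p k * D.wordCoef p l)
  refine (hsum.congr fun z => ?_).trans_eq ?_
  · rw [continuation, Finset.mul_sum]
    refine Finset.sum_congr rfl fun k _ => ?_
    rw [Finset.mul_sum]
    refine Finset.sum_congr rfl fun l _ => ?_
    rw [pairTerm, Function.comp_apply]
    ring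
  · congr 1
    -- The target sum over compositions of `m + r` is rewritten over joined pairs, to be compared
    -- with the limits of all pairs.
    rw [entry_current, ← sum_joined r m, Finset.sum_filter, Finset.sum_product, Finset.mul_sum]
    refine Finset.sum_congr rfl fun k hk => ?_
    rw [Finset.mul_sum]
    refine Finset.sum_congr rfl fun l hl => ?_
    split_ifs with hj
    · dsimp only at hj
      rw [wordCre_joined hl hj, wordAnn_joined hl hj, ← mul_assoc, word_fusion h hp.2.1 hr hk hl hj,
        mul_assoc]
    · rw [wordLim_eq_zero hr hk hl hj, zero_mul, mul_zero, mul_zero]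

end Data

namespace Data

/-! ### The parameters of the theorem -/

variable {D : Data n}

theorem Generic.mk_of_indep (hprod : D.qh 0 * D.qh 1 * D.qh 2 = 1)
    (hgen : ∀ L M N : ℤ, D.q 0 ^ L * D.q 1 ^ M * D.q 2 ^ N = 1 → L = M ∧ M = N)
    (hconv : ∃ ε : ℝ, 0 < ε ∧ ∀ k : ℕ, 1 ≤ k → ε ^ k ≤ ‖D.qc ^ k - 1‖) : D.Generic where
  hprod := hprod
  s_ne_zero i hi := by
    have h0 : ∏ j, D.qh j = 0 :=
      Finset.prod_eq_zero (Finset.mem_univ i) (by rw [qh, hi, zero_pow two_ne_zero])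
    rw [Fin.prod_univ_three, hprod] at h0
    exact one_ne_zero h0
  q_pow_ne_one i k hk hi := by
    -- A relation `q_i^k = 1` has exponents that are not all equal, so independence excludes it.
    have := hgen (if i = 0 then k else 0) (if i = 1 then k else 0) (if i = 2 then k else 0) (by
      fin_cases i <;> simpa using hi)
    fin_cases i <;> simp at this <;> omega
  exists_le := hconv

theorem exists_bound_dual (h : D.Generic) (r m : ℕ) :
    ∃ K, D.Bound r m K ∧ D.dual.Bound r m K := by
  obtain ⟨K, hK⟩ := exists_bound h r m
  obtain ⟨K', hK'⟩ := exists_bound h.dual r m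
  exact ⟨max K K', hK.mono (le_max_left _ _), hK'.mono (le_max_right _ _)⟩

end Data

end EllipticCorner

end

/-! ### The fusion rule -/

theorem mainTheorem3 {n : ℕ} (D : EllipticCorner.Data n)
    (hprod : D.qh 0 * D.qh 1 * D.qh 2 = 1)
    (hgen : ∀ L M N : ℤ, D.q 0 ^ L * D.q 1 ^ M * D.q 2 ^ N = 1 → L = M ∧ M = N)
    (hqc : D.qc ≠ 1)
    (hconv : ∃ ε : ℝ, 0 < ε ∧ ∀ k : ℕ, 1 ≤ k → ε ^ k ≤ ‖D.qc ^ k - 1‖)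
    (r m : ℕ) (hr : 1 ≤ r) (hrm : r ≤ m) :
    ∃ ρ : ℝ, 0 < ρ ∧ ∀ mu lam : EllipticCorner.Mode n →₀ ℕ,
      ∃ G : ℂ → ℂ → ℂ → ℂ,
        -- `G` is holomorphic in each variable on the domain
        (∀ z w : ℂ, DifferentiableOn ℂ (fun p => G p z w) {p | D.Regular p r m z w}) ∧
        (∀ p w : ℂ, DifferentiableOn ℂ (fun z => G p z w) {z | D.Regular p r m z w}) ∧
        (∀ p z : ℂ, DifferentiableOn ℂ (fun w => G p z w) {w | D.Regular p r m z w}) ∧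
        -- `G` continues the matrix element of `f_{r,m}(q_3^{(r-m)/2} w/z) T̃_r(z) T̃_m(w)`
        (∀ p z w : ℂ, D.Regular p r m z w → ‖w / z‖ < ρ → ‖p * (z / w)‖ < ρ →
          D.FConverges p r m (D.qh 2 ^ ((r : ℤ) - m) * (w / z)) ∧
          EllipticCorner.ProdConverges (D.current p r z) (D.current p m w) mu lam ∧
          G p z w = D.f p r m (D.qh 2 ^ ((r : ℤ) - m) * (w / z)) *
            EllipticCorner.prodEntry (D.current p r z) (D.current p m w) mu lam) ∧
        -- the fusion rule
        (∀ p w : ℂ, D.Nome p (m + r) → w ≠ 0 →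
          Tendsto (fun z => EllipticCorner.theta p ((D.q 2 ^ m)⁻¹ * (w / z)) * G p z w)
            (𝓝[≠] ((D.q 2 ^ m)⁻¹ * w))
            (𝓝 (D.fusionConst p r * EllipticCorner.entry (D.current p (m + r) w) mu lam))) := by
  have h := EllipticCorner.Data.Generic.mk_of_indep hprod hgen hconv
  obtain ⟨K, hb, hb'⟩ := EllipticCorner.Data.exists_bound_dual h r m
  -- `K` may be `0`, so the radius is taken to be `(K + 1)⁻¹`; it guarantees `K * ‖y‖ < 1` for both
  -- `y = w / z` and `y = p * (z / w)`.
  have hK : 0 < K + 1 := add_pos_of_nonneg_of_pos hb.nonneg one_pos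
  have hlt : ∀ y : ℂ, ‖y‖ < (K + 1)⁻¹ → K * ‖y‖ < 1 := fun y hy =>
    (mul_le_mul_of_nonneg_right (by linarith) (norm_nonneg y)).trans_lt
      ((lt_inv_mul_iff₀ hK).1 (by rwa [mul_one]))
  refine ⟨(K + 1)⁻¹, inv_pos.2 hK, fun mu lam => ⟨D.continuation r m mu lam, fun z w p hp => ?_,
    fun p w z hz => ?_, fun p z w hw => ?_, fun p z w hr hx hx' => ?_, fun p w hp hw =>
      EllipticCorner.Data.tendsto_continuation h hr hp hw mu lam⟩⟩
  · exact (EllipticCorner.Data.differentiableAt_continuation (p := fun p => p) (z := fun _ => z)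
      (w := fun _ => w) h differentiableAt_fun_id (differentiableAt_const _)
      (differentiableAt_const _) hp (EllipticCorner.Data.thetaCurve_nome hp.1.2.1 _)
      (EllipticCorner.Data.thetaCurve_nome hp.1.2.1 _) mu lam).differentiableWithinAt
  · exact (EllipticCorner.Data.differentiableAt_continuation (p := fun _ => p) (z := fun z => z)
      (w := fun _ => w) h (differentiableAt_const _) differentiableAt_fun_id
      (differentiableAt_const _) hz
      (EllipticCorner.Data.thetaCurve_arg hz.1.2.1 (differentiableAt_const _) one_ne_zero)
      (EllipticCorner.Data.thetaCurve_arg hz.1.2.1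
        ((differentiableAt_const _).fun_div differentiableAt_fun_id hz.2.1)
        (div_ne_zero hz.2.2.1 hz.2.1)) mu lam).differentiableWithinAt
  · exact (EllipticCorner.Data.differentiableAt_continuation (p := fun _ => p) (z := fun _ => z)
      (w := fun w => w) h (differentiableAt_const _) (differentiableAt_const _)
      differentiableAt_fun_id hw
      (EllipticCorner.Data.thetaCurve_arg hw.1.2.1 (differentiableAt_const _) one_ne_zero)
      (EllipticCorner.Data.thetaCurve_arg hw.1.2.1
        (differentiableAt_fun_id.fun_div (differentiableAt_const _) hw.2.1)
        (div_ne_zero hw.2.2.1 hw.2.1)) mu lam).differentiableWithinAt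
  · exact EllipticCorner.Data.continuation_eq h hrm hb hb' (norm_pos_iff.1 hr.1.1) hr.1.2.1
      (hlt _ hx) (hlt _ (by rwa [inv_div])) mu lam
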